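/- Let $Q$ be a finite connected quiver with $n$ vertices, $K$ a field, $J$ the ideal of the path algebra $KQ$ generated by the arrows, and $A = KQ/J^2$. Modules are finitely generated right modules and paths are composed from left to right. Let $A_0 = KQ/J$, the direct sum of the simple modules $S_v$. The heart of $Q$ is the full subquiver on the vertices $v$ such that $S_v$ lies in the support of both $\Omega^n(A_0)$ and $\Omega^{-n}(A_0)$ (syzygies and cosyzygies over $A$ in a minimal projective resolution, respectively a minimal injective coresolution), and the member of $Q$ is the full subquiver on the remaining vertices; $Q$ (or $A$) has no member if this is empty. For a noetherian algebra $B$ let $K_0(B)$ be the abelian group generated by the isomorphism classes $[M]$ of finitely generated $B$-modules with the relations $[M]=[M']+[M'']$ if $M\cong M'\oplus M''$ and $[P]=0$ for $P$ projective, let $\overline{\Omega}$ be the endomorphism of $K_0(B)$ with $\overline{\Omega}[M]=[\Omega M]$, and let $\langle \mathrm{add}\, M\rangle$ be the subgroup generated by the classes of the indecomposable direct summands of $M$. Put $\phi(M)=\min\{l\in\mathbb{N} : \overline{\Omega}$ is injective on $\overline{\Omega}^{\,l+s}\langle \mathrm{add}\, M\rangle$ for all $s\in\mathbb{N}\}$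 and $\phi\dim(B)=\sup_M \phi(M)$. The algebra $KQ/J^2$ of a quiver $Q$ with $n$ vertices has maximal $\phi$-dimension if its $\phi$-dimension is $n$, in case the member of $Q$ is empty, respectively $n-1$, in case the member is not empty. A partition $\pi=\{C_1,\dots,C_m\}$ of the vertex set of $Q$ is equitable if for all $i,j$ the number $b_{ij}$ of arrows that start at $v$ and end in $C_j$ is the same for all $v\in C_i$. The quotient quiver $Q/\pi$ then has the vertices $C_1,\dots,C_m$ and $b_{ij}$ arrows from $C_i$ to $C_j$, and $K(Q/\pi)/J^2$ denotes its radical square zero algebra, with $J$ the ideal of $K(Q/\pi)$ generated by the arrows. Theorem. Suppose that $A=KQ/J^2$ has no member. Then for every equitable partition $\pi$ of $Q$ into $m$ classes, the $\phi$-dimensions of $A$ and of $K(Q/\pi)/J^2$ are finite and $$m-\phi\dim\bigl(K(Q/\pi)/J^2\bigr)\ \le\ n-\phi\dim(A).$$ Moreover, $A$ has maximal $\phi$-dimension if and only if $K(Q/\pi)/J^2$ has maximal $\phi$-dimension for every equitable partition $\pi$ of $Q$. -/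

import Mathlib

noncomputable section

/-! ### Path algebras and their radical square zero quotients -/

/-- A path of the quiver `V`, with its starting vertex `src` and its ending vertex `tgt`. Paths of
length zero (one for each vertex) are included. -/
structure QuiverPath (V : Type*) [Quiver V] where
  src : V
  tgt : V
  path : Quiver.Path src tgt

/-- The path algebra `K Q` of a quiver: the vector space with basis the set of all paths. -/
def PathAlgebra (K : Type*) (V : Type*) [Field K] [Quiver V] := QuiverPath V →₀ K

namespace PathAlgebra

variable {K : Type*} {V : Type*} [Field K] [Quiver V]

instance : AddCommGroup (PathAlgebra K V) := inferInstanceAs (AddCommGroup (QuiverPath V →₀ K))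

instance : Module K (PathAlgebra K V) := inferInstanceAs (Module K (QuiverPath V →₀ K))

variable (K) in
/-- The basis element of `K Q` given by a path. -/
def ofPath (p : QuiverPath V) : PathAlgebra K V := Finsupp.single p (1 : K)

open Classical in
variable (K) in
/-- The product of two paths: `p` followed by `q` if `p` ends where `q` starts, and zero otherwise. -/
def pathMul (p q : QuiverPath V) : PathAlgebra K V :=
  if h : p.tgt = q.src then
    ofPath K ⟨p.src, q.tgt, p.path.comp (q.path.cast h.symm rfl)⟩
  else 0

variable (K V) in
/-- The multiplication of `K Q`, the bilinear extension of the product of paths. -/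
def mulLin : PathAlgebra K V →ₗ[K] PathAlgebra K V →ₗ[K] PathAlgebra K V :=
  Finsupp.linearCombination K
    (fun p => (Finsupp.linearCombination K (pathMul K p) : (QuiverPath V →₀ K) →ₗ[K] _))

instance : Mul (PathAlgebra K V) := ⟨fun f g => mulLin K V f g⟩

theorem mul_def (f g : PathAlgebra K V) : f * g = mulLin K V f g := rfl

theorem ofPath_mul (p q : QuiverPath V) : ofPath K p * ofPath K q = pathMul K p q := by
  rw [mul_def, mulLin, ofPath, ofPath]
  erw [Finsupp.linearCombination_single, one_smul, Finsupp.linearCombination_single, one_smul]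

theorem ofPath_mul_ofPath {a b c : V} (p : Quiver.Path a b) (q : Quiver.Path b c) :
    ofPath K ⟨a, b, p⟩ * ofPath K ⟨b, c, q⟩ = ofPath K ⟨a, c, p.comp q⟩ := by
  rw [ofPath_mul, pathMul, dif_pos rfl]
  rfl

theorem ofPath_mul_ofPath_of_ne (p q : QuiverPath V) (h : p.tgt ≠ q.src) :
    ofPath K p * ofPath K q = 0 := by
  rw [ofPath_mul, pathMul, dif_neg h]

/-- Every element of `K Q` is a linear combination of paths. -/
theorem induction_on {P : PathAlgebra K V → Prop} (f : PathAlgebra K V) (h0 : P 0)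
    (hadd : ∀ f g, P f → P g → P (f + g)) (hp : ∀ (c : K) (p : QuiverPath V), P (c • ofPath K p)) :
    P f := by
  refine Finsupp.induction_linear (motive := P) f h0 hadd ?_
  intro p c
  have := hp c p
  have h2 : c • ofPath K p = (Finsupp.single p c : QuiverPath V →₀ K) := by
    unfold ofPath
    erw [Finsupp.smul_single, smul_eq_mul, mul_one]
  rwa [h2] at this

theorem mul_add' (f g h : PathAlgebra K V) : f * (g + h) = f * g + f * h := map_add _ _ _

theorem add_mul' (f g h : PathAlgebra K V) : (f + g) * h = f * h + g * h := by
  simp only [mul_def, map_add, LinearMap.add_apply]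

theorem smul_mul' (c : K) (f g : PathAlgebra K V) : (c • f) * g = c • (f * g) := by
  simp only [mul_def, map_smul, LinearMap.smul_apply]

theorem mul_smul' (c : K) (f g : PathAlgebra K V) : f * (c • g) = c • (f * g) := by
  simp only [mul_def, map_smul]

theorem zero_mul' (f : PathAlgebra K V) : 0 * f = 0 := by
  simp only [mul_def, map_zero, LinearMap.zero_apply]

theorem mul_zero' (f : PathAlgebra K V) : f * 0 = 0 := by
  simp only [mul_def, map_zero]

theorem mul_assoc' (f g h : PathAlgebra K V) : f * g * h = f * (g * h) := by
  induction f using induction_on with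
  | h0 => simp only [zero_mul']
  | hadd f₁ f₂ h₁ h₂ => simp only [add_mul', h₁, h₂]
  | hp c p =>
    simp only [smul_mul']
    congr 1
    induction g using induction_on with
    | h0 => simp only [zero_mul', mul_zero']
    | hadd f₁ f₂ h₁ h₂ => simp only [add_mul', mul_add', h₁, h₂]
    | hp c q =>
      simp only [smul_mul', mul_smul']
      congr 1
      induction h using induction_on with
      | h0 => simp only [mul_zero']
      | hadd f₁ f₂ h₁ h₂ => simp only [mul_add', h₁, h₂]
      | hp c r =>
        simp only [mul_smul']
        congr 1
        obtain ⟨a, b, p⟩ := p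
        obtain ⟨b', c, q⟩ := q
        obtain ⟨c', d, r⟩ := r
        by_cases h₁ : b = b'
        · subst h₁
          by_cases h₂ : c = c'
          · subst h₂
            simp only [ofPath_mul_ofPath, Quiver.Path.comp_assoc]
          · rw [ofPath_mul_ofPath, ofPath_mul_ofPath_of_ne _ _ h₂,
              ofPath_mul_ofPath_of_ne _ _ h₂, mul_zero']
        · rw [ofPath_mul_ofPath_of_ne _ _ h₁, zero_mul']
          by_cases h₂ : c = c'
          · subst h₂
            rw [ofPath_mul_ofPath, ofPath_mul_ofPath_of_ne]
            exact h₁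
          · rw [ofPath_mul_ofPath_of_ne _ _ h₂, mul_zero']

variable (K) in
/-- The idempotent `e_v` of `K Q`, the path of length zero at `v`. -/
def vertex (v : V) : PathAlgebra K V := ofPath K ⟨v, v, Quiver.Path.nil⟩

variable (K) in
/-- An arrow as an element of `K Q`. -/
def arrow {v w : V} (α : v ⟶ w) : PathAlgebra K V := ofPath K ⟨v, w, α.toPath⟩

/-- The unit of `K Q` is the sum of the idempotents `e_v`. -/
instance [Finite V] : One (PathAlgebra K V) :=
  ⟨letI := Fintype.ofFinite V; ∑ v : V, vertex K v⟩

theorem one_def [Fintype V] : (1 : PathAlgebra K V) = ∑ v : V, vertex K v := by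
  change (letI := Fintype.ofFinite V; ∑ v : V, vertex K v) = _
  congr!

theorem one_mul' [Finite V] (f : PathAlgebra K V) : 1 * f = f := by
  let _ := Fintype.ofFinite V
  induction f using induction_on with
  | h0 => exact mul_zero' _
  | hadd f g hf hg => rw [mul_add', hf, hg]
  | hp c p =>
    rw [mul_smul', one_def, mul_def, map_sum, LinearMap.sum_apply]
    simp only [← mul_def]
    rw [Finset.sum_eq_single p.src]
    · obtain ⟨a, b, p⟩ := p
      rw [vertex, ofPath_mul_ofPath, Quiver.Path.nil_comp]
    · intro b _ hb
      exact ofPath_mul_ofPath_of_ne _ _ hb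
    · simp

theorem mul_one' [Finite V] (f : PathAlgebra K V) : f * 1 = f := by
  let _ := Fintype.ofFinite V
  induction f using induction_on with
  | h0 => exact zero_mul' _
  | hadd f g hf hg => rw [add_mul', hf, hg]
  | hp c p =>
    rw [smul_mul', one_def, mul_def, map_sum]
    simp only [← mul_def]
    rw [Finset.sum_eq_single p.tgt]
    · obtain ⟨a, b, p⟩ := p
      rw [vertex, ofPath_mul_ofPath, Quiver.Path.comp_nil]
    · intro b _ hb
      exact ofPath_mul_ofPath_of_ne _ _ hb.symm
    · simp

instance [Finite V] : Ring (PathAlgebra K V) :=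
  { (inferInstance : AddCommGroup (PathAlgebra K V)) with
    mul := (· * ·)
    one := 1
    left_distrib := mul_add'
    right_distrib := add_mul'
    zero_mul := zero_mul'
    mul_zero := mul_zero'
    mul_assoc := mul_assoc'
    one_mul := one_mul'
    mul_one := mul_one' }

instance [Finite V] : Algebra K (PathAlgebra K V) :=
  Algebra.ofModule smul_mul' mul_smul'

variable (K V) in
/-- The two-sided ideal `J` of `K Q` generated by the arrows. -/
def arrowIdeal [Finite V] : Ideal (PathAlgebra K V) :=
  (TwoSidedIdeal.span {x | ∃ (v w : V) (α : v ⟶ w), x = arrow K α}).asIdeal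

instance [Finite V] : (arrowIdeal K V).IsTwoSided := by
  unfold arrowIdeal; infer_instance

end PathAlgebra

/-- The radical square zero algebra `K Q / J²`. -/
abbrev RadSqZero (K : Type*) (V : Type*) [Field K] [Quiver V] [Finite V] :=
  PathAlgebra K V ⧸ (PathAlgebra.arrowIdeal K V ^ 2)

namespace RadSqZero

variable {K : Type*} {V : Type*} [Field K] [Quiver V] [Finite V]

variable (K) in
/-- The class of `e_v` in `K Q / J²`. -/
def vertex (v : V) : RadSqZero K V := Ideal.Quotient.mk _ (PathAlgebra.vertex K v)

variable (K) in
/-- The class of an arrow in `K Q / J²`. -/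
def arrow {v w : V} (α : v ⟶ w) : RadSqZero K V := Ideal.Quotient.mk _ (PathAlgebra.arrow K α)

theorem arrow_mem {v w : V} (α : v ⟶ w) : PathAlgebra.arrow K α ∈ PathAlgebra.arrowIdeal K V := by
  rw [PathAlgebra.arrowIdeal, TwoSidedIdeal.mem_asIdeal]
  exact TwoSidedIdeal.subset_span ⟨v, w, α, rfl⟩

theorem cons_mem {u v w : V} (p : Quiver.Path u v) (α : v ⟶ w) :
    PathAlgebra.ofPath K ⟨u, w, p.cons α⟩ ∈ PathAlgebra.arrowIdeal K V := by
  have h : PathAlgebra.ofPath K ⟨u, w, p.cons α⟩ =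
      PathAlgebra.ofPath K ⟨u, v, p⟩ * PathAlgebra.arrow K α := by
    rw [PathAlgebra.arrow, PathAlgebra.ofPath_mul_ofPath]; rfl
  rw [h]
  exact Ideal.mul_mem_left _ _ (arrow_mem α)

variable (K V) in
/-- `K Q / J²` is spanned by the vertices and the arrows, so it is finite-dimensional. -/
instance finite [∀ v w : V, Finite (v ⟶ w)] : Module.Finite K (RadSqZero K V) := by
  let S : Set (RadSqZero K V) := Set.range (vertex K (V := V)) ∪
    Set.range (fun α : (Σ v w : V, v ⟶ w) => arrow K α.2.2)
  have hS : S.Finite := (Set.finite_range _).union (Set.finite_range _)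
  suffices h : Submodule.span K S = ⊤ from
    Module.Finite.of_fg_top (h ▸ Submodule.fg_span hS)
  rw [eq_top_iff]
  intro x _
  obtain ⟨f, rfl⟩ := Ideal.Quotient.mk_surjective x
  induction f using PathAlgebra.induction_on with
  | h0 => rw [map_zero]; exact Submodule.zero_mem _
  | hadd f g hf hg =>
    rw [map_add]; exact Submodule.add_mem _ (hf trivial) (hg trivial)
  | hp c p =>
    have hsm : Ideal.Quotient.mk (PathAlgebra.arrowIdeal K V ^ 2) (c • PathAlgebra.ofPath K p) =
        c • Ideal.Quotient.mk (PathAlgebra.arrowIdeal K V ^ 2) (PathAlgebra.ofPath K p) := rfl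
    rw [hsm]
    refine Submodule.smul_mem _ _ ?_
    obtain ⟨a, b, p⟩ := p
    cases p with
    | nil => exact Submodule.subset_span (Or.inl ⟨a, rfl⟩)
    | cons p α =>
      cases p with
      | nil => exact Submodule.subset_span (Or.inr ⟨⟨_, _, α⟩, rfl⟩)
      | cons p β =>
        have h0 : Ideal.Quotient.mk (PathAlgebra.arrowIdeal K V ^ 2)
            (PathAlgebra.ofPath K ⟨a, b, (p.cons β).cons α⟩) = 0 := by
          rw [Ideal.Quotient.eq_zero_iff_mem]
          have h : PathAlgebra.ofPath K ⟨a, b, (p.cons β).cons α⟩ =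
              PathAlgebra.ofPath K ⟨a, _, p.cons β⟩ * PathAlgebra.arrow K α := by
            rw [PathAlgebra.arrow, PathAlgebra.ofPath_mul_ofPath]; rfl
          rw [h, Submodule.pow_succ, Submodule.pow_one]
          exact Ideal.mul_mem_mul (cons_mem _ _) (arrow_mem _)
        rw [h0]
        exact Submodule.zero_mem _

/-- `K Q / J²` is right noetherian. Right modules over a ring `A` are modules over `Aᵐᵒᵖ`. -/
instance [∀ v w : V, Finite (v ⟶ w)] : IsNoetherianRing (RadSqZero K V)ᵐᵒᵖ := by
  have : Module.Finite K (RadSqZero K V)ᵐᵒᵖ :=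
    Module.Finite.equiv (MulOpposite.opLinearEquiv K : RadSqZero K V ≃ₗ[K] _)
  exact isNoetherian_of_tower K (inferInstance : IsNoetherian K (RadSqZero K V)ᵐᵒᵖ)

end RadSqZero

/-! ### The Igusa-Todorov function and the `φ`-dimension

Here `R` is any noetherian ring and modules are `R`-modules in Mathlib's convention. For right
modules over an algebra `A` take `R = Aᵐᵒᵖ`. -/

section IgusaTodorov

universe u

variable (R : Type u) [Ring R]

/-- The relations `[M] - [M'] - [M'']` for `M ≅ M' ⊕ M''` and `[P]` for `P` projective, among the
finitely generated modules. -/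
def k0Relations : Set (FreeAbelianGroup (FGModuleCat.{u} R)) :=
  {x | ∃ M M' M'' : FGModuleCat.{u} R, Nonempty (M ≃ₗ[R] M' × M'') ∧
    x = FreeAbelianGroup.of M - FreeAbelianGroup.of M' - FreeAbelianGroup.of M''} ∪
  {x | ∃ P : FGModuleCat.{u} R, Module.Projective R P ∧ x = FreeAbelianGroup.of P}

/-- The group `K₀`: one generator for each finitely generated module, with the relations above.
Isomorphic modules have the same class by the first family of relations with `M'' = 0`. -/
abbrev IgusaTodorovK0 : Type (u + 1) :=
  FreeAbelianGroup (FGModuleCat.{u} R) ⧸ AddSubgroup.closure (k0Relations R)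

variable {R}

/-- The class `[M]` in `K₀`. -/
def k0Class (M : FGModuleCat.{u} R) : IgusaTodorovK0 R :=
  QuotientAddGroup.mk (FreeAbelianGroup.of M)

theorem k0Class_prod (M M' M'' : FGModuleCat.{u} R) (e : M ≃ₗ[R] M' × M'') :
    k0Class M = k0Class M' + k0Class M'' := by
  have h : FreeAbelianGroup.of M - FreeAbelianGroup.of M' - FreeAbelianGroup.of M'' ∈
      AddSubgroup.closure (k0Relations R) :=
    AddSubgroup.subset_closure (Or.inl ⟨M, M', M'', ⟨e⟩, rfl⟩)
  rw [← QuotientAddGroup.eq_zero_iff, QuotientAddGroup.mk_sub, QuotientAddGroup.mk_sub,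
    sub_sub, sub_eq_zero] at h
  exact h

theorem k0Class_projective (P : FGModuleCat.{u} R) [h : Module.Projective R P] : k0Class P = 0 :=
  (QuotientAddGroup.eq_zero_iff _).2 (AddSubgroup.subset_closure (Or.inr ⟨P, h, rfl⟩))

theorem k0Class_congr (M N : FGModuleCat.{u} R) (e : M ≃ₗ[R] N) : k0Class M = k0Class N := by
  have h0 : k0Class (FGModuleCat.of R PUnit.{u + 1}) = 0 := k0Class_projective _
  have e' : M ≃ₗ[R] N × FGModuleCat.of R PUnit.{u + 1} :=
    e.trans (LinearEquiv.prodUnique (R := R) (M := N) (M₂ := PUnit.{u + 1})).symm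
  rw [k0Class_prod _ _ _ e', h0, add_zero]

/-- Schanuel's lemma. -/
theorem schanuel {M P Q : Type*} [AddCommGroup M] [AddCommGroup P] [AddCommGroup Q]
    [Module R M] [Module R P] [Module R Q] [Module.Projective R P] [Module.Projective R Q]
    (f : P →ₗ[R] M) (g : Q →ₗ[R] M) (hf : Function.Surjective f) (hg : Function.Surjective g) :
    Nonempty ((LinearMap.ker f × Q) ≃ₗ[R] (LinearMap.ker g × P)) := by
  obtain ⟨a, ha⟩ := Module.projective_lifting_property g f hg
  obtain ⟨b, hb⟩ := Module.projective_lifting_property f g hf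
  have ha' : ∀ p, g (a p) = f p := fun p => LinearMap.congr_fun ha p
  have hb' : ∀ q, f (b q) = g q := fun q => LinearMap.congr_fun hb q
  have h1 : ∀ x : LinearMap.ker f × Q, x.2 - a (b x.2 + x.1) ∈ LinearMap.ker g := by
    intro x
    have := x.1.2
    rw [LinearMap.mem_ker] at this
    rw [LinearMap.mem_ker, map_sub, ha', map_add, hb', this, add_zero, sub_self]
  have h2 : ∀ y : LinearMap.ker g × P, y.2 - b (y.1 + a y.2) ∈ LinearMap.ker f := by
    intro y
    have := y.1.2
    rw [LinearMap.mem_ker] at this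
    rw [LinearMap.mem_ker, map_sub, hb', map_add, ha', this, zero_add, sub_self]
  refine ⟨{ toFun := fun x => (⟨x.2 - a (b x.2 + x.1), h1 x⟩, b x.2 + x.1)
            invFun := fun y => (⟨y.2 - b (y.1 + a y.2), h2 y⟩, y.1 + a y.2)
            map_add' := ?_, map_smul' := ?_, left_inv := ?_, right_inv := ?_ }⟩
  · intro x y
    ext
    · simp only [Prod.fst_add, Prod.snd_add, Submodule.coe_add, map_add]; abel
    · simp only [Prod.fst_add, Prod.snd_add, Submodule.coe_add, map_add]; abel
  · intro r x
    ext
    · simp [smul_sub, smul_add]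
    · simp [smul_add]
  · intro x
    ext
    · simp
    · simp
  · intro x
    ext
    · simp
    · simp

section Noetherian

variable [IsNoetherianRing R]

/-- The kernel of a map from a finitely generated module, as a finitely generated module. -/
def fgKer {P : Type u} [AddCommGroup P] [Module R P] [Module.Finite R P] {M : Type u}
    [AddCommGroup M] [Module R M] (f : P →ₗ[R] M) : FGModuleCat.{u} R :=
  FGModuleCat.of R (LinearMap.ker f)

/-- The class in `K₀` of the kernel of a surjection `P → M` with `P` finitely generated projective
depends on `M` only. -/
theorem k0Class_fgKer_eq {M P Q : Type u} [AddCommGroup M] [AddCommGroup P] [AddCommGroup Q]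
    [Module R M] [Module R P] [Module R Q] [Module.Projective R P] [Module.Projective R Q]
    [Module.Finite R P] [Module.Finite R Q]
    (f : P →ₗ[R] M) (g : Q →ₗ[R] M) (hf : Function.Surjective f) (hg : Function.Surjective g) :
    k0Class (fgKer f) = k0Class (fgKer g) := by
  obtain ⟨e⟩ := schanuel f g hf hg
  have h1 := k0Class_prod (FGModuleCat.of R (LinearMap.ker f × Q)) (fgKer f) (FGModuleCat.of R Q)
    (LinearEquiv.refl R _)
  have h2 := k0Class_prod (FGModuleCat.of R (LinearMap.ker f × Q)) (fgKer g) (FGModuleCat.of R P) e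
  have : Module.Projective R (FGModuleCat.of R Q) := inferInstanceAs (Module.Projective R Q)
  have : Module.Projective R (FGModuleCat.of R P) := inferInstanceAs (Module.Projective R P)
  rw [k0Class_projective (FGModuleCat.of R Q), add_zero] at h1
  rw [k0Class_projective (FGModuleCat.of R P), add_zero] at h2
  rw [← h1, h2]

/-- The class in `K₀` of a syzygy of `M`, computed from some surjection of a finitely generated
free module onto `M`. -/
def syzygyClass (M : FGModuleCat.{u} R) : IgusaTodorovK0 R :=
  k0Class (fgKer (Module.Finite.exists_fin' R M).choose_spec.choose)

theorem syzygyClass_eq (M : FGModuleCat.{u} R) {P : Type u} [AddCommGroup P] [Module R P]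
    [Module.Projective R P] [Module.Finite R P] (f : P →ₗ[R] M) (hf : Function.Surjective f) :
    syzygyClass M = k0Class (fgKer f) :=
  k0Class_fgKer_eq _ _ (Module.Finite.exists_fin' R M).choose_spec.choose_spec hf

theorem syzygyClass_prod (M M' M'' : FGModuleCat.{u} R) (e : M ≃ₗ[R] M' × M'') :
    syzygyClass M = syzygyClass M' + syzygyClass M'' := by
  obtain ⟨n', f', hf'⟩ := Module.Finite.exists_fin' R M'
  obtain ⟨n'', f'', hf''⟩ := Module.Finite.exists_fin' R M''
  have hf : Function.Surjective (e.symm.toLinearMap ∘ₗ f'.prodMap f'') :=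
    e.symm.surjective.comp (hf'.prodMap hf'')
  rw [syzygyClass_eq M' f' hf', syzygyClass_eq M'' f'' hf'', syzygyClass_eq M _ hf]
  refine k0Class_prod _ _ _ ?_
  change LinearMap.ker (e.symm.toLinearMap ∘ₗ f'.prodMap f'') ≃ₗ[R]
    LinearMap.ker f' × LinearMap.ker f''
  refine (LinearEquiv.ofEq _ ((LinearMap.ker f').prod (LinearMap.ker f'')) ?_).trans
    { toFun := fun x => (⟨x.1.1, x.2.1⟩, ⟨x.1.2, x.2.2⟩)
      invFun := fun y => ⟨(y.1.1, y.2.1), y.1.2, y.2.2⟩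
      map_add' := fun _ _ => rfl
      map_smul' := fun _ _ => rfl
      left_inv := fun _ => rfl
      right_inv := fun _ => rfl }
  rw [LinearEquiv.ker_comp, LinearMap.ker_prodMap]

theorem syzygyClass_projective (P : FGModuleCat.{u} R) [Module.Projective R P] :
    syzygyClass P = 0 := by
  rw [syzygyClass_eq P (LinearMap.id : P →ₗ[R] P) Function.surjective_id]
  have : Subsingleton (LinearMap.ker (LinearMap.id : P →ₗ[R] P)) := by
    rw [LinearMap.ker_id]; infer_instance
  have : Module.Projective R (fgKer (LinearMap.id : P →ₗ[R] P)) :=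
    inferInstanceAs (Module.Projective R (LinearMap.ker (LinearMap.id : P →ₗ[R] P)))
  exact k0Class_projective _

variable (R) in
/-- The endomorphism of `K₀` induced by the syzygy operator `Ω`. -/
def omegaBar : IgusaTodorovK0 R →+ IgusaTodorovK0 R :=
  QuotientAddGroup.lift _ (FreeAbelianGroup.lift (syzygyClass (R := R))) (by
    rw [AddSubgroup.closure_le]
    rintro x (⟨M, M', M'', ⟨e⟩, rfl⟩ | ⟨P, hP, rfl⟩)
    · rw [SetLike.mem_coe, AddMonoidHom.mem_ker, map_sub, map_sub, FreeAbelianGroup.lift_apply_of,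
        FreeAbelianGroup.lift_apply_of, FreeAbelianGroup.lift_apply_of, syzygyClass_prod _ _ _ e]
      abel
    · rw [SetLike.mem_coe, AddMonoidHom.mem_ker, FreeAbelianGroup.lift_apply_of]
      exact syzygyClass_projective P)

/-- `omegaBar [M] = [Ω M]`, where `Ω M` is the kernel of a projective cover of `M`, or of any other
surjection of a finitely generated projective module onto `M`. -/
theorem omegaBar_k0Class (M : FGModuleCat.{u} R) {P : Type u} [AddCommGroup P] [Module R P]
    [Module.Projective R P] [Module.Finite R P] (f : P →ₗ[R] M) (hf : Function.Surjective f) :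
    omegaBar R (k0Class M) = k0Class (fgKer f) := by
  rw [← syzygyClass_eq M f hf]
  exact FreeAbelianGroup.lift_apply_of _ _

/-- A module is indecomposable if it is nonzero and is not the direct sum of two nonzero
submodules. -/
def IsIndecomposableModule (R : Type*) [Ring R] (N : Type*) [AddCommGroup N] [Module R N] : Prop :=
  Nontrivial N ∧ ∀ p q : Submodule R N, IsCompl p q → p = ⊥ ∨ q = ⊥

/-- The subgroup `⟨add M⟩` of `K₀` generated by the classes of the indecomposable direct summands
of `M`. -/
def addClosure (M : FGModuleCat.{u} R) : AddSubgroup (IgusaTodorovK0 R) :=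
  AddSubgroup.closure {x | ∃ N N' : FGModuleCat.{u} R, IsIndecomposableModule R N ∧
    Nonempty (M ≃ₗ[R] N × N') ∧ x = k0Class N}

/-- The Igusa-Todorov function: the least `l` such that `omegaBar` is injective on
`omegaBar ^ (l + s) ⟨add M⟩` for all `s`. (Such an `l` exists as `⟨add M⟩` has finite rank.) -/
def igusaTodorovPhi (M : FGModuleCat.{u} R) : ℕ :=
  sInf {l : ℕ | ∀ s : ℕ,
    Set.InjOn (omegaBar R) ((omegaBar R)^[l + s] '' (addClosure M : Set (IgusaTodorovK0 R)))}

variable (R) in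
/-- The `φ`-dimension, the supremum of the Igusa-Todorov function over all finitely generated
modules. -/
def phiDim : ℕ∞ := ⨆ M : FGModuleCat.{u} R, (igusaTodorovPhi M : ℕ∞)

end Noetherian

/-! ### Minimal syzygies and cosyzygies -/

/-- `N` is isomorphic to the kernel of a projective cover `P → M`, that is of a surjection with `P`
projective and superfluous kernel. -/
def IsSyzygy (M N : ModuleCat.{u} R) : Prop :=
  ∃ (P : ModuleCat.{u} R) (f : P →ₗ[R] M), Module.Projective R P ∧ Function.Surjective f ∧
    (∀ L : Submodule R P, L ⊔ LinearMap.ker f = ⊤ → L = ⊤) ∧ Nonempty (N ≃ₗ[R] LinearMap.ker f)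

/-- `N` is isomorphic to the cokernel of an injective envelope `M → E`, that is of an injection with
`E` injective and essential image. -/
def IsCosyzygy (M N : ModuleCat.{u} R) : Prop :=
  ∃ (E : ModuleCat.{u} R) (i : M →ₗ[R] E), Module.Injective R E ∧ Function.Injective i ∧
    (∀ L : Submodule R E, L ⊓ LinearMap.range i = ⊥ → L = ⊥) ∧
    Nonempty (N ≃ₗ[R] (E ⧸ LinearMap.range i))

/-- `N ≅ Ωⁿ(M)`. -/
def IsNthSyzygy : ℕ → ModuleCat.{u} R → ModuleCat.{u} R → Prop
  | 0, M, N => Nonempty (M ≃ₗ[R] N)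
  | n + 1, M, N => ∃ L : ModuleCat.{u} R, IsNthSyzygy n M L ∧ IsSyzygy L N

/-- `N ≅ Ω⁻ⁿ(M)`. -/
def IsNthCosyzygy : ℕ → ModuleCat.{u} R → ModuleCat.{u} R → Prop
  | 0, M, N => Nonempty (M ≃ₗ[R] N)
  | n + 1, M, N => ∃ L : ModuleCat.{u} R, IsNthCosyzygy n M L ∧ IsCosyzygy L N

end IgusaTodorov

/-! ### Heart and member of a quiver -/

section Heart

variable (K : Type*) (V : Type*) [Field K] [Quiver V] [Finite V]

/-- The semisimple module `A₀ = K Q / J`, the direct sum of the simple modules `S_v`. -/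
def SemisimpleTop := PathAlgebra K V ⧸ PathAlgebra.arrowIdeal K V

instance : AddCommGroup (SemisimpleTop K V) :=
  inferInstanceAs (AddCommGroup (PathAlgebra K V ⧸ PathAlgebra.arrowIdeal K V))

/-- `K Q / J` is a right module over `A = K Q / J²` through the projection `K Q / J² → K Q / J`. -/
instance : Module (RadSqZero K V)ᵐᵒᵖ (SemisimpleTop K V) :=
  Module.compHom (PathAlgebra K V ⧸ PathAlgebra.arrowIdeal K V)
    (RingHom.op (Ideal.Quotient.factor
      (Ideal.pow_le_self two_ne_zero :
        PathAlgebra.arrowIdeal K V ^ 2 ≤ PathAlgebra.arrowIdeal K V)))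

variable {K V} in
/-- The support of a right module `M` over `K Q / J²`: the vertices `v` with `M e_v ≠ 0`, that is
those whose simple module `S_v` is a composition factor of `M` (for `M` finitely generated). -/
def moduleSupport (M : ModuleCat (RadSqZero K V)ᵐᵒᵖ) : Set V :=
  {v | ∃ x : M, MulOpposite.op (RadSqZero.vertex K v) • x ≠ 0}

/-- The vertices of the heart of `Q`: those in the support of `Ωⁿ(A₀)` and of `Ω⁻ⁿ(A₀)`, with `n`
the number of vertices. -/
def heart : Set V :=
  {v | (∃ N, IsNthSyzygy (Nat.card V) (ModuleCat.of (RadSqZero K V)ᵐᵒᵖ (SemisimpleTop K V)) N ∧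
      v ∈ moduleSupport N) ∧
    ∃ N, IsNthCosyzygy (Nat.card V) (ModuleCat.of (RadSqZero K V)ᵐᵒᵖ (SemisimpleTop K V)) N ∧
      v ∈ moduleSupport N}

/-- The vertices of the member of `Q`: those which are not in the heart. -/
def member : Set V := (heart K V)ᶜ

/-- `K Q / J²` has maximal `φ`-dimension: it is the number `n` of vertices if the member is empty,
and `n - 1` if the member is not empty. -/
def HasMaximalPhiDim [∀ v w : V, Finite (v ⟶ w)] : Prop :=
  (member K V = ∅ → phiDim (RadSqZero K V)ᵐᵒᵖ = Nat.card V) ∧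
  (member K V ≠ ∅ → phiDim (RadSqZero K V)ᵐᵒᵖ + 1 = Nat.card V)

end Heart

/-! ### Connected quivers and equitable partitions -/

section Equitable

variable {V : Type*} [Quiver V]

variable (V) in
/-- A quiver is connected if it has a vertex and any two vertices are joined by a path of the
underlying undirected graph. -/
def IsConnectedQuiver : Prop :=
  Nonempty V ∧ Subsingleton (Quiver.WeaklyConnectedComponent V)

/-- The number of arrows that start at the vertex `v` and end in the class `C` of a partition. -/
def arrowsToClass (π : Setoid V) (v : V) (C : Quotient π) : ℕ :=
  Nat.card {α : (Σ w : V, v ⟶ w) // (Quotient.mk π α.1) = C}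

/-- A partition (given as an equivalence relation) is equitable if the number of arrows from `v` to
the class `C` depends only on `C` and on the class of `v`. -/
def IsEquitable (π : Setoid V) : Prop :=
  ∀ v v' : V, π v v' → ∀ C : Quotient π, arrowsToClass π v C = arrowsToClass π v' C

/-- The vertices of the quotient quiver `Q / π`: the classes of `π`. -/
def QuotientQuiver (π : Setoid V) (_h : IsEquitable π) := Quotient π

/-- The number `b C D` of arrows from any vertex of the class `C` to the class `D`. -/
def quotientArrows (π : Setoid V) (h : IsEquitable π) (C D : Quotient π) : ℕ :=
  Quotient.lift (fun v => arrowsToClass π v D) (fun v v' hv => h v v' hv D) C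

instance (π : Setoid V) (h : IsEquitable π) : Quiver (QuotientQuiver π h) :=
  ⟨fun C D => Fin (quotientArrows π h C D)⟩

instance (π : Setoid V) (h : IsEquitable π) [Finite V] : Finite (QuotientQuiver π h) :=
  inferInstanceAs (Finite (Quotient π))

instance (π : Setoid V) (h : IsEquitable π) (C D : QuotientQuiver π h) : Finite (C ⟶ D) :=
  inferInstanceAs (Finite (Fin _))

end Equitable

end

/-! Let `T` be the integer matrix that counts the arrows of the quiver. Since `J² = 0`, the syzygy
in a projective cover lies in the radical of a projective module and is semisimple. So one
application of `omegaBar` lands in the subgroup of classes of semisimple modules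
(`omegaBar_mem_range`), and on this subgroup `omegaBar` is multiplication of row vectors by `T`
(`omegaBar_ofVec`).

The member is empty exactly when there are no sources and no sinks (`member_eq_empty_iff`). Without
sinks no simple module is a summand of a projective one, and the classes of the simples are
independent in K₀ (`ofVec_injective`). Without sources every simple module is the syzygy of an
indecomposable quotient of some `R e_v` by one arrow (`omegaBar_arrowQuotient`). Let ν(T) be the
index of the eigenvalue zero, the least `k` with `ker T^k = ker T^(k+1)`. Then the φ-dimension is
ν(T) + 1: one step to reach the semisimple classes, and ν(T) more until the kernels stabilize. The
exception is a quiver in which exactly one arrow starts at each vertex. It consists of cycles, all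
`R e_v` are injective and the φ-dimension is 0 (`RadSqZeroBasis.phiDim_eq`).

A partition is equitable precisely when the functions constant on its classes form a `T`-invariant
subspace; there `T` acts as the matrix `S` of the quotient quiver. Restriction to an invariant
subspace of codimension n - m lowers the index by at most n - m, so ν(S) ≤ ν(T) ≤ ν(S) + n - m
(`Matrix.zeroIndex_of_quotient`). The quotient again has no sources or sinks, and the exceptional
case is a condition on row sums that passes to the quotient and back. This gives the inequality.

A nonnegative matrix without zero rows is not nilpotent, so ν(S) < m. If ν(T) = n - 1, the
comparison forces ν(S) = m - 1, which is maximality of the quotient. Conversely, the partition into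
single vertices recovers `T`. -/

noncomputable section

/-! ### Radical square zero algebras presented by a basis of vertices and arrows -/

open Classical in
/-- A `K`-basis of `R` consisting of orthogonal idempotents `e v`, indexed by the vertices of a
quiver, and of elements `a α`, indexed by its arrows, with products as in the opposite of the
radical square zero algebra of the quiver. The arrow `α` starts at `s α` and ends at `t α`, and
left multiplication by `a α` maps `e (s α) R` to `e (t α) R`. -/
structure RadSqZeroBasis (K : Type*) (R : Type*) {V E : Type*} [Field K] [Ring R] [Algebra K R]
    [Fintype V] [Fintype E] (s t : E → V) where
  basis : Module.Basis (V ⊕ E) K R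
  one_eq : (1 : R) = ∑ v, basis (Sum.inl v)
  e_mul_e : ∀ v w, basis (Sum.inl v) * basis (Sum.inl w) = if v = w then basis (Sum.inl v) else 0
  a_mul_e : ∀ α v, basis (Sum.inr α) * basis (Sum.inl v) =
    if s α = v then basis (Sum.inr α) else 0
  e_mul_a : ∀ v α, basis (Sum.inl v) * basis (Sum.inr α) =
    if t α = v then basis (Sum.inr α) else 0
  a_mul_a : ∀ α β, basis (Sum.inr α) * basis (Sum.inr β) = 0

namespace RadSqZeroBasis

variable {K R V E : Type*} [Field K] [Ring R] [Algebra K R] [Fintype V] [Fintype E]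
  {s t : E → V} (B : RadSqZeroBasis K R s t)

/-- The idempotent of a vertex. -/
def e (v : V) : R := B.basis (Sum.inl v)

/-- The element of an arrow. -/
def a (α : E) : R := B.basis (Sum.inr α)

/-- The coefficient of `e v`. -/
def ce (v : V) : R →ₗ[K] K := B.basis.coord (Sum.inl v)

/-- The coefficient of `a α`. -/
def ca (α : E) : R →ₗ[K] K := B.basis.coord (Sum.inr α)

theorem e_mul_self (v : V) : B.e v * B.e v = B.e v := by
  rw [e, B.e_mul_e, if_pos rfl]

theorem e_mul_of_ne {v w : V} (h : v ≠ w) : B.e v * B.e w = 0 := by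
  rw [e, e, B.e_mul_e, if_neg h]

theorem a_mul_e_self (α : E) : B.a α * B.e (s α) = B.a α := by
  rw [e, a, B.a_mul_e, if_pos rfl]

theorem a_mul_e_of_ne {α : E} {v : V} (h : s α ≠ v) : B.a α * B.e v = 0 := by
  rw [e, a, B.a_mul_e, if_neg h]

theorem e_mul_a_self (α : E) : B.e (t α) * B.a α = B.a α := by
  rw [e, a, B.e_mul_a, if_pos rfl]

theorem e_mul_a_of_ne {α : E} {v : V} (h : t α ≠ v) : B.e v * B.a α = 0 := by
  rw [e, a, B.e_mul_a, if_neg h]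

theorem a_mul_a' (α β : E) : B.a α * B.a β = 0 := B.a_mul_a α β

theorem sum_e : ∑ v, B.e v = 1 := B.one_eq.symm

theorem decomp (r : R) : r = ∑ v, B.ce v r • B.e v + ∑ α, B.ca α r • B.a α := by
  conv_lhs => rw [← B.basis.sum_repr r]
  rw [Fintype.sum_sum_type]
  rfl

theorem ce_e_self (v : V) : B.ce v (B.e v) = 1 := by
  simp [ce, e]

theorem ce_e_of_ne {v w : V} (h : v ≠ w) : B.ce v (B.e w) = 0 := by
  classical
  simp [ce, e, h.symm]

theorem ce_a (v : V) (α : E) : B.ce v (B.a α) = 0 := by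
  simp [ce, a]

theorem ca_e (α : E) (v : V) : B.ca α (B.e v) = 0 := by
  simp [ca, e]

theorem ca_a_self (α : E) : B.ca α (B.a α) = 1 := by
  simp [ca, a]

theorem ca_a_of_ne {α β : E} (h : α ≠ β) : B.ca α (B.a β) = 0 := by
  classical
  simp [ca, a, h.symm]

theorem e_ne_zero (v : V) : B.e v ≠ 0 := B.basis.ne_zero _

theorem a_ne_zero (α : E) : B.a α ≠ 0 := B.basis.ne_zero _

theorem a_mul (α : E) (r : R) : B.a α * r = B.ce (s α) r • B.a α := by
  conv_lhs => rw [B.decomp r, mul_add, Finset.mul_sum, Finset.mul_sum]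
  rw [Finset.sum_eq_single (s α), Finset.sum_eq_zero, add_zero, mul_smul_comm, a_mul_e_self]
  · intro β _
    rw [mul_smul_comm, a_mul_a', smul_zero]
  · intro v _ hv
    rw [mul_smul_comm, a_mul_e_of_ne _ hv.symm, smul_zero]
  · simp

theorem mul_a (r : R) (α : E) : r * B.a α = B.ce (t α) r • B.a α := by
  conv_lhs => rw [B.decomp r, add_mul, Finset.sum_mul, Finset.sum_mul]
  rw [Finset.sum_eq_single (t α), Finset.sum_eq_zero, add_zero, smul_mul_assoc, e_mul_a_self]
  · intro β _
    rw [smul_mul_assoc, a_mul_a', smul_zero]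
  · intro v _ hv
    rw [smul_mul_assoc, e_mul_a_of_ne _ hv.symm, smul_zero]
  · simp

theorem ce_e_mul_self (v : V) (r : R) : B.ce v (B.e v * r) = B.ce v r := by
  have : B.ce v ∘ₗ LinearMap.mulLeft K (B.e v) = B.ce v := by
    refine B.basis.ext fun i => ?_
    rcases i with w | α
    · change B.ce v (B.e v * B.e w) = B.ce v (B.e w)
      by_cases h : v = w
      · rw [h, e_mul_self]
      · rw [e_mul_of_ne _ h, map_zero, ce_e_of_ne _ h]
    · change B.ce v (B.e v * B.a α) = B.ce v (B.a α)
      rw [mul_a, map_smul, ce_a, smul_zero]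
  exact LinearMap.congr_fun this r

theorem ce_e_mul_of_ne {v w : V} (h : v ≠ w) (r : R) : B.ce v (B.e w * r) = 0 := by
  rw [← ce_e_mul_self, ← mul_assoc, e_mul_of_ne _ h, zero_mul, map_zero]

/-- Products that involve an arrow are combinations of arrows and do not contribute. Hence `ce v` is
a character, whose kernel gives the simple module of `v`. -/
theorem ce_mul (v : V) (r r' : R) : B.ce v (r * r') = B.ce v r * B.ce v r' := by
  conv_lhs => rw [B.decomp r, add_mul, Finset.sum_mul, Finset.sum_mul, map_add, map_sum, map_sum]
  rw [Finset.sum_eq_single v, Finset.sum_eq_zero, add_zero, smul_mul_assoc, map_smul,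
    ce_e_mul_self, smul_eq_mul]
  · intro β _
    rw [smul_mul_assoc, a_mul, map_smul, map_smul, ce_a, smul_zero, smul_zero]
  · intro w _ hw
    rw [smul_mul_assoc, map_smul, ce_e_mul_of_ne _ hw.symm, smul_zero]
  · simp

section Module

variable {M N : Type*} [AddCommGroup M] [Module R M] [Module K M] [IsScalarTower K R M]
  [AddCommGroup N] [Module R N] [Module K N] [IsScalarTower K R N]

theorem smul_decomp (r : R) (m : M) :
    r • m = ∑ v, B.ce v r • B.e v • m + ∑ α, B.ca α r • B.a α • m := by
  conv_lhs => rw [B.decomp r, add_smul, Finset.sum_smul, Finset.sum_smul]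
  simp only [smul_assoc]

omit [Module K M] [IsScalarTower K R M] in
theorem sum_e_smul (m : M) : ∑ v, B.e v • m = m := by
  rw [← Finset.sum_smul, sum_e, one_smul]

omit [Module K M] [IsScalarTower K R M] in
theorem a_smul_a_smul (α β : E) (m : M) : B.a α • B.a β • m = 0 := by
  rw [smul_smul, a_mul_a', zero_smul]

omit [Module K M] [IsScalarTower K R M] in
theorem a_smul_e_smul_of_ne {α : E} {v : V} (h : s α ≠ v) (m : M) : B.a α • B.e v • m = 0 := by
  rw [smul_smul, a_mul_e_of_ne _ h, zero_smul]

omit [Module K M] [IsScalarTower K R M] in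
theorem a_smul_e_smul_self (α : E) (m : M) : B.a α • B.e (s α) • m = B.a α • m := by
  rw [smul_smul, a_mul_e_self]

omit [Module K M] [IsScalarTower K R M] in
theorem e_smul_a_smul_of_ne {α : E} {v : V} (h : t α ≠ v) (m : M) : B.e v • B.a α • m = 0 := by
  rw [smul_smul, e_mul_a_of_ne _ h, zero_smul]

omit [Module K M] [IsScalarTower K R M] in
theorem e_smul_a_smul_self (α : E) (m : M) : B.e (t α) • B.a α • m = B.a α • m := by
  rw [smul_smul, e_mul_a_self]

omit [Module K M] [IsScalarTower K R M] in
theorem e_smul_e_smul_of_ne {v w : V} (h : v ≠ w) (m : M) : B.e v • B.e w • m = 0 := by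
  rw [smul_smul, e_mul_of_ne _ h, zero_smul]

omit [Module K M] [IsScalarTower K R M] in
theorem e_smul_e_smul_self (v : V) (m : M) : B.e v • B.e v • m = B.e v • m := by
  rw [smul_smul, e_mul_self]

/-- On an element of weight `v` which is killed by the arrows, `R` acts through `ce v`. -/
theorem smul_of_weight {v : V} {m : M} (hv : B.e v • m = m) (ha : ∀ α, B.a α • m = 0) (r : R) :
    r • m = B.ce v r • m := by
  rw [B.smul_decomp, Finset.sum_eq_single v, hv, Finset.sum_eq_zero, add_zero]
  · intro α _
    rw [ha, smul_zero]
  · intro w _ hw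
    rw [← hv, B.e_smul_e_smul_of_ne hw, smul_zero]
  · simp

/-- A `K`-linear map which commutes with the vertices and the arrows is `R`-linear. -/
def mkLinearMap (f : M →ₗ[K] N) (he : ∀ v m, f (B.e v • m) = B.e v • f m)
    (ha : ∀ α m, f (B.a α • m) = B.a α • f m) : M →ₗ[R] N where
  toFun := f
  map_add' := map_add f
  map_smul' r m := by
    rw [RingHom.id_apply, B.smul_decomp r m, B.smul_decomp r (f m), map_add, map_sum, map_sum]
    simp only [map_smul, he, ha]

include B in
theorem finite_base : Module.Finite K R := Module.Finite.of_basis B.basis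

variable (M) in
/-- The radical `J M`, as an `R`-submodule. -/
def rad : Submodule R M where
  carrier := {x | ∃ y : E → M, x = ∑ α, B.a α • y α}
  zero_mem' := ⟨0, by simp⟩
  add_mem' := by
    rintro _ _ ⟨y, rfl⟩ ⟨z, rfl⟩
    exact ⟨y + z, by simp [smul_add, Finset.sum_add_distrib]⟩
  smul_mem' := by
    rintro r _ ⟨y, rfl⟩
    -- By `mul_a`, `r` acts on `a α` from the left by a scalar, and scalars are central, so it can
    -- be moved to `y α`.
    refine ⟨fun α => (algebraMap K R (B.ce (t α) r)) • y α, ?_⟩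
    rw [Finset.smul_sum]
    refine Finset.sum_congr rfl fun α _ => ?_
    rw [smul_smul, mul_a, smul_smul, ← Algebra.commutes, ← Algebra.smul_def]

omit [Module K M] [IsScalarTower K R M] in
theorem a_smul_mem_rad (α : E) (m : M) : B.a α • m ∈ B.rad M := by
  classical
  refine ⟨Pi.single α m, ?_⟩
  rw [Finset.sum_eq_single α]
  · simp
  · intro β _ h
    simp [h]
  · simp

-- This is `J² = 0`; it makes every submodule of a radical semisimple, in particular every minimal
-- syzygy.
omit [Module K M] [IsScalarTower K R M] in
theorem a_smul_of_mem_rad {x : M} (hx : x ∈ B.rad M) (α : E) : B.a α • x = 0 := by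
  obtain ⟨y, rfl⟩ := hx
  rw [Finset.smul_sum]
  exact Finset.sum_eq_zero fun β _ => B.a_smul_a_smul _ _ _

omit [Module K M] [IsScalarTower K R M] [Module K N] [IsScalarTower K R N] in
theorem map_mem_rad (f : M →ₗ[R] N) {x : M} (hx : x ∈ B.rad M) : f x ∈ B.rad N := by
  obtain ⟨y, rfl⟩ := hx
  exact ⟨fun α => f (y α), by simp⟩

omit [Module K M] [IsScalarTower K R M] in
theorem rad_le_iff {L : Submodule R M} : B.rad M ≤ L ↔ ∀ α m, B.a α • m ∈ L := by
  refine ⟨fun h α m => h (B.a_smul_mem_rad α m), ?_⟩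
  rintro h _ ⟨y, rfl⟩
  exact Submodule.sum_mem _ fun α _ => h _ _

omit [Module K M] [IsScalarTower K R M] in
/-- Nakayama's lemma for the nilpotent radical. -/
theorem eq_top_of_sup_rad {L : Submodule R M} (h : L ⊔ B.rad M = ⊤) : L = ⊤ := by
  have h1 : B.rad M ≤ L := by
    rw [rad_le_iff]
    intro α m
    obtain ⟨x, hx, y, hy, rfl⟩ := Submodule.mem_sup.1 (h ▸ Submodule.mem_top : m ∈ L ⊔ B.rad M)
    rw [smul_add, B.a_smul_of_mem_rad hy, add_zero]
    exact L.smul_mem _ hx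
  rwa [sup_eq_left.2 h1] at h

omit [Module K M] [IsScalarTower K R M] in
/-- The elements of `M` modulo the radical are killed by the arrows. -/
theorem a_smul_quotient_rad (α : E) (x : M ⧸ B.rad M) : B.a α • x = 0 := by
  obtain ⟨m, rfl⟩ := Submodule.Quotient.mk_surjective _ x
  rw [← Submodule.Quotient.mk_smul, Submodule.Quotient.mk_eq_zero]
  exact B.a_smul_mem_rad α m

include B in
/-- A finite-dimensional module has a `K`-basis consisting of elements of weights. -/
theorem exists_weight_basis [Module.Finite K M] : ∃ (I : Type) (_ : Fintype I) (w : I → V)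
    (b : Module.Basis I K M), ∀ i, B.e (w i) • b i = b i := by
  classical
  let A : V → Submodule K M := fun v => LinearMap.range (Module.toModuleEnd K (S := R) M (B.e v))
  have hmem : ∀ v m, m ∈ A v ↔ B.e v • m = m := by
    intro v m
    constructor
    · rintro ⟨m, rfl⟩
      exact B.e_smul_e_smul_self v m
    · intro h
      exact ⟨m, h⟩
  have hA : DirectSum.IsInternal A := by
    rw [DirectSum.isInternal_submodule_iff_iSupIndep_and_iSup_eq_top]
    constructor
    · rw [iSupIndep_def]
      intro v
      rw [Submodule.disjoint_def]
      intro x hx hx'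
      -- Orthogonality of the idempotents: `e v` kills all other weight spaces and is the identity
      -- on its own, so the sum is direct.
      have : (⨆ j, ⨆ (_ : j ≠ v), A j) ≤ LinearMap.ker (Module.toModuleEnd K (S := R) M (B.e v)) := by
        refine iSup₂_le fun w hw => ?_
        rintro _ ⟨m, rfl⟩
        exact B.e_smul_e_smul_of_ne hw.symm m
      have h1 : B.e v • x = 0 := this hx'
      rw [← (hmem v x).1 hx, h1]
    · rw [eq_top_iff]
      intro m _
      rw [← B.sum_e_smul m]
      exact Submodule.sum_mem _ fun v _ =>
        Submodule.mem_iSup_of_mem v ((hmem v _).2 (B.e_smul_e_smul_self v m))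
  let b' := hA.collectedBasis (fun v => Module.finBasis K (A v))
  let eq := Fintype.equivFin (Σ v, Fin (Module.finrank K (A v)))
  refine ⟨_, inferInstance, fun i => (eq.symm i).1, b'.reindex eq, fun i => ?_⟩
  rw [Module.Basis.reindex_apply, ← hmem]
  exact hA.collectedBasis_mem _ _

end Module

end RadSqZeroBasis

end

/-! ### Projective modules of the vertices and projective covers -/

noncomputable section

namespace RadSqZeroBasis

variable {K R V E : Type*} [Field K] [Ring R] [Algebra K R] [Fintype V] [Fintype E]
  {s t : E → V} (B : RadSqZeroBasis K R s t)

/-- The projective module `R e_v` of a vertex, as a left ideal. -/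
def vertexProj (v : V) : Submodule R R := Submodule.span R {B.e v}

theorem mem_vertexProj {v : V} {r : R} : r ∈ B.vertexProj v ↔ r * B.e v = r := by
  rw [vertexProj, Submodule.mem_span_singleton]
  constructor
  · rintro ⟨x, rfl⟩
    rw [smul_eq_mul, mul_assoc, e_mul_self]
  · intro h
    exact ⟨r, h⟩

theorem e_mem_vertexProj (v : V) : B.e v ∈ B.vertexProj v := B.mem_vertexProj.2 (B.e_mul_self v)

theorem a_mem_vertexProj (α : E) : B.a α ∈ B.vertexProj (s α) :=
  B.mem_vertexProj.2 (B.a_mul_e_self α)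

theorem eq_of_mem_vertexProj {v : V} {r : R} (h : r ∈ B.vertexProj v) :
    r = B.ce v r • B.e v + ∑ α, B.ca α r • (B.a α * B.e v) := by
  conv_lhs => rw [← B.mem_vertexProj.1 h, B.decomp r, add_mul, Finset.sum_mul, Finset.sum_mul]
  simp only [smul_mul_assoc]
  congr 1
  rw [Finset.sum_eq_single v]
  · rw [e_mul_self]
  · intro w _ hw
    rw [e_mul_of_ne _ hw, smul_zero]
  · simp

instance (v : V) : Module.Projective R (B.vertexProj v) := by
  refine Module.Projective.of_split (B.vertexProj v).subtype
    (LinearMap.codRestrict (B.vertexProj v) (LinearMap.toSpanSingleton R R (B.e v)) fun r => ?_) ?_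
  · rw [mem_vertexProj, LinearMap.toSpanSingleton_apply, smul_eq_mul, mul_assoc, e_mul_self]
  · ext x
    exact B.mem_vertexProj.1 x.2

instance (v : V) : Module.Finite R (B.vertexProj v) :=
  Module.Finite.iff_fg.2 (Submodule.fg_span (Set.finite_singleton _))

section Cover

variable {M : Type*} [AddCommGroup M] [Module R M]
  {I : Type*} [Fintype I] (w : I → V) (m : I → M)

/-- The map from a sum of projective modules `R e_v` given by a family of elements. -/
def projMap : (∀ i, B.vertexProj (w i)) →ₗ[R] M :=
  ∑ i, (LinearMap.toSpanSingleton R M (m i)) ∘ₗ (B.vertexProj (w i)).subtype ∘ₗ LinearMap.proj i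

theorem projMap_apply (p : ∀ i, B.vertexProj (w i)) :
    B.projMap w m p = ∑ i, (p i : R) • m i := by
  simp [projMap]

variable [Module K M] [IsScalarTower K R M]
variable (b : Module.Basis I K (M ⧸ B.rad M)) (hm : ∀ i, Submodule.Quotient.mk (m i) = b i)

-- The images of the `e (w i)` span `M` modulo the radical, so Nakayama's lemma applies.
include hm in
theorem projMap_surjective (hw : ∀ i, B.e (w i) • b i = b i) :
    Function.Surjective (B.projMap w m) := by
  classical
  rw [← LinearMap.range_eq_top]
  refine B.eq_top_of_sup_rad ?_
  rw [eq_top_iff]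
  intro x _
  have h1 : x - ∑ i, b.repr (Submodule.Quotient.mk x) i • B.e (w i) • m i ∈ B.rad M := by
    rw [← Submodule.Quotient.mk_eq_zero, Submodule.Quotient.mk_sub, sub_eq_zero]
    conv_lhs => rw [← b.sum_repr (Submodule.Quotient.mk x)]
    rw [← Submodule.mkQ_apply (B.rad M) (∑ i, _), map_sum]
    refine Finset.sum_congr rfl fun i _ => ?_
    rw [Submodule.mkQ_apply, Submodule.Quotient.mk_smul, Submodule.Quotient.mk_smul, hm, hw]
  rw [← add_sub_cancel (∑ i, b.repr (Submodule.Quotient.mk x) i • B.e (w i) • m i) x]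
  refine Submodule.add_mem_sup ⟨fun i => b.repr (Submodule.Quotient.mk x) i •
    (⟨B.e (w i), B.e_mem_vertexProj _⟩ : B.vertexProj (w i)), ?_⟩ h1
  rw [projMap_apply]
  refine Finset.sum_congr rfl fun i _ => ?_
  rw [Submodule.coe_smul_of_tower, smul_assoc]

-- Modulo the radical, a relation among the generators reads as a relation among the basis vectors
-- `b i`. Hence the coefficients of the idempotents vanish and only arrows remain.
include hm in
theorem ker_projMap_le (hw : ∀ i, B.e (w i) • b i = b i) :
    LinearMap.ker (B.projMap w m) ≤ B.rad (∀ i, B.vertexProj (w i)) := by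
  intro p hp
  rw [LinearMap.mem_ker, projMap_apply] at hp
  have h1 : ∑ i, B.ce (w i) (p i : R) • b i = 0 := by
    have h2 := congrArg (B.rad M).mkQ hp
    rw [map_sum, map_zero] at h2
    rw [← h2]
    refine Finset.sum_congr rfl fun i _ => ?_
    rw [Submodule.mkQ_apply, Submodule.Quotient.mk_smul, hm]
    exact (B.smul_of_weight (hw i) (fun α => B.a_smul_quotient_rad α _) _).symm
  have h2 := fun i => Fintype.linearIndependent_iff.1 b.linearIndependent _ h1 i
  refine ⟨fun α i => B.ca α (p i : R) • ⟨B.e (w i), B.e_mem_vertexProj _⟩, ?_⟩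
  ext i
  conv_lhs => rw [B.eq_of_mem_vertexProj (p i).2, h2, zero_smul, zero_add]
  rw [Finset.sum_apply, AddSubmonoidClass.coe_finsetSum]
  refine Finset.sum_congr rfl fun α _ => ?_
  rw [Pi.smul_apply, Submodule.coe_smul, Submodule.coe_smul_of_tower, smul_eq_mul, mul_smul_comm]

end Cover

universe u

/-- A projective cover of a finitely generated module. -/
theorem exists_cover {R : Type u} [Ring R] [Algebra K R] (B : RadSqZeroBasis K R s t)
    (M : Type u) [AddCommGroup M] [Module R M] [Module.Finite R M] :
    ∃ (P : ModuleCat.{u} R) (f : P →ₗ[R] M), Module.Projective R P ∧ Module.Finite R P ∧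
      Function.Surjective f ∧ LinearMap.ker f ≤ B.rad P := by
  classical
  let _ : Module K M := Module.compHom M (algebraMap K R)
  have : IsScalarTower K R M := ⟨fun c r m => by rw [Algebra.smul_def, mul_smul]; rfl⟩
  have := B.finite_base
  have : Module.Finite K M := Module.Finite.trans R M
  have : Module.Finite K (M ⧸ B.rad M) := Module.Finite.trans R _
  obtain ⟨I, _, w, b, hb⟩ := B.exists_weight_basis (M := M ⧸ B.rad M)
  choose m hm using fun i => Submodule.Quotient.mk_surjective (B.rad M) (b i)
  refine ⟨ModuleCat.of R (∀ i, B.vertexProj (w i)), B.projMap w m, ?_, ?_,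
    B.projMap_surjective w m b hm hb, B.ker_projMap_le w m b hm hb⟩
  · exact Module.Projective.of_equiv (DirectSum.linearEquivFunOnFintype R I
      fun i => B.vertexProj (w i))
  · exact inferInstanceAs (Module.Finite R (∀ i, B.vertexProj (w i)))

/-- In a projective module an arrow only kills elements of the radical, up to weights. -/
theorem e_smul_mem_rad_of_projective {P : Type*} [AddCommGroup P] [Module R P]
    [Module.Projective R P] [Module.Finite R P] {α : E} {p : P} (h : B.a α • p = 0) :
    B.e (s α) • p ∈ B.rad P := by
  obtain ⟨n, f, hf⟩ := Module.Finite.exists_fin' R P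
  -- The splitting `g` embeds `P` into a free module, so the claim can be checked on coordinates in
  -- `R` and carried back by `f`.
  obtain ⟨g, hg⟩ := Module.projective_lifting_property f LinearMap.id hf
  have hg' : ∀ x, f (g x) = x := fun x => LinearMap.congr_fun hg x
  rw [← hg' (B.e (s α) • p)]
  refine B.map_mem_rad f ?_
  rw [map_smul]
  refine ⟨fun β i => B.ca β (B.e (s α) * g p i) • 1, ?_⟩
  ext i
  -- This product is `ce (s α) (g p i) • a α`, so that coefficient vanishes and `e (s α) * g p i` is
  -- a combination of arrows.
  have h1 : B.a α * g p i = 0 := by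
    have := congrFun (congrArg g h) i
    rwa [map_smul, map_zero] at this
  rw [a_mul, smul_eq_zero, or_iff_left (B.a_ne_zero α)] at h1
  rw [Pi.smul_apply, smul_eq_mul]
  conv_lhs => rw [B.decomp (B.e (s α) * g p i)]
  rw [Finset.sum_eq_zero, zero_add, Finset.sum_apply]
  · refine Finset.sum_congr rfl fun β _ => ?_
    rw [Pi.smul_apply, smul_eq_mul, mul_smul_comm, mul_one]
  · intro v _
    by_cases hv : v = s α
    · rw [hv, ce_e_mul_self, h1, zero_smul]
    · rw [ce_e_mul_of_ne _ hv, zero_smul]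

end RadSqZeroBasis

end

/-! ### Classes in K₀ and the syzygy operator on semisimple modules -/

noncomputable section

universe u

/-- The class of a finite product is the sum of the classes. -/
theorem k0Class_pi {R : Type u} [Ring R] (ι : Type) [Fintype ι] :
    ∀ M : ι → FGModuleCat.{u} R, k0Class (FGModuleCat.of R (∀ i, M i)) = ∑ i, k0Class (M i) := by
  refine Fintype.induction_empty_option (P := fun (ι : Type) (_ : Fintype ι) =>
    ∀ M : ι → FGModuleCat.{u} R, k0Class (FGModuleCat.of R (∀ i, M i)) = ∑ i, k0Class (M i))
    ?_ ?_ ?_ ι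
  · intro α β _ e ih M
    let _ := Fintype.ofEquiv β e.symm
    rw [← Equiv.sum_comp e, ← ih]
    exact k0Class_congr _ _ (LinearEquiv.piCongrLeft R (fun i => M i) e).symm
  · intro M
    have : Module.Projective R (FGModuleCat.of R (∀ i, M i)) :=
      inferInstanceAs (Module.Projective R (∀ i : PEmpty, M i))
    rw [k0Class_projective]
    rfl
  · intro α _ ih M
    rw [Fintype.sum_option, ← ih]
    exact k0Class_prod _ _ _ (LinearEquiv.piOptionEquivProd R (M := fun i => M i))

namespace RadSqZeroBasis

variable {K V E : Type*} {R : Type u} [Field K] [Ring R] [Algebra K R] [Fintype V] [Fintype E]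
  {s t : E → V} (B : RadSqZeroBasis K R s t)

/-- The maximal left ideal of a vertex. -/
def maxIdeal (v : V) : Submodule R R where
  carrier := {r | B.ce v r = 0}
  zero_mem' := map_zero _
  add_mem' := by
    intro x y hx hy
    change B.ce v _ = 0 at *
    rw [map_add, hx, hy, add_zero]
  smul_mem' := by
    intro r x hx
    change B.ce v _ = 0 at *
    rw [smul_eq_mul, ce_mul, hx, mul_zero]

theorem mem_maxIdeal {v : V} {r : R} : r ∈ B.maxIdeal v ↔ B.ce v r = 0 := Iff.rfl

/-- The simple module of a vertex. -/
abbrev simple (v : V) : FGModuleCat.{u} R := FGModuleCat.of R (R ⧸ B.maxIdeal v)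

section WeightBasis

variable {N : Type u} [AddCommGroup N] [Module R N] [Module K N] [IsScalarTower K R N]

/-- The map from a simple module given by an element of its weight. -/
def simpleMap {v : V} (x : N) (hx : B.e v • x = x) (ha : ∀ α, B.a α • x = 0) :
    (R ⧸ B.maxIdeal v) →ₗ[R] N :=
  (B.maxIdeal v).liftQ (LinearMap.toSpanSingleton R N x) fun r hr => by
    rw [LinearMap.mem_ker, LinearMap.toSpanSingleton_apply, B.smul_of_weight hx ha,
      B.mem_maxIdeal.1 hr, zero_smul]

theorem simpleMap_mk {v : V} (x : N) (hx : B.e v • x = x) (ha : ∀ α, B.a α • x = 0) (r : R) :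
    B.simpleMap x hx ha (Submodule.Quotient.mk r) = B.ce v r • x := by
  rw [← B.smul_of_weight hx ha]
  rfl

/-- Each basis vector spans a copy of a simple module, and together they identify `N` with a
product. The index type lives in `Type` because `k0Class_pi` requires it; reindexing by `Fin`
removes the restriction afterwards. -/
theorem k0Class_of_basis_aux {I : Type} [Fintype I] (N : FGModuleCat.{u} R) [Module K N]
    [IsScalarTower K R N] (b : Module.Basis I K N) (w : I → V)
    (hw : ∀ i, B.e (w i) • b i = b i) (ha : ∀ i α, B.a α • b i = 0) :
    k0Class N = ∑ i, k0Class (B.simple (w i)) := by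
  classical
  rw [← k0Class_pi]
  let f : (∀ i, R ⧸ B.maxIdeal (w i)) →ₗ[R] N :=
    ∑ i, B.simpleMap (b i) (hw i) (ha i) ∘ₗ LinearMap.proj i
  have hf : ∀ r : I → R, f (fun i => Submodule.Quotient.mk (r i)) =
      ∑ i, B.ce (w i) (r i) • b i := by
    intro r
    simp only [f, LinearMap.sum_apply, LinearMap.comp_apply, LinearMap.proj_apply, simpleMap_mk]
  refine (k0Class_congr _ _ (LinearEquiv.ofBijective f ⟨?_, ?_⟩)).symm
  · rw [← LinearMap.ker_eq_bot, LinearMap.ker_eq_bot']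
    intro x hx
    choose r hr using fun i => Submodule.Quotient.mk_surjective _ (x i)
    obtain rfl : (fun i => Submodule.Quotient.mk (r i)) = x := funext hr
    rw [hf] at hx
    funext i
    exact (Submodule.Quotient.mk_eq_zero _).2
      (Fintype.linearIndependent_iff.1 b.linearIndependent _ hx i)
  · intro n
    refine ⟨fun i => Submodule.Quotient.mk (b.repr n i • B.e (w i)), ?_⟩
    rw [hf]
    conv_rhs => rw [← b.sum_repr n]
    refine Finset.sum_congr rfl fun i _ => ?_
    rw [map_smul, ce_e_self, smul_eq_mul, mul_one]

/-- The class of a module with a basis of weight vectors which are killed by the arrows. -/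
theorem k0Class_of_basis {I : Type*} [Fintype I] (N : FGModuleCat.{u} R) [Module K N]
    [IsScalarTower K R N] (b : Module.Basis I K N) (w : I → V)
    (hw : ∀ i, B.e (w i) • b i = b i) (ha : ∀ i α, B.a α • b i = 0) :
    k0Class N = ∑ i, k0Class (B.simple (w i)) := by
  rw [B.k0Class_of_basis_aux N (b.reindex (Fintype.equivFin I)) (w ∘ (Fintype.equivFin I).symm)]
  · exact Equiv.sum_comp (Fintype.equivFin I).symm fun i => k0Class (B.simple (w i))
  · intro i
    rw [Module.Basis.reindex_apply]
    exact hw _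
  · intro i α
    rw [Module.Basis.reindex_apply]
    exact ha _ _

/-- The class of a module which is isomorphic to the span of a set of arrows. -/
theorem k0Class_of_arrows (F : Finset E) (N : FGModuleCat.{u} R) (j : N →ₗ[R] R)
    (hj : Function.Injective j)
    (hF : ∀ r, r ∈ LinearMap.range j ↔ r ∈ Submodule.span K (Set.range fun α : F => B.a α)) :
    k0Class N = ∑ α ∈ F, k0Class (B.simple (t α)) := by
  let _ : Module K N := Module.compHom N (algebraMap K R)
  have : IsScalarTower K R N := ⟨fun c r m => by rw [Algebra.smul_def, mul_smul]; rfl⟩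
  have hli : LinearIndependent K fun α : F => B.a α :=
    B.basis.linearIndependent.comp (fun α : F => Sum.inr (α : E))
      (Sum.inr_injective.comp Subtype.val_injective)
  let eq : N ≃ₗ[K] Submodule.span K (Set.range fun α : F => B.a α) :=
    (LinearEquiv.ofInjective (j.restrictScalars K) hj).trans
      (LinearEquiv.ofEq _ _ (Submodule.ext fun r => hF r))
  have heq : ∀ n, (eq n : R) = j n := fun n => rfl
  have hb : ∀ α : F, j (((Module.Basis.span hli).map eq.symm) α) = B.a α := by
    intro α
    rw [Module.Basis.map_apply, ← heq, LinearEquiv.apply_symm_apply, Module.Basis.span_apply]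
  rw [B.k0Class_of_basis N ((Module.Basis.span hli).map eq.symm) fun α => t α]
  · exact Finset.sum_coe_sort F fun α => k0Class (B.simple (t α))
  · intro α
    apply hj
    rw [map_smul, hb, smul_eq_mul, e_mul_a_self]
  · intro α β
    apply hj
    rw [map_smul, hb, smul_eq_mul, a_mul_a', map_zero]

end WeightBasis

theorem mem_span_a {F : Finset E} {r : R} :
    r ∈ Submodule.span K (Set.range fun α : F => B.a α) ↔
      (∀ v, B.ce v r = 0) ∧ ∀ α ∉ F, B.ca α r = 0 := by
  have h1 : (Set.range fun α : F => B.a α) = B.basis '' (Sum.inr '' (F : Set E)) := by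
    ext x
    simp [a]
  rw [h1, Module.Basis.mem_span_image]
  constructor
  · intro h
    constructor
    · intro v
      by_contra hv
      have := h (Finsupp.mem_support_iff.2 hv)
      simp at this
    · intro α hα
      by_contra hv
      have := h (Finsupp.mem_support_iff.2 hv)
      simp [hα] at this
  · rintro ⟨h, h'⟩ i hi
    rw [Finset.mem_coe, Finsupp.mem_support_iff] at hi
    rcases i with v | α
    · exact absurd (h v) hi
    · by_contra hα
      exact hi (h' α fun hF => hα ⟨α, hF, rfl⟩)

section K0

/-- The homomorphism `ℤ^V → K₀` which maps the unit vectors to the classes of the simple modules. -/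
def ofVec : (V → ℤ) →+ IgusaTodorovK0 R where
  toFun x := ∑ v, x v • k0Class (B.simple v)
  map_zero' := by simp
  map_add' x y := by simp [add_smul, Finset.sum_add_distrib]

theorem ofVec_apply (x : V → ℤ) : B.ofVec x = ∑ v, x v • k0Class (B.simple v) := rfl

theorem ofVec_single [DecidableEq V] (v : V) : B.ofVec (Pi.single v 1) = k0Class (B.simple v) := by
  rw [ofVec_apply, Finset.sum_eq_single v]
  · simp
  · intro w _ hw
    simp [hw]
  · simp

theorem k0Class_mem_range_of_semisimple (N : FGModuleCat.{u} R)
    (hN : ∀ α (x : N), B.a α • x = 0) : k0Class N ∈ B.ofVec.range := by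
  classical
  let _ : Module K N := Module.compHom N (algebraMap K R)
  have : IsScalarTower K R N := ⟨fun c r m => by rw [Algebra.smul_def, mul_smul]; rfl⟩
  have := B.finite_base
  have : Module.Finite K N := Module.Finite.trans R N
  obtain ⟨I, _, w, b, hb⟩ := B.exists_weight_basis (M := N)
  rw [B.k0Class_of_basis N b w hb fun i α => hN α _]
  exact AddSubgroup.sum_mem _ fun i _ => ⟨Pi.single (w i) 1, B.ofVec_single _⟩

theorem k0_induction {P : IgusaTodorovK0 R → Prop} (h0 : P 0) (hM : ∀ M, P (k0Class M))
    (hadd : ∀ x y, P x → P y → P (x + y)) (hneg : ∀ x, P x → P (-x)) (x : IgusaTodorovK0 R) :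
    P x := by
  obtain ⟨y, rfl⟩ := QuotientAddGroup.mk_surjective x
  induction y using FreeAbelianGroup.induction_on with
  | zero => exact h0
  | of M => exact hM M
  | neg M _ => exact hneg _ (hM M)
  | add x y hx hy => exact hadd _ _ hx hy

variable [IsNoetherianRing R]

/-- The kernel of a projective cover lies in the radical, where all arrows act as zero. This is the
one step that accounts for the `+ 1` in the φ-dimension. -/
theorem omegaBar_mem_range (x : IgusaTodorovK0 R) : omegaBar R x ∈ B.ofVec.range := by
  induction x using k0_induction with
  | h0 => rw [map_zero]; exact zero_mem _
  | hM M =>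
    obtain ⟨P, f, hP, hP', hf, hker⟩ := B.exists_cover M
    rw [omegaBar_k0Class M f hf]
    refine B.k0Class_mem_range_of_semisimple _ fun α x => ?_
    apply Subtype.ext
    exact B.a_smul_of_mem_rad (hker x.2) α
  | hadd x y hx hy => rw [map_add]; exact add_mem hx hy
  | hneg x hx => rw [map_neg]; exact neg_mem hx

/-- The class of the syzygy of a quotient of `R e_v`. -/
theorem omegaBar_of_vertexProj {v : V} (F : Finset E)
    (M : FGModuleCat.{u} R) (f : B.vertexProj v →ₗ[R] M) (hf : Function.Surjective f)
    (hF : ∀ r : B.vertexProj v, f r = 0 ↔ B.ce v r = 0 ∧ ∀ α ∉ F, B.ca α r = 0)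
    (hs : ∀ α ∈ F, s α = v) :
    omegaBar R (k0Class M) = ∑ α ∈ F, k0Class (B.simple (t α)) := by
  rw [omegaBar_k0Class M f hf]
  refine B.k0Class_of_arrows F _ ((B.vertexProj v).subtype ∘ₗ (LinearMap.ker f).subtype)
    (Subtype.val_injective.comp Subtype.val_injective) fun r => ?_
  rw [mem_span_a]
  constructor
  · rintro ⟨x, rfl⟩
    have := (hF x.1).1 x.2
    refine ⟨fun w => ?_, this.2⟩
    by_cases hw : w = v
    · rw [hw]
      exact this.1
    · change B.ce w (x.1 : R) = 0
      rw [← B.mem_vertexProj.1 x.1.2, ce_mul, ce_e_of_ne _ hw, mul_zero]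
  · rintro ⟨h1, h2⟩
    have hr : r ∈ B.vertexProj v := by
      rw [B.decomp r]
      refine add_mem (sum_mem fun w _ => by rw [h1, zero_smul]; exact zero_mem _)
        (sum_mem fun α _ => ?_)
      by_cases hα : α ∈ F
      · refine Submodule.smul_of_tower_mem _ _ ?_
        rw [← hs α hα]
        exact B.a_mem_vertexProj α
      · rw [h2 α hα, zero_smul]
        exact zero_mem _
    exact ⟨⟨⟨r, hr⟩, (hF _).2 ⟨h1 v, h2⟩⟩, rfl⟩

-- The kernel of `R e_v → S_v` has the arrows starting at `v` as a basis, and each of them spans the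
-- simple module of its end.
open Classical in
theorem omegaBar_simple (v : V) :
    omegaBar R (k0Class (B.simple v)) = ∑ α with s α = v, k0Class (B.simple (t α)) := by
  refine B.omegaBar_of_vertexProj _ _ ((B.maxIdeal v).mkQ ∘ₗ (B.vertexProj v).subtype) ?_ ?_ ?_
  · intro x
    obtain ⟨r, rfl⟩ := Submodule.Quotient.mk_surjective _ x
    refine ⟨⟨r * B.e v, B.mem_vertexProj.2 (by rw [mul_assoc, e_mul_self])⟩, ?_⟩
    refine (Submodule.Quotient.eq _).2 ?_
    rw [mem_maxIdeal, map_sub, Submodule.subtype_apply, ce_mul, ce_e_self, mul_one, sub_self]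
  · intro r
    refine (Submodule.Quotient.mk_eq_zero _).trans ?_
    rw [mem_maxIdeal]
    refine (and_iff_left_of_imp fun _ α hα => ?_).symm
    have hα' : s α ≠ v := by simpa using hα
    rw [B.eq_of_mem_vertexProj r.2, map_add, map_smul, ca_e, smul_zero, zero_add, map_sum]
    refine Finset.sum_eq_zero fun β _ => ?_
    by_cases hβ : α = β
    · rw [← hβ, a_mul_e_of_ne _ hα', smul_zero, map_zero]
    · rw [a_mul, smul_smul, map_smul, ca_a_of_ne _ hβ, smul_zero]
  · intro α hα
    simpa using hα

open Classical in
/-- The matrix with the numbers of arrows between the vertices of a quiver as entries. -/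
def _root_.arrowMatrix {V E : Type*} [Fintype E] (s t : E → V) : Matrix V V ℤ :=
  Matrix.of fun v w => ((Finset.univ.filter fun α => s α = v ∧ t α = w).card : ℤ)

/-- Sorting the arrows that start at a vertex by their ends turns the syzygies of the simples into
rows of the matrix. -/
theorem omegaBar_ofVec (x : V → ℤ) :
    omegaBar R (B.ofVec x) = B.ofVec (Matrix.vecMul x (arrowMatrix s t)) := by
  classical
  rw [ofVec_apply, ofVec_apply, map_sum]
  simp only [map_zsmul, omegaBar_simple, Matrix.vecMul, dotProduct, Finset.sum_smul]
  rw [Finset.sum_comm]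
  refine Finset.sum_congr rfl fun v _ => ?_
  simp only [mul_smul, ← Finset.smul_sum]
  congr 1
  rw [← Finset.sum_fiberwise _ t]
  refine Finset.sum_congr rfl fun w _ => ?_
  rw [Finset.filter_filter, Finset.sum_congr rfl (g := fun _ => k0Class (B.simple w)),
    Finset.sum_const, arrowMatrix, Matrix.of_apply, natCast_zsmul]
  intro α hα
  rw [(Finset.mem_filter.1 hα).2.2]

end K0

end RadSqZeroBasis

end

/-! ### Multiplicities of simple direct summands and independence of the simple classes -/

noncomputable section

universe u

theorem Submodule.finrank_prod_eq {K M N : Type*} [Field K] [AddCommGroup M] [AddCommGroup N]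
    [Module K M] [Module K N] [Module.Finite K M] [Module.Finite K N]
    (p : Submodule K M) (q : Submodule K N) :
    Module.finrank K (p.prod q) = Module.finrank K p + Module.finrank K q := by
  rw [← Module.finrank_prod]
  exact LinearEquiv.finrank_eq
    { toFun := fun x => (⟨x.1.1, x.2.1⟩, ⟨x.1.2, x.2.2⟩)
      invFun := fun y => ⟨(y.1.1, y.2.1), y.1.2, y.2.2⟩
      map_add' := fun _ _ => rfl
      map_smul' := fun _ _ => rfl
      left_inv := fun _ => rfl
      right_inv := fun _ => rfl }

namespace RadSqZeroBasis

variable {K R V E : Type*} [Field K] [Ring R] [Algebra K R] [Fintype V] [Fintype E]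
  {s t : E → V} (B : RadSqZeroBasis K R s t)

section Mult

variable (v : V) (M : Type*) [AddCommGroup M] [Module R M] [Module K M] [IsScalarTower K R M]
variable {N : Type*} [AddCommGroup N] [Module R N] [Module K N] [IsScalarTower K R N]

/-- The elements of weight `v` of the socle. -/
def socWeight : Submodule K M where
  carrier := {x | B.e v • x = x ∧ ∀ α, B.a α • x = 0}
  zero_mem' := by simp
  add_mem' := by
    rintro x y ⟨hx, hx'⟩ ⟨hy, hy'⟩
    exact ⟨by rw [smul_add, hx, hy], fun α => by rw [smul_add, hx', hy', add_zero]⟩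
  smul_mem' := by
    rintro c x ⟨hx, hx'⟩
    exact ⟨by rw [smul_comm, hx], fun α => by rw [smul_comm, hx', smul_zero]⟩

/-- The elements of weight `v` of the radical. -/
def radWeight : Submodule K M where
  carrier := {x | B.e v • x = x ∧ x ∈ B.rad M}
  zero_mem' := by simp
  add_mem' := by
    rintro x y ⟨hx, hx'⟩ ⟨hy, hy'⟩
    exact ⟨by rw [smul_add, hx, hy], add_mem hx' hy'⟩
  smul_mem' := by
    rintro c x ⟨hx, hx'⟩
    exact ⟨by rw [smul_comm, hx], Submodule.smul_of_tower_mem _ _ hx'⟩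

variable {M v}

theorem mem_socWeight {x : M} :
    x ∈ B.socWeight v M ↔ B.e v • x = x ∧ ∀ α, B.a α • x = 0 := Iff.rfl

theorem mem_radWeight {x : M} :
    x ∈ B.radWeight v M ↔ B.e v • x = x ∧ x ∈ B.rad M := Iff.rfl

theorem radWeight_le : B.radWeight v M ≤ B.socWeight v M := fun _ hx =>
  ⟨hx.1, B.a_smul_of_mem_rad hx.2⟩

theorem map_socWeight (f : M →ₗ[R] N) {x : M} (hx : x ∈ B.socWeight v M) :
    f x ∈ B.socWeight v N :=
  ⟨by rw [← map_smul, hx.1], fun α => by rw [← map_smul, hx.2, map_zero]⟩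

theorem map_radWeight (f : M →ₗ[R] N) {x : M} (hx : x ∈ B.radWeight v M) :
    f x ∈ B.radWeight v N :=
  ⟨by rw [← map_smul, hx.1], B.map_mem_rad f hx.2⟩

variable (v M) in
/-- The multiplicity of the simple module of the vertex `v` as a direct summand of `M`. -/
def mult : ℤ := Module.finrank K (B.socWeight v M) - Module.finrank K (B.radWeight v M)

theorem mult_congr (f : M ≃ₗ[R] N) : B.mult v M = B.mult v N := by
  have h1 : (B.socWeight v M).map (f.restrictScalars K : M →ₗ[K] N) = B.socWeight v N := by
    ext x
    constructor
    · rintro ⟨y, hy, rfl⟩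
      exact B.map_socWeight f.toLinearMap hy
    · intro hx
      exact ⟨f.symm x, B.map_socWeight f.symm.toLinearMap hx, f.apply_symm_apply x⟩
  have h2 : (B.radWeight v M).map (f.restrictScalars K : M →ₗ[K] N) = B.radWeight v N := by
    ext x
    constructor
    · rintro ⟨y, hy, rfl⟩
      exact B.map_radWeight f.toLinearMap hy
    · intro hx
      exact ⟨f.symm x, B.map_radWeight f.symm.toLinearMap hx, f.apply_symm_apply x⟩
  rw [mult, mult, ← h1, ← h2, LinearEquiv.finrank_map_eq, LinearEquiv.finrank_map_eq]

theorem mult_prod [Module.Finite K M] [Module.Finite K N] :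
    B.mult v (M × N) = B.mult v M + B.mult v N := by
  have h1 : B.socWeight v (M × N) = (B.socWeight v M).prod (B.socWeight v N) := by
    ext ⟨x, y⟩
    simp only [mem_socWeight, Submodule.mem_prod, Prod.smul_mk, Prod.mk.injEq, Prod.mk_eq_zero,
      forall_and]
    tauto
  have h2 : B.radWeight v (M × N) = (B.radWeight v M).prod (B.radWeight v N) := by
    ext ⟨x, y⟩
    simp only [mem_radWeight, Submodule.mem_prod, Prod.smul_mk, Prod.mk.injEq]
    constructor
    · rintro ⟨⟨hx, hy⟩, h⟩
      exact ⟨⟨hx, B.map_mem_rad (LinearMap.fst R M N) h⟩,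
        ⟨hy, B.map_mem_rad (LinearMap.snd R M N) h⟩⟩
    · rintro ⟨⟨hx, hx'⟩, ⟨hy, hy'⟩⟩
      refine ⟨⟨hx, hy⟩, ?_⟩
      have := add_mem (B.map_mem_rad (LinearMap.inl R M N) hx')
        (B.map_mem_rad (LinearMap.inr R M N) hy')
      simpa using this
  rw [mult, h1, h2, Submodule.finrank_prod_eq, Submodule.finrank_prod_eq, mult, mult]
  push_cast
  ring

theorem mult_eq_zero (h : B.socWeight v M ≤ B.radWeight v M) : B.mult v M = 0 := by
  rw [mult, le_antisymm h B.radWeight_le, sub_self]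

/-- A socle element of weight `v` is killed by an arrow starting at `v`, and in a projective module
this places it in the radical. At a sink the claim would fail, as `R e_v` is simple there. -/
theorem mult_projective [Module.Projective R M] [Module.Finite R M] (hs : Function.Surjective s) :
    B.mult v M = 0 := by
  refine B.mult_eq_zero fun x hx => ⟨hx.1, ?_⟩
  obtain ⟨α, rfl⟩ := hs v
  rw [← hx.1]
  exact B.e_smul_mem_rad_of_projective (hx.2 α)

end Mult

theorem mult_simple_self {R : Type u} [Ring R] [Algebra K R] (B : RadSqZeroBasis K R s t) (v : V) :
    B.mult v (R ⧸ B.maxIdeal v) = 1 := by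
  have ha : ∀ α (x : R ⧸ B.maxIdeal v), B.a α • x = 0 := by
    intro α x
    obtain ⟨r, rfl⟩ := Submodule.Quotient.mk_surjective _ x
    refine (Submodule.Quotient.mk_eq_zero _).2 ?_
    change B.ce v (B.a α * r) = 0
    rw [ce_mul, ce_a, zero_mul]
  have h1 : B.socWeight v (R ⧸ B.maxIdeal v) = ⊤ := by
    rw [eq_top_iff]
    intro x _
    refine ⟨?_, fun α => ha α x⟩
    obtain ⟨r, rfl⟩ := Submodule.Quotient.mk_surjective _ x
    refine (Submodule.Quotient.eq _).2 ?_
    change B.ce v (B.e v * r - r) = 0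
    rw [map_sub, ce_mul, ce_e_self, one_mul, sub_self]
  have h2 : B.radWeight v (R ⧸ B.maxIdeal v) = ⊥ := by
    rw [eq_bot_iff]
    rintro x ⟨-, y, rfl⟩
    rw [Submodule.mem_bot]
    exact Finset.sum_eq_zero fun α _ => ha α _
  -- The character `ce v` identifies the simple module with `K`, so its dimension is one.
  have h3 : LinearMap.range (B.ce v) = ⊤ := LinearMap.range_eq_top.2 fun c =>
    ⟨c • B.e v, by rw [map_smul, ce_e_self, smul_eq_mul, mul_one]⟩
  have h4 : Module.finrank K (R ⧸ B.maxIdeal v) = 1 := by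
    rw [← Module.finrank_self K, ← finrank_top K K, ← h3]
    let eq : (R ⧸ (B.maxIdeal v).restrictScalars K) ≃ₗ[K] LinearMap.range (B.ce v) :=
      (Submodule.quotEquivOfEq _ _ (by ext; rfl)).trans (B.ce v).quotKerEquivRange
    exact (Submodule.Quotient.restrictScalarsEquiv K (B.maxIdeal v)).symm.finrank_eq.trans
      eq.finrank_eq
  rw [mult, h1, h2, finrank_top, h4, finrank_bot]
  simp

theorem mult_simple_of_ne {R : Type u} [Ring R] [Algebra K R] (B : RadSqZeroBasis K R s t)
    {v w : V} (h : v ≠ w) : B.mult v (R ⧸ B.maxIdeal w) = 0 := by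
  refine B.mult_eq_zero ?_
  rintro x ⟨hx, -⟩
  have : x = 0 := by
    rw [← hx]
    obtain ⟨r, rfl⟩ := Submodule.Quotient.mk_surjective _ x
    refine (Submodule.Quotient.mk_eq_zero _).2 ?_
    change B.ce w (B.e v * r) = 0
    rw [ce_e_mul_of_ne _ h.symm]
  rw [this]
  exact zero_mem _

section K0

variable {R : Type u} [Ring R] [Algebra K R] (B : RadSqZeroBasis K R s t)

/-- The multiplicity of a simple module as a function on `K₀`. -/
def multK0 (hs : Function.Surjective s) (v : V) : IgusaTodorovK0 R →+ ℤ :=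
  QuotientAddGroup.lift _ (FreeAbelianGroup.lift fun M : FGModuleCat.{u} R =>
    letI : Module K M := Module.compHom M (algebraMap K R)
    haveI : IsScalarTower K R M := ⟨fun c r m => by rw [Algebra.smul_def, mul_smul]; rfl⟩
    B.mult v M) (by
    have := B.finite_base
    rw [AddSubgroup.closure_le]
    rintro x (⟨M, M', M'', ⟨e⟩, rfl⟩ | ⟨P, hP, rfl⟩)
    · rw [SetLike.mem_coe, AddMonoidHom.mem_ker, map_sub, map_sub, FreeAbelianGroup.lift_apply_of,
        FreeAbelianGroup.lift_apply_of, FreeAbelianGroup.lift_apply_of]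
      let _ : Module K M := Module.compHom M (algebraMap K R)
      have : IsScalarTower K R M := ⟨fun c r m => by rw [Algebra.smul_def, mul_smul]; rfl⟩
      let _ : Module K M' := Module.compHom M' (algebraMap K R)
      have : IsScalarTower K R M' := ⟨fun c r m => by rw [Algebra.smul_def, mul_smul]; rfl⟩
      let _ : Module K M'' := Module.compHom M'' (algebraMap K R)
      have : IsScalarTower K R M'' := ⟨fun c r m => by rw [Algebra.smul_def, mul_smul]; rfl⟩
      have : Module.Finite K M' := Module.Finite.trans R M'
      have : Module.Finite K M'' := Module.Finite.trans R M''
      have h := (B.mult_congr (v := v) e).trans B.mult_prod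
      linarith
    · rw [SetLike.mem_coe, AddMonoidHom.mem_ker, FreeAbelianGroup.lift_apply_of]
      let _ : Module K P := Module.compHom P (algebraMap K R)
      have : IsScalarTower K R P := ⟨fun c r m => by rw [Algebra.smul_def, mul_smul]; rfl⟩
      exact B.mult_projective hs)

variable (hs : Function.Surjective s)

theorem multK0_k0Class (v : V) (M : FGModuleCat.{u} R) [h : Module K M] [IsScalarTower K R M] :
    B.multK0 hs v (k0Class M) = B.mult v M := by
  refine (FreeAbelianGroup.lift_apply_of _ _).trans ?_
  -- The scalar tower forces any given `K`-structure to be the restriction of the `R`-structure that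
  -- was used in the definition.
  have : h = Module.compHom M (algebraMap K R) := by
    refine Module.ext' _ _ fun c m => ?_
    rw [← one_smul R m, ← smul_assoc, Algebra.smul_def, mul_one, one_smul]
    rfl
  subst this
  rfl

theorem multK0_ofVec (v : V) (x : V → ℤ) : B.multK0 hs v (B.ofVec x) = x v := by
  rw [ofVec_apply, map_sum, Finset.sum_eq_single v]
  · rw [map_zsmul, multK0_k0Class, mult_simple_self, smul_eq_mul, mul_one]
  · intro w _ hw
    rw [map_zsmul, multK0_k0Class, mult_simple_of_ne _ hw.symm, smul_zero]
  · simp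

-- The multiplicities recover the coefficients. The absence of sinks is what makes them functions on
-- K₀, where projectives vanish.
include hs in
theorem ofVec_injective : Function.Injective B.ofVec := fun x y h => by
  funext v
  rw [← B.multK0_ofVec hs v x, h, multK0_ofVec]

end K0

/-! ### Indecomposable modules with simple syzygy -/

section ArrowQuotient

variable {R : Type u} [Ring R] [Algebra K R] (B : RadSqZeroBasis K R s t)

/-- The left ideal generated by an arrow, as a submodule of the projective module of its start. -/
def arrowSpan (α : E) : Submodule R (B.vertexProj (s α)) :=
  Submodule.span R {⟨B.a α, B.a_mem_vertexProj α⟩}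

theorem mem_arrowSpan {α : E} {x : B.vertexProj (s α)} :
    x ∈ B.arrowSpan α ↔ B.ce (s α) x = 0 ∧ ∀ β ∉ ({α} : Finset E), B.ca β x = 0 := by
  rw [arrowSpan, Submodule.mem_span_singleton]
  constructor
  · rintro ⟨r, rfl⟩
    rw [Submodule.coe_smul, smul_eq_mul, mul_a]
    refine ⟨by rw [map_smul, ce_a, smul_zero], fun β hβ => ?_⟩
    rw [map_smul, ca_a_of_ne _ (by simpa using hβ), smul_zero]
  · rintro ⟨h1, h2⟩
    refine ⟨B.ca α x • B.e (t α), ?_⟩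
    apply Subtype.ext
    rw [Submodule.coe_smul, smul_eq_mul, smul_mul_assoc, e_mul_a_self, B.decomp x,
      Finset.sum_eq_zero, zero_add, Finset.sum_eq_single α]
    · simp only [map_smul, ca_a_self, smul_eq_mul, mul_one]
    · intro β _ hβ
      rw [h2 β (by simpa using hβ), zero_smul]
    · simp
    · intro w _
      by_cases hw : w = s α
      · rw [hw, h1, zero_smul]
      · rw [← B.mem_vertexProj.1 x.2, ce_mul, ce_e_of_ne _ hw, mul_zero, zero_smul]

/-- The quotient of `R e_v` by the left ideal generated by an arrow that starts at `v`. -/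
abbrev arrowQuotient (α : E) : FGModuleCat.{u} R :=
  FGModuleCat.of R (B.vertexProj (s α) ⧸ B.arrowSpan α)

/-- The kernel of the projection from `R e_(s α)` is the line `K a_α`. Without sources every simple
class is therefore hit by `omegaBar`, which makes the upper bound for the φ-dimension sharp. -/
theorem omegaBar_arrowQuotient [IsNoetherianRing R] (α : E) :
    omegaBar R (k0Class (B.arrowQuotient α)) = k0Class (B.simple (t α)) := by
  rw [B.omegaBar_of_vertexProj {α} _ (B.arrowSpan α).mkQ (Submodule.mkQ_surjective _),
    Finset.sum_singleton]
  · intro r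
    refine (Submodule.Quotient.mk_eq_zero _).trans ?_
    rw [mem_arrowSpan]
  · simp

/-- The quotients of `R e_v` by submodules of the radical are indecomposable. -/
theorem isIndecomposableModule_quotient {v : V} (L : Submodule R (B.vertexProj v))
    (hL : ∀ x ∈ L, B.ce v x = 0) : IsIndecomposableModule R (B.vertexProj v ⧸ L) := by
  -- `R e_v` is local: an element with nonzero coefficient at `e v` generates it. Multiplying `x` by
  -- arrows yields the arrows themselves, and subtracting these from `x` leaves a multiple of `e v`.
  have key : ∀ (p : Submodule R (B.vertexProj v ⧸ L)) (x : B.vertexProj v),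
      Submodule.Quotient.mk x ∈ p → B.ce v x ≠ 0 → p = ⊤ := by
    intro p x hx hc
    have h1 : ∀ α (y : B.vertexProj v), (y : R) = B.a α * B.e v →
        (Submodule.Quotient.mk y : B.vertexProj v ⧸ L) ∈ p := by
      intro α y hy
      have h2 : B.ce v x • y = B.a α • x := by
        apply Subtype.ext
        rw [Submodule.coe_smul, Submodule.coe_smul_of_tower, smul_eq_mul,
          ← B.mem_vertexProj.1 x.2, ← mul_assoc, a_mul, smul_mul_assoc, ← hy]
        by_cases hα : s α = v
        · rw [hα, ce_mul, ce_e_self, mul_one]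
        · rw [hy, a_mul_e_of_ne _ hα, smul_zero, smul_zero]
      have h3 : y = (B.ce v x)⁻¹ • B.a α • x := by
        rw [← h2, smul_smul, inv_mul_cancel₀ hc, one_smul]
      rw [h3, Submodule.Quotient.mk_smul, Submodule.Quotient.mk_smul]
      exact Submodule.smul_of_tower_mem _ _ (Submodule.smul_mem _ _ hx)
    have h4 : (Submodule.Quotient.mk ⟨B.e v, B.e_mem_vertexProj v⟩ : B.vertexProj v ⧸ L) ∈ p := by
      have h5 : (⟨B.e v, B.e_mem_vertexProj v⟩ : B.vertexProj v) =
          (B.ce v x)⁻¹ • (x - ∑ α, B.ca α x • ⟨B.a α * B.e v, B.mem_vertexProj.2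
            (by rw [mul_assoc, e_mul_self])⟩) := by
        apply Subtype.ext
        rw [Submodule.coe_smul_of_tower, Submodule.coe_sub, AddSubmonoidClass.coe_finsetSum]
        simp only [Submodule.coe_smul_of_tower]
        conv_rhs => rw [B.eq_of_mem_vertexProj x.2]
        rw [map_add, map_smul, ce_e_self, map_sum, Finset.sum_eq_zero, add_zero]
        · have h6 : ∀ α, B.ca α (B.ce v x • B.e v + ∑ β, B.ca β x • (B.a β * B.e v)) =
              B.ca α x := fun α => by rw [← B.eq_of_mem_vertexProj x.2]
          simp only [h6]
          rw [add_sub_cancel_right, smul_eq_mul, mul_one, smul_smul, inv_mul_cancel₀ hc, one_smul]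
        · intro α _
          rw [map_smul, ce_mul, ce_a, zero_mul, smul_zero]
      rw [h5, Submodule.Quotient.mk_smul, Submodule.Quotient.mk_sub]
      refine Submodule.smul_of_tower_mem _ _ (sub_mem hx ?_)
      rw [← Submodule.mkQ_apply, map_sum]
      refine sum_mem fun α _ => ?_
      rw [Submodule.mkQ_apply, Submodule.Quotient.mk_smul]
      exact Submodule.smul_of_tower_mem _ _ (h1 α _ rfl)
    rw [eq_top_iff]
    intro y _
    obtain ⟨r, rfl⟩ := Submodule.Quotient.mk_surjective _ y
    have : r = (r : R) • (⟨B.e v, B.e_mem_vertexProj v⟩ : B.vertexProj v) :=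
      Subtype.ext (B.mem_vertexProj.1 r.2).symm
    rw [this, Submodule.Quotient.mk_smul]
    exact Submodule.smul_mem _ _ h4
  have hne : (Submodule.Quotient.mk ⟨B.e v, B.e_mem_vertexProj v⟩ : B.vertexProj v ⧸ L) ≠ 0 := by
    rw [Ne, Submodule.Quotient.mk_eq_zero]
    intro h
    exact one_ne_zero ((B.ce_e_self v).symm.trans (hL _ h))
  refine ⟨⟨_, _, hne⟩, fun p q hpq => ?_⟩
  -- Writing the generator as a sum of elements of `p` and `q`, one of the two has a nonzero
  -- coefficient at `e v`, so that summand is everything.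
  obtain ⟨x, hx, y, hy, hxy⟩ := Submodule.mem_sup.1 (hpq.sup_eq_top ▸ Submodule.mem_top :
    (Submodule.Quotient.mk ⟨B.e v, B.e_mem_vertexProj v⟩ : B.vertexProj v ⧸ L) ∈ p ⊔ q)
  obtain ⟨x, rfl⟩ := Submodule.Quotient.mk_surjective _ x
  obtain ⟨y, rfl⟩ := Submodule.Quotient.mk_surjective _ y
  rw [← Submodule.Quotient.mk_add, Submodule.Quotient.eq] at hxy
  have h1 := hL _ hxy
  rw [Submodule.coe_sub, Submodule.coe_add, map_sub, map_add, ce_e_self, sub_eq_zero] at h1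
  by_cases hcx : B.ce v x = 0
  · rw [hcx, zero_add] at h1
    left
    have := hpq.inf_eq_bot
    rwa [key q y hy (by rw [h1]; exact one_ne_zero), inf_top_eq] at this
  · right
    have := hpq.inf_eq_bot
    rwa [key p x hx hcx, top_inf_eq] at this

theorem isIndecomposableModule_arrowQuotient (α : E) :
    IsIndecomposableModule R (B.arrowQuotient α) :=
  B.isIndecomposableModule_quotient _ fun _ hx => (B.mem_arrowSpan.1 hx).1

theorem isIndecomposableModule_simple (v : V) : IsIndecomposableModule R (B.simple v) := by
  have key : ∀ (p : Submodule R (R ⧸ B.maxIdeal v)) (r : R),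
      Submodule.Quotient.mk r ∈ p → B.ce v r ≠ 0 → p = ⊤ := by
    intro p r hr hc
    rw [eq_top_iff]
    intro y _
    obtain ⟨x, rfl⟩ := Submodule.Quotient.mk_surjective _ y
    have : (Submodule.Quotient.mk x : R ⧸ B.maxIdeal v) =
        Submodule.Quotient.mk (x • (B.ce v r)⁻¹ • r) := by
      rw [Submodule.Quotient.eq, mem_maxIdeal, map_sub, smul_eq_mul, ce_mul, map_smul, smul_eq_mul,
        inv_mul_cancel₀ hc, mul_one, sub_self]
    rw [this, Submodule.Quotient.mk_smul, Submodule.Quotient.mk_smul]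
    exact p.smul_mem _ (Submodule.smul_of_tower_mem _ _ hr)
  have h1 : B.ce v 1 = 1 := by
    have := B.ce_mul v (B.e v) 1
    rwa [mul_one, ce_e_self, one_mul, eq_comm] at this
  refine ⟨⟨Submodule.Quotient.mk 1, 0, ?_⟩, fun p q hpq => ?_⟩
  · rw [Ne, Submodule.Quotient.mk_eq_zero, mem_maxIdeal, h1]
    exact one_ne_zero
  obtain ⟨x, hx, y, hy, hxy⟩ := Submodule.mem_sup.1 (hpq.sup_eq_top ▸ Submodule.mem_top :
    (Submodule.Quotient.mk 1 : R ⧸ B.maxIdeal v) ∈ p ⊔ q)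
  obtain ⟨x, rfl⟩ := Submodule.Quotient.mk_surjective _ x
  obtain ⟨y, rfl⟩ := Submodule.Quotient.mk_surjective _ y
  rw [← Submodule.Quotient.mk_add, Submodule.Quotient.eq, mem_maxIdeal, map_sub, map_add, h1,
    sub_eq_zero] at hxy
  by_cases hcx : B.ce v x = 0
  · rw [hcx, zero_add] at hxy
    left
    have := hpq.inf_eq_bot
    rwa [key q y hy (by rw [hxy]; exact one_ne_zero), inf_top_eq] at this
  · right
    have := hpq.inf_eq_bot
    rwa [key p x hx hcx, top_inf_eq] at this

/-- If another arrow starts where `α` does, then the quotient of `R e_v` by the left ideal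
generated by `α` has no simple direct summand. -/
theorem multK0_arrowQuotient (hs : Function.Surjective s) {α β : E} (hαβ : β ≠ α) (h : s β = s α)
    (w : V) : B.multK0 hs w (k0Class (B.arrowQuotient α)) = 0 := by
  have : B.mult w (B.vertexProj (s α) ⧸ B.arrowSpan α) = 0 := by
    refine B.mult_eq_zero ?_
    rintro x ⟨hx, hx'⟩
    refine ⟨hx, ?_⟩
    obtain ⟨r, rfl⟩ := Submodule.Quotient.mk_surjective _ x
    -- The second arrow detects the top: `a β • r` is the `e`-coefficient of `r` times `a β`, which
    -- lies in the span of `a α` only if that coefficient is zero.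
    have h1 := hx' β
    rw [← Submodule.Quotient.mk_smul, Submodule.Quotient.mk_eq_zero, mem_arrowSpan] at h1
    have h2 := h1.2 β (by simpa using hαβ)
    rw [Submodule.coe_smul, smul_eq_mul, a_mul, h, map_smul, ca_a_self, smul_eq_mul, mul_one] at h2
    have h3 : r ∈ B.rad (B.vertexProj (s α)) := by
      refine ⟨fun γ => B.ca γ r • ⟨B.e (s α), B.e_mem_vertexProj _⟩, ?_⟩
      apply Subtype.ext
      conv_lhs => rw [B.eq_of_mem_vertexProj r.2, h2, zero_smul, zero_add]
      rw [AddSubmonoidClass.coe_finsetSum]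
      refine Finset.sum_congr rfl fun γ _ => ?_
      rw [Submodule.coe_smul, Submodule.coe_smul_of_tower, smul_eq_mul, mul_smul_comm]
    exact B.map_mem_rad (B.arrowSpan α).mkQ h3
  exact (B.multK0_k0Class hs w (B.arrowQuotient α)).trans this

end ArrowQuotient

end RadSqZeroBasis

/-- A finite family of indecomposable modules consists of direct summands of a single module. -/
theorem exists_forall_mem_addClosure {R : Type u} [Ring R] {ι : Type*} [Finite ι]
    (N : ι → FGModuleCat.{u} R) (hN : ∀ i, IsIndecomposableModule R (N i)) :
    ∃ M : FGModuleCat.{u} R, ∀ i, k0Class (N i) ∈ addClosure M := by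
  classical
  have := Fintype.ofFinite ι
  suffices h : ∀ F : Finset ι, ∃ M : FGModuleCat.{u} R, ∀ i ∈ F, ∃ N' : FGModuleCat.{u} R,
      Nonempty (M ≃ₗ[R] N i × N') by
    obtain ⟨M, hM⟩ := h Finset.univ
    refine ⟨M, fun i => AddSubgroup.subset_closure ?_⟩
    obtain ⟨N', e⟩ := hM i (Finset.mem_univ i)
    exact ⟨N i, N', hN i, e, rfl⟩
  intro F
  induction F using Finset.induction_on with
  | empty => exact ⟨FGModuleCat.of R PUnit, by simp⟩
  | insert i F _ ih =>
    obtain ⟨M, hM⟩ := ih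
    refine ⟨FGModuleCat.of R (N i × M), fun j hj => ?_⟩
    rcases Finset.mem_insert.1 hj with rfl | hj
    · exact ⟨M, ⟨LinearEquiv.refl R _⟩⟩
    · obtain ⟨N', ⟨e⟩⟩ := hM j hj
      exact ⟨FGModuleCat.of R (N i × N'),
        ⟨((LinearEquiv.refl R (N i)).prodCongr e).trans (LinearEquiv.prodAssoc R _ _ _).symm ≪≫ₗ
          ((LinearEquiv.prodComm R _ _).prodCongr (LinearEquiv.refl R _)) ≪≫ₗ
          LinearEquiv.prodAssoc R _ _ _⟩⟩

end

/-! ### The index of the eigenvalue zero of an endomorphism -/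

noncomputable section

section ZeroIndex

variable {F W W' : Type*} [Field F] [AddCommGroup W] [Module F W] [AddCommGroup W'] [Module F W']

/-- The index of the eigenvalue zero: the least `k` at which the kernels of the powers stabilize. -/
def zeroIndex (f : Module.End F W) : ℕ :=
  sInf {k | LinearMap.ker (f ^ (k + 1)) ≤ LinearMap.ker (f ^ k)}

theorem zeroIndex_le {f : Module.End F W} {k : ℕ}
    (h : LinearMap.ker (f ^ (k + 1)) ≤ LinearMap.ker (f ^ k)) : zeroIndex f ≤ k :=
  Nat.sInf_le h

theorem ker_pow_succ_le_of_zeroIndex_le [FiniteDimensional F W] {f : Module.End F W} {k : ℕ}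
    (hk : zeroIndex f ≤ k) : LinearMap.ker (f ^ (k + 1)) ≤ LinearMap.ker (f ^ k) := by
  obtain ⟨m, -, hm⟩ := Module.End.exists_ker_pow_eq_ker_pow_succ f
  have h : LinearMap.ker (f ^ (zeroIndex f + 1)) ≤ LinearMap.ker (f ^ zeroIndex f) :=
    Nat.sInf_mem (s := {k | LinearMap.ker (f ^ (k + 1)) ≤ LinearMap.ker (f ^ k)}) ⟨m, hm.ge⟩
  obtain ⟨d, rfl⟩ := Nat.exists_eq_add_of_le hk
  intro x hx
  rw [LinearMap.mem_ker] at hx ⊢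
  rw [pow_add, Module.End.mul_apply]
  refine h ?_
  rw [LinearMap.mem_ker, ← Module.End.mul_apply, ← pow_add, ← hx]
  congr 2
  ring

theorem exists_of_lt_zeroIndex {f : Module.End F W} {k : ℕ} (hk : k < zeroIndex f) :
    ∃ x, (f ^ (k + 1)) x = 0 ∧ (f ^ k) x ≠ 0 := by
  have := Nat.notMem_of_lt_sInf hk
  simpa [SetLike.not_le_iff_exists] using this

theorem pow_comm_apply {f : Module.End F W} {g : Module.End F W'} {P : W' →ₗ[F] W}
    (h : ∀ x, f (P x) = P (g x)) (k : ℕ) (x : W') : (f ^ k) (P x) = P ((g ^ k) x) := by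
  induction k generalizing x with
  | zero => rfl
  | succ k ih => rw [pow_succ, pow_succ, Module.End.mul_apply, Module.End.mul_apply, h, ih]

theorem zeroIndex_le_of_injective [FiniteDimensional F W] {f : Module.End F W}
    {g : Module.End F W'} {P : W' →ₗ[F] W} (h : ∀ x, f (P x) = P (g x))
    (hP : Function.Injective P) : zeroIndex g ≤ zeroIndex f := by
  refine zeroIndex_le fun x hx => ?_
  rw [LinearMap.mem_ker] at hx ⊢
  apply hP
  rw [map_zero, ← pow_comm_apply h]
  refine ker_pow_succ_le_of_zeroIndex_le le_rfl ?_
  rw [LinearMap.mem_ker, pow_comm_apply h, hx, map_zero]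

/-- On `W ⧸ S` the kernels stabilize by the dimension `d`, so `f ^ d` moves the relevant vectors
into `S`, where `k` further steps suffice. -/
theorem zeroIndex_le_add [FiniteDimensional F W] {f : Module.End F W} {S : Submodule F W}
    (hS : S ≤ S.comap f) {k : ℕ} (hk : ∀ x ∈ S, (f ^ (k + 1)) x = 0 → (f ^ k) x = 0) :
    zeroIndex f ≤ k + Module.finrank F (W ⧸ S) := by
  set d := Module.finrank F (W ⧸ S)
  refine zeroIndex_le fun x hx => ?_
  rw [LinearMap.mem_ker] at hx ⊢
  have hmk : ∀ x, (S.mapQ S f hS) (S.mkQ x) = S.mkQ (f x) := fun x => rfl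
  have h1 : S.mkQ x ∈ LinearMap.ker ((S.mapQ S f hS) ^ d) := by
    rw [← Module.End.ker_pow_eq_ker_pow_finrank_of_le (m := k + d + 1) (by omega),
      LinearMap.mem_ker, pow_comm_apply hmk, hx, map_zero]
  rw [LinearMap.mem_ker, pow_comm_apply hmk, Submodule.mkQ_apply,
    Submodule.Quotient.mk_eq_zero] at h1
  rw [pow_add, Module.End.mul_apply]
  refine hk _ h1 ?_
  rw [← Module.End.mul_apply, ← pow_add, ← hx]
  congr 2
  ring

theorem zeroIndex_add_finrank_le [FiniteDimensional F W] [FiniteDimensional F W']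
    {f : Module.End F W} {g : Module.End F W'} {P : W' →ₗ[F] W} (h : ∀ x, f (P x) = P (g x))
    (hP : Function.Injective P) :
    zeroIndex f + Module.finrank F W' ≤ zeroIndex g + Module.finrank F W := by
  have h1 : zeroIndex f ≤ zeroIndex g + Module.finrank F (W ⧸ LinearMap.range P) := by
    refine zeroIndex_le_add ?_ ?_
    · rintro _ ⟨x, rfl⟩
      exact ⟨g x, (h x).symm⟩
    · rintro _ ⟨x, rfl⟩ hx
      rw [pow_comm_apply h] at hx ⊢
      have h2 := hP (hx.trans (map_zero P).symm)
      have h3 : (g ^ zeroIndex g) x = 0 := ker_pow_succ_le_of_zeroIndex_le le_rfl h2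
      rw [h3, map_zero]
  have h2 := Submodule.finrank_quotient_add_finrank (LinearMap.range P)
  have h3 := LinearMap.finrank_range_of_inj hP
  omega

theorem zeroIndex_lt_finrank [FiniteDimensional F W] {f : Module.End F W}
    (h : f ^ Module.finrank F W ≠ 0) : zeroIndex f < Module.finrank F W := by
  set n := Module.finrank F W
  -- Fitting's lemma: `f` is injective on the range of `f ^ n`, which is nonzero by hypothesis and
  -- so has codimension less than `n`.
  have hn : zeroIndex f ≤ 0 + Module.finrank F (W ⧸ LinearMap.range (f ^ n)) := by
    refine zeroIndex_le_add ?_ ?_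
    · rintro _ ⟨x, rfl⟩
      refine ⟨f x, ?_⟩
      rw [← Module.End.mul_apply, ← Module.End.mul_apply, ← pow_succ, ← pow_succ']
    · rintro _ ⟨x, rfl⟩ hx
      rw [zero_add, pow_one, ← Module.End.mul_apply, ← pow_succ'] at hx
      rw [pow_zero, Module.End.one_apply]
      exact (Module.End.ker_pow_eq_ker_pow_finrank_of_le (Nat.le_succ n)).le hx
  have h2 := Submodule.finrank_quotient_add_finrank (LinearMap.range (f ^ n))
  have h3 : 0 < Module.finrank F (LinearMap.range (f ^ n)) := by
    rw [Nat.pos_iff_ne_zero, Ne, Submodule.finrank_eq_zero, LinearMap.range_eq_bot]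
    exact h
  omega

theorem finrank_ker_toLin'_transpose {n : Type*} [Fintype n] [DecidableEq n] (A : Matrix n n F) :
    Module.finrank F (LinearMap.ker (Matrix.toLin' A.transpose)) =
      Module.finrank F (LinearMap.ker (Matrix.toLin' A)) := by
  have h1 := LinearMap.finrank_range_add_finrank_ker (Matrix.toLin' A)
  have h2 := LinearMap.finrank_range_add_finrank_ker (Matrix.toLin' A.transpose)
  have h3 : A.transpose.rank = A.rank := Matrix.rank_transpose A
  rw [Matrix.rank, Matrix.rank] at h3
  rw [Matrix.toLin'_apply'] at h1 h2 ⊢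
  rw [Matrix.toLin'_apply']
  omega

/-- The kernels of successive powers are nested, so stabilization can be read off from dimensions.
-/
theorem ker_pow_toLin'_iff {n : Type*} [Fintype n] [DecidableEq n] (A : Matrix n n F) (k : ℕ) :
    LinearMap.ker (Matrix.toLin' A ^ (k + 1)) ≤ LinearMap.ker (Matrix.toLin' A ^ k) ↔
      Module.finrank F (LinearMap.ker (Matrix.toLin' (A ^ (k + 1)))) ≤
        Module.finrank F (LinearMap.ker (Matrix.toLin' (A ^ k))) := by
  rw [Matrix.toLin'_pow, Matrix.toLin'_pow]
  refine ⟨Submodule.finrank_mono, fun h => ?_⟩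
  refine (Submodule.eq_of_le_of_finrank_le ?_ h).ge
  rw [pow_succ']
  exact LinearMap.ker_le_ker_comp _ _

/-- Powers of a matrix and of its transpose have equal rank. This links the two sides of the
argument: `omegaBar` acts on row vectors, while functions constant on the classes of a partition are
column vectors. -/
theorem zeroIndex_toLin'_transpose {n : Type*} [Fintype n] [DecidableEq n] (A : Matrix n n F) :
    zeroIndex (Matrix.toLin' A.transpose) = zeroIndex (Matrix.toLin' A) := by
  rw [zeroIndex, zeroIndex]
  congr 1
  ext k
  rw [Set.mem_ofPred_eq, Set.mem_ofPred_eq, ker_pow_toLin'_iff, ker_pow_toLin'_iff,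
    ← Matrix.transpose_pow, ← Matrix.transpose_pow, finrank_ker_toLin'_transpose,
    finrank_ker_toLin'_transpose]

end ZeroIndex

/-! ### Integral matrices and the comparison with a quotient matrix -/

namespace Matrix

variable {n : Type*} [Fintype n] [DecidableEq n]

/-- The index of the eigenvalue zero of an integral matrix. -/
def zeroIndex (T : Matrix n n ℤ) : ℕ := _root_.zeroIndex (toLin' (T.map ((↑) : ℤ → ℚ)))

theorem toLin'_transpose_pow_cast (T : Matrix n n ℤ) (k : ℕ) (x : n → ℤ) :
    (toLin' (T.map ((↑) : ℤ → ℚ)).transpose ^ k) (fun i => (x i : ℚ)) =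
      fun i => ((x ᵥ* T ^ k) i : ℚ) := by
  have h1 : (T.map ((↑) : ℤ → ℚ)) ^ k = (T ^ k).map ((↑) : ℤ → ℚ) :=
    (map_pow (Int.castRingHom ℚ).mapMatrix T k).symm
  rw [← toLin'_pow, toLin'_apply, ← transpose_pow, h1, mulVec_transpose]
  ext i
  simp [vecMul, dotProduct]

theorem vecMul_pow_eq_zero (T : Matrix n n ℤ) {k : ℕ} (hk : T.zeroIndex ≤ k) {x : n → ℤ}
    (hx : x ᵥ* T ^ (k + 1) = 0) : x ᵥ* T ^ k = 0 := by
  rw [zeroIndex, ← zeroIndex_toLin'_transpose] at hk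
  have h1 := ker_pow_succ_le_of_zeroIndex_le hk
    (x := fun i => (x i : ℚ)) (by
      rw [LinearMap.mem_ker, toLin'_transpose_pow_cast, hx]
      ext i
      simp)
  rw [LinearMap.mem_ker, toLin'_transpose_pow_cast] at h1
  ext i
  exact Int.cast_eq_zero.1 (congrFun h1 i)

theorem exists_vecMul_pow_eq_zero (T : Matrix n n ℤ) {k : ℕ} (hk : k < T.zeroIndex) :
    ∃ x : n → ℤ, x ᵥ* T ^ (k + 1) = 0 ∧ x ᵥ* T ^ k ≠ 0 := by
  rw [zeroIndex, ← zeroIndex_toLin'_transpose] at hk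
  obtain ⟨x, h1, h2⟩ := exists_of_lt_zeroIndex hk
  -- The index is defined over `ℚ`, but elements of K₀ need integral coefficients; `d` is a common
  -- denominator.
  obtain ⟨d, hd⟩ := IsLocalization.exist_integer_multiples_of_finite (nonZeroDivisors ℤ) x
  choose y hy using hd
  have hd0 : (d : ℤ) ≠ 0 := nonZeroDivisors.ne_zero d.2
  have hxy : (fun i => (y i : ℚ)) = (d : ℤ) • x := funext hy
  refine ⟨y, ?_, fun h => h2 ?_⟩
  · have := toLin'_transpose_pow_cast T (k + 1) y
    rw [hxy, map_zsmul, h1, smul_zero] at this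
    ext i
    exact Int.cast_eq_zero.1 (congrFun this i).symm
  · have := toLin'_transpose_pow_cast T k y
    rw [hxy, map_zsmul, h] at this
    have h0 : (d : ℤ) • (toLin' (T.map ((↑) : ℤ → ℚ)).transpose ^ k) x = 0 := by
      rw [this]
      ext i
      simp
    exact (smul_eq_zero.1 h0).resolve_left hd0

/-- Index zero means trivial kernel, so the determinant is nonzero, and a row of the adjugate is an
integral preimage of `det T` times the unit vector. -/
theorem exists_vecMul_eq_single (T : Matrix n n ℤ) (hT : T.zeroIndex = 0) (w : n) :
    ∃ (c : ℤ) (y : n → ℤ), c ≠ 0 ∧ y ᵥ* T = Pi.single w c := by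
  refine ⟨T.det, (Pi.single w 1) ᵥ* T.adjugate, fun h => ?_, ?_⟩
  · obtain ⟨x, hx0, hx⟩ := exists_vecMul_eq_zero_iff.2 h
    refine hx0 ?_
    have := T.vecMul_pow_eq_zero (k := 0) hT.le (x := x) (by rwa [zero_add, pow_one])
    rwa [pow_zero, vecMul_one] at this
  · rw [vecMul_vecMul, adjugate_mul, vecMul_smul, vecMul_one, ← Pi.single_smul, smul_eq_mul,
      mul_one]

theorem zeroIndex_lt_card (T : Matrix n n ℤ) [Nonempty n] (h0 : ∀ v w, 0 ≤ T v w)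
    (h : ∀ v, ∃ w, T v w ≠ 0) : T.zeroIndex < Fintype.card n := by
  -- Every row has an entry at least 1 and no negative ones, so `T` preserves vectors with all
  -- entries at least 1. Hence no power of `T` is zero.
  have key : ∀ k, ∀ i, 1 ≤ ((toLin' (T.map ((↑) : ℤ → ℚ)) ^ k) 1) i := by
    intro k
    induction k with
    | zero => intro i; simp
    | succ k ih =>
      intro i
      rw [pow_succ', Module.End.mul_apply, toLin'_apply, mulVec, dotProduct]
      have hnn : ∀ j, (0 : ℚ) ≤ (T.map ((↑) : ℤ → ℚ)) i j := fun j => by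
        rw [map_apply]
        exact_mod_cast h0 i j
      obtain ⟨w, hw⟩ := h i
      have h1 : (1 : ℚ) ≤ (T.map ((↑) : ℤ → ℚ)) i w := by
        rw [map_apply]
        exact_mod_cast Int.add_one_le_of_lt (lt_of_le_of_ne (h0 i w) hw.symm)
      refine (one_le_mul_of_one_le_of_one_le h1 (ih w)).trans ?_
      exact Finset.single_le_sum (f := fun j => (T.map ((↑) : ℤ → ℚ)) i j *
        ((toLin' (T.map ((↑) : ℤ → ℚ)) ^ k) 1) j)
        (fun j _ => mul_nonneg (hnn j) (zero_le_one.trans (ih j))) (Finset.mem_univ w)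
  have h2 := zeroIndex_lt_finrank (f := toLin' (T.map ((↑) : ℤ → ℚ))) (fun h3 => by
    obtain ⟨i⟩ := ‹Nonempty n›
    have := key (Module.finrank ℚ (n → ℚ)) i
    rw [h3] at this
    simp at this
    linarith)
  rwa [Module.finrank_fintype_fun_eq_card] at h2

variable {m : Type*} [Fintype m] [DecidableEq m]

/-- The matrices of a quiver and of its quotient by an equitable partition. -/
theorem zeroIndex_of_quotient (T : Matrix n n ℤ) (S : Matrix m m ℤ) (p : n → m)
    (hp : Function.Surjective p) (h : ∀ v j, ∑ w with p w = j, T v w = S (p v) j) :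
    S.zeroIndex ≤ T.zeroIndex ∧
      T.zeroIndex + Fintype.card m ≤ S.zeroIndex + Fintype.card n := by
  -- Pullback along `p` embeds the functions on classes as the functions constant on classes; the
  -- row-sum hypothesis says that it intertwines `S` with `T`.
  have h1 : ∀ x, toLin' (T.map ((↑) : ℤ → ℚ)) (LinearMap.funLeft ℚ ℚ p x) =
      LinearMap.funLeft ℚ ℚ p (toLin' (S.map ((↑) : ℤ → ℚ)) x) := by
    intro x
    ext v
    simp only [toLin'_apply, mulVec, dotProduct, LinearMap.funLeft_apply, map_apply, ← h]
    rw [← Finset.sum_fiberwise _ p]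
    refine Finset.sum_congr rfl fun j _ => ?_
    push_cast
    rw [Finset.sum_mul]
    refine Finset.sum_congr rfl fun w hw => ?_
    rw [(Finset.mem_filter.1 hw).2]
  have h2 := LinearMap.funLeft_injective_of_surjective ℚ ℚ p hp
  refine ⟨zeroIndex_le_of_injective h1 h2, ?_⟩
  have := zeroIndex_add_finrank_le h1 h2
  rwa [Module.finrank_fintype_fun_eq_card, Module.finrank_fintype_fun_eq_card] at this

end Matrix

end

/-! ### The φ-dimension in terms of the arrow matrix -/

noncomputable section

universe u

section Phi

variable {R : Type u} [Ring R] [IsNoetherianRing R]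

theorem iterate_omegaBar_sub (k : ℕ) (x y : IgusaTodorovK0 R) :
    (omegaBar R)^[k] (x - y) = (omegaBar R)^[k] x - (omegaBar R)^[k] y := by
  induction k generalizing x y with
  | zero => rfl
  | succ k ih =>
    rw [Function.iterate_succ_apply, Function.iterate_succ_apply, Function.iterate_succ_apply,
      map_sub, ih]

theorem iterate_omegaBar_zero (k : ℕ) : (omegaBar R)^[k] 0 = 0 := by
  have := iterate_omegaBar_sub k (0 : IgusaTodorovK0 R) 0
  rwa [sub_self, sub_self] at this

theorem igusaTodorovPhi_le {M : FGModuleCat.{u} R} {l : ℕ}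
    (hl : ∀ s, Set.InjOn (omegaBar R)
      ((omegaBar R)^[l + s] '' (addClosure M : Set (IgusaTodorovK0 R)))) :
    igusaTodorovPhi M ≤ l :=
  Nat.sInf_le hl

/-- If φ were at most `k`, then `omegaBar` would be injective on a set containing both 0 and the
nonzero `k`-th iterate of `x`. The bound `hl` ensures that the infimum defining φ is attained and
not the default value 0 of the empty set. -/
theorem lt_igusaTodorovPhi {M : FGModuleCat.{u} R} {x : IgusaTodorovK0 R} {k l : ℕ}
    (hl : ∀ s, Set.InjOn (omegaBar R)
      ((omegaBar R)^[l + s] '' (addClosure M : Set (IgusaTodorovK0 R))))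
    (hx : x ∈ addClosure M) (h0 : (omegaBar R)^[k] x ≠ 0) (h1 : (omegaBar R)^[k + 1] x = 0) :
    k < igusaTodorovPhi M := by
  by_contra! h
  have h2 : ∀ s, Set.InjOn (omegaBar R)
      ((omegaBar R)^[igusaTodorovPhi M + s] '' (addClosure M : Set (IgusaTodorovK0 R))) :=
    Nat.sInf_mem (s := {l : ℕ | ∀ s : ℕ, Set.InjOn (omegaBar R)
      ((omegaBar R)^[l + s] '' (addClosure M : Set (IgusaTodorovK0 R)))}) ⟨l, hl⟩
  obtain ⟨d, rfl⟩ := Nat.exists_eq_add_of_le h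
  refine h0 (h2 d ⟨x, hx, rfl⟩ ⟨0, zero_mem _, iterate_omegaBar_zero _⟩ ?_)
  rw [← Function.iterate_succ_apply' (omegaBar R), h1, map_zero]

end Phi

namespace RadSqZeroBasis

variable {K V E : Type*} {R : Type u} [Field K] [Ring R] [Algebra K R] [Fintype V] [Fintype E]
  {s t : E → V} (B : RadSqZeroBasis K R s t) [IsNoetherianRing R]

theorem iterate_omegaBar_ofVec [DecidableEq V] (k : ℕ) (x : V → ℤ) :
    (omegaBar R)^[k] (B.ofVec x) = B.ofVec (Matrix.vecMul x (arrowMatrix s t ^ k)) := by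
  induction k generalizing x with
  | zero => rw [pow_zero, Matrix.vecMul_one]; rfl
  | succ k ih => rw [Function.iterate_succ_apply, omegaBar_ofVec, ih, Matrix.vecMul_vecMul, pow_succ']

include B in
open Classical in
theorem injOn_omegaBar (hs : Function.Surjective s) (M : FGModuleCat.{u} R) (j : ℕ) :
    Set.InjOn (omegaBar R) ((omegaBar R)^[(arrowMatrix s t).zeroIndex + 1 + j] ''
      (addClosure M : Set (IgusaTodorovK0 R))) := by
  rintro _ ⟨x, hx, rfl⟩ _ ⟨y, hy, rfl⟩ h
  -- The first of the `zeroIndex + 1 + j` steps is spent here, to replace the difference by an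
  -- integral vector on which `omegaBar` acts as the matrix.
  obtain ⟨z, hz⟩ := B.omegaBar_mem_range (x - y)
  rw [← sub_eq_zero, ← map_sub, ← iterate_omegaBar_sub, add_right_comm,
    Function.iterate_succ_apply, ← hz, iterate_omegaBar_ofVec, omegaBar_ofVec,
    Matrix.vecMul_vecMul, ← pow_succ] at h
  have h1 := Matrix.vecMul_pow_eq_zero _ (Nat.le_add_right _ j)
    (B.ofVec_injective hs (h.trans (map_zero _).symm))
  rw [← sub_eq_zero, ← iterate_omegaBar_sub, add_right_comm, Function.iterate_succ_apply, ← hz,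
    iterate_omegaBar_ofVec, h1, map_zero]

include B in
open Classical in
/-- The `φ`-dimension in the case that some vertex is the start of two arrows. -/
theorem phiDim_eq_zeroIndex_add_one (hs : Function.Surjective s) (ht : Function.Surjective t)
    {α β : E} (hαβ : β ≠ α) (h : s β = s α) :
    phiDim R = ((arrowMatrix s t).zeroIndex + 1 : ℕ) := by
  refine le_antisymm (iSup_le fun M => ?_) ?_
  · exact_mod_cast igusaTodorovPhi_le fun j => B.injOn_omegaBar hs M j
  · obtain ⟨M, hM⟩ := exists_forall_mem_addClosure
      (Sum.elim (fun v => B.simple v) fun γ => B.arrowQuotient γ) (by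
        rintro (v | γ)
        · exact B.isIndecomposableModule_simple v
        · exact B.isIndecomposableModule_arrowQuotient γ)
    have hM1 : ∀ v, k0Class (B.simple v) ∈ addClosure M := fun v => hM (Sum.inl v)
    have hM2 : ∀ γ, k0Class (B.arrowQuotient γ) ∈ addClosure M := fun γ => hM (Sum.inr γ)
    refine le_iSup_of_le M ?_
    suffices hk : ∃ X ∈ addClosure M, (omegaBar R)^[(arrowMatrix s t).zeroIndex] X ≠ 0 ∧
        (omegaBar R)^[(arrowMatrix s t).zeroIndex + 1] X = 0 by
      obtain ⟨X, hX, h0, h1⟩ := hk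
      exact_mod_cast lt_igusaTodorovPhi (fun j => B.injOn_omegaBar hs M j) hX h0 h1
    rcases Nat.eq_zero_or_eq_succ_pred (arrowMatrix s t).zeroIndex with hν | hν
    · obtain ⟨c, y, hc, hy⟩ := Matrix.exists_vecMul_eq_single _ hν (t α)
      refine ⟨c • k0Class (B.arrowQuotient α) - B.ofVec y, ?_, ?_, ?_⟩
      · exact sub_mem (zsmul_mem (hM2 α) _) (sum_mem fun v _ => zsmul_mem (hM1 v) _)
      · rw [hν]
        intro h0
        have hy0 : y = 0 := by
          funext w
          have := congrArg (B.multK0 hs w) h0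
          rwa [Function.iterate_zero, id_eq, map_zero, map_sub, map_zsmul,
            B.multK0_arrowQuotient hs hαβ h, smul_zero, zero_sub, neg_eq_zero,
            multK0_ofVec] at this
        rw [hy0, Matrix.zero_vecMul] at hy
        have := congrFun hy (t α)
        rw [Pi.single_eq_same] at this
        exact hc this.symm
      · rw [hν, zero_add, Function.iterate_one, map_sub, map_zsmul, omegaBar_arrowQuotient,
          omegaBar_ofVec, hy, ← B.ofVec_single, ← map_zsmul, ← Pi.single_smul, smul_eq_mul,
          mul_one, sub_self]
    · obtain ⟨x, hx1, hx0⟩ := Matrix.exists_vecMul_pow_eq_zero (arrowMatrix s t)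
        (k := (arrowMatrix s t).zeroIndex.pred) (by omega)
      choose γ hγ using ht
      have hΩ : omegaBar R (∑ v, x v • k0Class (B.arrowQuotient (γ v))) = B.ofVec x := by
        rw [map_sum, ofVec_apply]
        refine Finset.sum_congr rfl fun v _ => ?_
        rw [map_zsmul, omegaBar_arrowQuotient, hγ]
      refine ⟨∑ v, x v • k0Class (B.arrowQuotient (γ v)), sum_mem fun v _ => zsmul_mem (hM2 _) _,
        ?_, ?_⟩
      · rw [hν, Function.iterate_succ_apply, hΩ, iterate_omegaBar_ofVec]
        exact fun h0 => hx0 (B.ofVec_injective hs (h0.trans (map_zero _).symm))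
      · rw [hν, Function.iterate_succ_apply, hΩ, iterate_omegaBar_ofVec]
        exact (congrArg B.ofVec hx1).trans (map_zero _)

section Cycle

omit [IsNoetherianRing R] in
/-- If exactly one arrow starts and exactly one arrow ends at each vertex, then the projective
modules `R e_v` are injective, and split off whenever the arrow acts nontrivially. -/
theorem exists_surjective_vertexProj (hs : Function.Injective s) (ht : Function.Injective t)
    {M : Type*} [AddCommGroup M] [Module R M] [Module K M] [IsScalarTower K R M] {α : E} {x : M}
    (hx : B.a α • x ≠ 0) : ∃ g : M →ₗ[R] B.vertexProj (s α), Function.Surjective g := by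
  obtain ⟨l, hl⟩ : ∃ l : Module.Dual K M, l (B.a α • x) ≠ 0 := by
    by_contra! h
    exact hx ((Module.forall_dual_apply_eq_zero_iff K _).1 h)
  -- The map into `R e_(s α)` determined by the functional `l`. It commutes with the other arrows
  -- since none of them starts at `s α` or ends at `t α`.
  let g₀ : M →ₗ[K] R :=
    (l ∘ₗ Module.toModuleEnd K (S := R) M (B.a α)).smulRight (B.e (s α)) +
      (l ∘ₗ Module.toModuleEnd K (S := R) M (B.e (t α))).smulRight (B.a α)
  have hg₀ : ∀ m, g₀ m = l (B.a α • m) • B.e (s α) + l (B.e (t α) • m) • B.a α := fun m => rfl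
  let g₁ : M →ₗ[R] R := B.mkLinearMap g₀ (by
      intro v m
      rw [hg₀, hg₀, smul_eq_mul, mul_add, mul_smul_comm, mul_smul_comm]
      congr 1
      · by_cases h : s α = v
        · rw [← h, a_smul_e_smul_self, e_mul_self]
        · rw [B.a_smul_e_smul_of_ne h, e_mul_of_ne _ (Ne.symm h), map_zero, zero_smul, smul_zero]
      · by_cases h : t α = v
        · rw [← h, e_smul_e_smul_self, e_mul_a_self]
        · rw [B.e_smul_e_smul_of_ne h, e_mul_a_of_ne _ h, map_zero, zero_smul, smul_zero]) (by
      intro β m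
      rw [hg₀, hg₀, smul_eq_mul, mul_add, mul_smul_comm, mul_smul_comm, a_smul_a_smul, map_zero,
        zero_smul, zero_add, a_mul_a', smul_zero, add_zero]
      by_cases h : α = β
      · rw [← h, e_smul_a_smul_self, a_mul_e_self]
      · rw [B.e_smul_a_smul_of_ne (fun h' => h (ht h').symm),
          a_mul_e_of_ne _ (fun h' => h (hs h').symm), map_zero, zero_smul, smul_zero])
  have hg₁ : ∀ m, g₁ m = l (B.a α • m) • B.e (s α) + l (B.e (t α) • m) • B.a α := fun m => rfl
  refine ⟨g₁.codRestrict (B.vertexProj (s α)) fun m => ?_, ?_⟩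
  · rw [hg₁]
    exact add_mem (Submodule.smul_of_tower_mem _ _ (B.e_mem_vertexProj _))
      (Submodule.smul_of_tower_mem _ _ (B.a_mem_vertexProj _))
  · intro r
    set c := l (B.a α • x) with hc
    set d := l (B.e (t α) • x) with hd
    -- `g₁` sends `x` to `c e + d a` and `a α • x` to `c a`, so this combination is an exact
    -- preimage of the generator.
    have h1 : g₁ (c⁻¹ • (x - (d * c⁻¹) • B.a α • x)) = B.e (s α) := by
      rw [LinearMap.map_smul_of_tower, map_sub, LinearMap.map_smul_of_tower, hg₁, hg₁,
        a_smul_a_smul, map_zero, zero_smul, zero_add, e_smul_a_smul_self, ← hc, ← hd, smul_smul,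
        mul_assoc, inv_mul_cancel₀ hl, mul_one, add_sub_cancel_right, smul_smul,
        inv_mul_cancel₀ hl, one_smul]
    refine ⟨(r : R) • (c⁻¹ • (x - (d * c⁻¹) • B.a α • x)), ?_⟩
    apply Subtype.ext
    rw [LinearMap.codRestrict_apply, map_smul, h1]
    exact B.mem_vertexProj.1 r.2

/-- Whenever an arrow acts nontrivially, a projective `R e_v` splits off, which does not change the
class and lowers the dimension. What remains in the end is semisimple. -/
theorem k0Class_mem_range_of_injective (hs : Function.Injective s) (ht : Function.Injective t)
    (n : ℕ) : ∀ (M : FGModuleCat.{u} R) [Module K M] [IsScalarTower K R M],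
      Module.finrank K M ≤ n → k0Class M ∈ B.ofVec.range := by
  have := B.finite_base
  induction n with
  | zero =>
    intro M _ _ hM
    have : Module.Finite K M := Module.Finite.trans R M
    have := Module.finrank_zero_iff.1 (Nat.le_zero.1 hM)
    exact B.k0Class_mem_range_of_semisimple M fun α x => Subsingleton.elim _ _
  | succ n ih =>
    intro M _ _ hM
    have : Module.Finite K M := Module.Finite.trans R M
    by_cases h : ∀ α (x : M), B.a α • x = 0
    · exact B.k0Class_mem_range_of_semisimple M h
    push Not at h
    obtain ⟨α, x, hx⟩ := h
    obtain ⟨g, hg⟩ := B.exists_surjective_vertexProj hs ht hx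
    obtain ⟨h, hgh⟩ := Module.projective_lifting_property g LinearMap.id hg
    have hgh' : ∀ p, g (h p) = p := fun p => LinearMap.congr_fun hgh p
    have e : M ≃ₗ[R] LinearMap.ker g × B.vertexProj (s α) :=
      { toFun := fun m => (⟨m - h (g m), by rw [LinearMap.mem_ker, map_sub, hgh', sub_self]⟩, g m)
        invFun := fun y => y.1 + h y.2
        map_add' := fun x y => by
          ext
          · simp only [map_add, Prod.mk_add_mk, Submodule.coe_add]; abel
          · simp
        map_smul' := fun r x => by
          ext
          · simp [smul_sub]
          · simp
        left_inv := fun m => by simp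
        right_inv := fun y => by
          have : g (y.1 : M) = 0 := y.1.2
          ext
          · simp [hgh', this]
          · simp [hgh', this] }
    rw [k0Class_prod M (FGModuleCat.of R (LinearMap.ker g)) (FGModuleCat.of R (B.vertexProj (s α))) e]
    have : Module.Projective R (FGModuleCat.of R (B.vertexProj (s α))) :=
      inferInstanceAs (Module.Projective R (B.vertexProj (s α)))
    rw [k0Class_projective (FGModuleCat.of R (B.vertexProj (s α))), add_zero]
    let _ : Module K (FGModuleCat.of R (LinearMap.ker g)) :=
      inferInstanceAs (Module K (LinearMap.ker g))
    have : IsScalarTower K R (FGModuleCat.of R (LinearMap.ker g)) :=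
      inferInstanceAs (IsScalarTower K R (LinearMap.ker g))
    refine ih _ (Nat.le_of_lt_succ (lt_of_lt_of_le ?_ hM))
    refine Submodule.finrank_lt (s := (LinearMap.ker g).restrictScalars K) fun htop => ?_
    obtain ⟨m, hm⟩ := hg ⟨B.e (s α), B.e_mem_vertexProj _⟩
    have hm' : m ∈ (LinearMap.ker g).restrictScalars K := htop ▸ Submodule.mem_top
    have h0 : g m = 0 := hm'
    rw [h0] at hm
    exact B.e_ne_zero _ (congrArg Subtype.val hm).symm

include B in
/-- The `φ`-dimension of a cycle is zero. -/
theorem phiDim_eq_zero (hs : Function.Bijective s) (ht : Function.Bijective t) :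
    phiDim R = 0 := by
  classical
  have hrange : ∀ x, x ∈ B.ofVec.range := fun x => by
    induction x using k0_induction with
    | h0 => exact zero_mem _
    | hM M =>
      let _ : Module K M := Module.compHom M (algebraMap K R)
      have : IsScalarTower K R M := ⟨fun c r m => by rw [Algebra.smul_def, mul_smul]; rfl⟩
      exact B.k0Class_mem_range_of_injective hs.1 ht.1 _ M le_rfl
    | hadd x y hx hy => exact add_mem hx hy
    | hneg x hx => exact neg_mem hx
  have hinj : Function.Injective (omegaBar R) := by
    rw [injective_iff_map_eq_zero]
    intro X hX
    obtain ⟨x, rfl⟩ := hrange X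
    rw [omegaBar_ofVec] at hX
    have h1 := B.ofVec_injective hs.2 (hX.trans (map_zero _).symm)
    -- The matrix is a permutation matrix: the entry of the product at `t α` is the entry of `x` at
    -- `s α`.
    have hx : x = 0 := by
      funext v
      obtain ⟨α, rfl⟩ := hs.2 v
      have h2 := congrFun h1 (t α)
      rw [Matrix.vecMul, dotProduct, Finset.sum_eq_single (s α)] at h2
      · have h3 : (Finset.univ.filter fun β => s β = s α ∧ t β = t α) = {α} := by
          ext β
          simp only [Finset.mem_filter, Finset.mem_univ, true_and, Finset.mem_singleton]
          exact ⟨fun h => hs.1 h.1, fun h => by rw [h]; exact ⟨rfl, rfl⟩⟩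
        rw [arrowMatrix, Matrix.of_apply] at h2
        have h4 : (Finset.univ.filter fun β => s β = s α ∧ t β = t α).card = 1 := by
          rw [h3, Finset.card_singleton]
        have h5 : x (s α) * ((Finset.univ.filter fun β => s β = s α ∧ t β = t α).card : ℤ) = 0 := by
          exact h2
        rwa [h4, Nat.cast_one, mul_one] at h5
      · intro v _ hv
        rw [arrowMatrix, Matrix.of_apply, Finset.filter_false_of_mem]
        · simp
        · rintro β - ⟨h3, h4⟩
          rw [ht.1 h4] at h3
          exact hv h3.symm
      · simp
    rw [hx, map_zero]
  refine le_antisymm (iSup_le fun M => ?_) zero_le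
  exact_mod_cast igusaTodorovPhi_le fun j => hinj.injOn

end Cycle

theorem _root_.sum_arrowMatrix {V E : Type*} [Fintype E] [Fintype V] [DecidableEq V] (s t : E → V)
    (v : V) : ∑ w, arrowMatrix s t v w = ((Finset.univ.filter fun α => s α = v).card : ℤ) := by
  classical
  rw [Finset.card_eq_sum_card_fiberwise (f := t) (t := Finset.univ) (by simp), Nat.cast_sum]
  refine Finset.sum_congr rfl fun w _ => ?_
  rw [arrowMatrix, Matrix.of_apply, Finset.filter_filter]
  congr!

include B in
open Classical in
/-- The `φ`-dimension of the radical square zero algebra of a quiver without sources and sinks. -/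
theorem phiDim_eq (hs : Function.Surjective s) (ht : Function.Surjective t) :
    phiDim R = ((if ∀ v, ∑ w, arrowMatrix s t v w = 1 then 0 else
      (arrowMatrix s t).zeroIndex + 1 : ℕ) : ℕ∞) := by
  by_cases h : ∀ v, ∑ w, arrowMatrix s t v w = 1
  · rw [if_pos h]
    have hs' : Function.Injective s := by
      intro α β hαβ
      have h1 := h (s β)
      rw [sum_arrowMatrix, Nat.cast_eq_one, Finset.card_eq_one] at h1
      obtain ⟨γ, hγ⟩ := h1
      have h2 : α ∈ ({γ} : Finset E) := hγ ▸ by simpa using hαβ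
      have h3 : β ∈ ({γ} : Finset E) := hγ ▸ by simp
      rw [Finset.mem_singleton.1 h2, Finset.mem_singleton.1 h3]
    -- There are as many arrows as vertices, so the surjection `t` is a bijection and the quiver
    -- consists of cycles.
    have hcard := Fintype.card_of_bijective ⟨hs', hs⟩
    have ht' := (Fintype.bijective_iff_surjective_and_card t).2 ⟨ht, hcard⟩
    exact B.phiDim_eq_zero ⟨hs', hs⟩ ht'
  · rw [if_neg h]
    push Not at h
    obtain ⟨v, hv⟩ := h
    have hs' : ¬ Function.Injective s := by
      intro hinj
      apply hv
      obtain ⟨α, rfl⟩ := hs v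
      rw [sum_arrowMatrix, Nat.cast_eq_one, Finset.card_eq_one]
      refine ⟨α, ?_⟩
      ext β
      simpa using hinj.eq_iff
    simp only [Function.Injective, not_forall] at hs'
    obtain ⟨β, α, h1, h2⟩ := hs'
    exact B.phiDim_eq_zeroIndex_add_one hs ht h2 h1

end RadSqZeroBasis

end

/-! ### Supports of syzygies and cosyzygies -/

noncomputable section

universe u

theorem ModuleCat.injective_of_isSemisimpleRing {S : Type*} [Ring S] [IsSemisimpleRing S]
    (M : ModuleCat S) : CategoryTheory.Injective M :=
  Module.injective_object_of_injective_module (inj := Module.injective_of_isSemisimpleRing S M)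

namespace RadSqZeroBasis

variable {K : Type*} {R : Type u} {V E : Type*} [Field K] [Ring R] [Algebra K R] [Fintype V]
  [Fintype E] {s t : E → V} (B : RadSqZeroBasis K R s t)

/-- The semisimple algebra spanned by the vertices, as a subalgebra. -/
def vertexHom : (V → K) →+* R where
  toFun c := ∑ v, c v • B.e v
  map_one' := by simp [B.sum_e]
  map_zero' := by simp
  map_add' c d := by simp [add_smul, Finset.sum_add_distrib]
  map_mul' c d := by
    rw [Finset.sum_mul]
    refine Finset.sum_congr rfl fun v _ => ?_
    rw [Finset.mul_sum, Finset.sum_eq_single v]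
    · rw [smul_mul_smul_comm, e_mul_self, Pi.mul_apply]
    · intro w _ hw
      rw [smul_mul_smul_comm, e_mul_of_ne _ hw.symm, smul_zero]
    · simp

theorem vertexHom_apply (c : V → K) : B.vertexHom c = ∑ v, c v • B.e v := rfl

theorem ce_vertexHom (c : V → K) (v : V) : B.ce v (B.vertexHom c) = c v := by
  rw [vertexHom_apply, map_sum, Finset.sum_eq_single v]
  · rw [map_smul, ce_e_self, smul_eq_mul, mul_one]
  · intro w _ hw
    rw [map_smul, ce_e_of_ne _ hw.symm, smul_zero]
  · simp

/-- The injective module coinduced from the semisimple algebra spanned by the vertices. -/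
abbrev coinduced (M : ModuleCat.{u} R) : ModuleCat.{u} R :=
  (ModuleCat.coextendScalars.{_, u, u} B.vertexHom).obj
    ((ModuleCat.restrictScalars.{u} B.vertexHom).obj M)

/-- All modules over `K^V` are injective, and coinduction preserves injectives as the right adjoint
of the exact restriction functor. -/
theorem injective_coinduced (M : ModuleCat.{u} R) : Module.Injective R (B.coinduced M) := by
  have h2 : CategoryTheory.Injective ((ModuleCat.restrictScalars.{u} B.vertexHom).obj M) :=
    ModuleCat.injective_of_isSemisimpleRing _
  have h3 : CategoryTheory.Injective (B.coinduced M) :=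
    CategoryTheory.Injective.injective_of_adjoint
      (ModuleCat.restrictCoextendScalarsAdj.{u} B.vertexHom) _
  exact Module.injective_module_of_injective_object (inj := h3)

section Coinduced

variable (M : ModuleCat.{u} R)

/-- The function given by an element of the coinduced module. -/
def coindFun (g : B.coinduced M) : R →+ M :=
  (ModuleCat.CoextendScalars.equiv B.vertexHom _ g).toAddMonoidHom

variable {M}

theorem coindFun_smul (g : B.coinduced M) (r x : R) :
    B.coindFun M (r • g) x = B.coindFun M g (x * r) := rfl

theorem coindFun_vertexHom_mul (g : B.coinduced M) (c : V → K) (x : R) :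
    B.coindFun M g (B.vertexHom c * x) = B.vertexHom c • B.coindFun M g x :=
  (ModuleCat.CoextendScalars.equiv B.vertexHom _ g).map_smul c x

theorem coindFun_injective : Function.Injective (B.coindFun M) := fun _ _ H =>
  ModuleCat.CoextendScalars.ext (LinearMap.ext fun x => DFunLike.congr_fun H x)

variable (M) in
/-- An element of the coinduced module. -/
def coindMk (f : R →+ M) (hf : ∀ (c : V → K) x, f (B.vertexHom c * x) = B.vertexHom c • f x) :
    B.coinduced M :=
  (ModuleCat.CoextendScalars.equiv B.vertexHom _).symm
    { toFun := f
      map_add' := map_add f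
      map_smul' := hf }

theorem coindFun_coindMk (f : R →+ M) (hf) (x : R) :
    B.coindFun M (B.coindMk M f hf) x = f x := rfl

variable (M) in
/-- The embedding into the coinduced module. -/
def coindEmb : M →ₗ[R] B.coinduced M :=
  ModuleCat.RestrictionCoextensionAdj.app' B.vertexHom M

theorem coindFun_coindEmb (m : M) (x : R) : B.coindFun M (B.coindEmb M m) x = x • m := rfl

theorem coindEmb_injective : Function.Injective (B.coindEmb M) := fun x y h => by
  have := congrArg (fun g => B.coindFun M g 1) h
  simpa only [coindFun_coindEmb, one_smul] using this

theorem vertexHom_single [DecidableEq V] (v : V) (c : K) :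
    B.vertexHom (Pi.single v c) = c • B.e v := by
  rw [vertexHom_apply, Finset.sum_eq_single v]
  · rw [Pi.single_eq_same]
  · intro w _ hw
    rw [Pi.single_eq_of_ne hw, zero_smul]
  · simp

/-- Multiplication by an arrow maps the coinduced module to `M`. -/
theorem a_smul_coinduced (hM : ∀ α (x : M), B.a α • x = 0) (α : E) (g : B.coinduced M) :
    B.a α • g = B.coindEmb M (B.coindFun M g (B.a α)) := by
  classical
  refine B.coindFun_injective (AddMonoidHom.ext fun x => ?_)
  rw [coindFun_smul, coindFun_coindEmb, mul_a]
  let _ : Module K M := Module.compHom M (algebraMap K R)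
  have : IsScalarTower K R M := ⟨fun c r m => by rw [Algebra.smul_def, mul_smul]; rfl⟩
  have h1 : B.ce (t α) x • B.a α = B.vertexHom (Pi.single (t α) (B.ce (t α) x)) * B.a α := by
    rw [vertexHom_single, smul_mul_assoc, e_mul_a_self]
  have h2 : B.e (t α) • B.coindFun M g (B.a α) = B.coindFun M g (B.a α) := by
    have := B.coindFun_vertexHom_mul g (Pi.single (t α) 1) (B.a α)
    rw [vertexHom_single, one_smul, e_mul_a_self] at this
    exact this.symm
  rw [h1, coindFun_vertexHom_mul, vertexHom_single, smul_assoc, h2,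
    B.smul_of_weight h2 fun β => hM β _]

/-- Over `K^V` the ring is spanned by 1 and the arrows, so a function that vanishes on the arrows is
determined by its value at 1. -/
theorem mem_range_coindEmb (hM : ∀ α (x : M), B.a α • x = 0) {g : B.coinduced M}
    (hg : ∀ α, B.coindFun M g (B.a α) = 0) : g ∈ LinearMap.range (B.coindEmb M) := by
  classical
  refine ⟨B.coindFun M g 1, B.coindFun_injective (AddMonoidHom.ext fun x => ?_)⟩
  let _ : Module K M := Module.compHom M (algebraMap K R)
  have : IsScalarTower K R M := ⟨fun c r m => by rw [Algebra.smul_def, mul_smul]; rfl⟩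
  have h1 : ∀ (c : K) (α : E), B.coindFun M g (c • B.a α) = 0 := by
    intro c α
    have := B.coindFun_vertexHom_mul g (Pi.single (t α) c) (B.a α)
    rwa [vertexHom_single, smul_mul_assoc, e_mul_a_self, hg, smul_zero] at this
  have h2 : x = B.vertexHom (fun v => B.ce v x) * 1 + ∑ α, B.ca α x • B.a α := by
    rw [mul_one]
    exact B.decomp x
  rw [coindFun_coindEmb]
  conv_rhs => rw [h2, map_add, map_sum, Finset.sum_eq_zero fun α _ => h1 _ α, add_zero,
    coindFun_vertexHom_mul]
  conv_lhs => rw [B.smul_decomp, Finset.sum_eq_zero (s := (Finset.univ : Finset E)) fun α _ => by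
    rw [hM, smul_zero], add_zero]
  rw [vertexHom_apply, Finset.sum_smul]
  simp only [smul_assoc]

end Coinduced

/-- A semisimple module of full support has a cosyzygy of full support, if there are no sinks. -/
theorem exists_isCosyzygy (hs : Function.Surjective s) (M : ModuleCat.{u} R)
    (hM : ∀ α (x : M), B.a α • x = 0) (hsupp : ∀ v, ∃ x : M, B.e v • x ≠ 0) :
    ∃ N : ModuleCat.{u} R, IsCosyzygy M N ∧ (∀ α (x : N), B.a α • x = 0) ∧
      ∀ v, ∃ x : N, B.e v • x ≠ 0 := by
  classical
  refine ⟨ModuleCat.of R (B.coinduced M ⧸ LinearMap.range (B.coindEmb M)),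
    ⟨B.coinduced M, B.coindEmb M, B.injective_coinduced M, B.coindEmb_injective, ?_,
      ⟨LinearEquiv.refl R _⟩⟩, ?_, ?_⟩
  -- The image is essential: arrows map `L` into `L` and into the image of `M`, hence to zero, so
  -- elements of `L` vanish on arrows and lie in the image themselves.
  · intro L hL
    rw [eq_bot_iff]
    intro g hg
    have h1 : ∀ α, B.coindFun M g (B.a α) = 0 := by
      intro α
      have h2 : B.a α • g ∈ L ⊓ LinearMap.range (B.coindEmb M) :=
        ⟨L.smul_mem _ hg, _, (B.a_smul_coinduced hM α g).symm⟩
      rw [hL, Submodule.mem_bot, a_smul_coinduced B hM] at h2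
      exact B.coindEmb_injective (h2.trans (map_zero _).symm)
    rw [← hL]
    exact ⟨hg, B.mem_range_coindEmb hM h1⟩
  · intro α x
    obtain ⟨g, rfl⟩ := Submodule.Quotient.mk_surjective _ x
    refine (Submodule.Quotient.mk_eq_zero _).2 ?_
    exact ⟨_, (B.a_smul_coinduced hM α g).symm⟩
  · intro v
    obtain ⟨α, rfl⟩ := hs v
    obtain ⟨x, hx⟩ := hsupp (t α)
    let _ : Module K M := Module.compHom M (algebraMap K R)
    have : IsScalarTower K R M := ⟨fun c r m => by rw [Algebra.smul_def, mul_smul]; rfl⟩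
    -- The function supported on the single arrow `α`. Its class has a nonzero part of weight `s α`,
    -- because functions in the image of `M` vanish on arrows and this one does not.
    let f : R →+ M := ((B.ca α).smulRight (B.e (t α) • x)).toAddMonoidHom
    have hf : ∀ r, f r = B.ca α r • B.e (t α) • x := fun r => rfl
    have hca : ∀ (c : V → K) r, B.ca α (B.vertexHom c * r) = c (t α) * B.ca α r := by
      intro c r
      conv_lhs => rw [B.decomp r, mul_add, Finset.mul_sum, Finset.mul_sum, map_add, map_sum, map_sum]
      rw [Finset.sum_eq_zero, zero_add, Finset.sum_eq_single α]
      · rw [mul_smul_comm, mul_a, ce_vertexHom, map_smul, map_smul, ca_a_self, smul_eq_mul,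
          smul_eq_mul, mul_one, mul_comm]
      · intro β _ hβ
        rw [mul_smul_comm, mul_a, map_smul, map_smul, ca_a_of_ne _ hβ.symm, smul_zero, smul_zero]
      · simp
      · intro w _
        rw [mul_smul_comm, vertexHom_apply, Finset.sum_mul, Finset.sum_eq_single w]
        · rw [smul_mul_assoc, e_mul_self, map_smul, map_smul, ca_e, smul_zero, smul_zero]
        · intro w' _ hw
          rw [smul_mul_assoc, e_mul_of_ne _ hw, smul_zero]
        · simp
    let g := B.coindMk M f (by
      intro c r
      rw [hf, hf, hca, B.smul_of_weight (v := t α) (m := B.ca α r • B.e (t α) • x) (by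
        rw [smul_comm, e_smul_e_smul_self]) (fun β => hM β _), ce_vertexHom, smul_smul])
    refine ⟨(Submodule.Quotient.mk g :
      B.coinduced M ⧸ LinearMap.range (B.coindEmb M)), fun h => ?_⟩
    obtain ⟨m, hm⟩ := (Submodule.Quotient.mk_eq_zero _).1 h
    have h1 := congrArg (fun g => B.coindFun M g (B.a α)) hm
    change B.coindFun M (B.coindEmb M m) (B.a α) = B.coindFun M (B.e (s α) • g) (B.a α) at h1
    rw [coindFun_coindEmb, hM, coindFun_smul, a_mul_e_self, coindFun_coindMk, hf, ca_a_self,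
      one_smul] at h1
    exact hx h1.symm

/-- A semisimple module of full support has a syzygy of full support, if there are no sources. -/
theorem exists_isSyzygy [IsNoetherianRing R] (ht : Function.Surjective t) (M : ModuleCat.{u} R)
    [Module.Finite R M] (hM : ∀ α (x : M), B.a α • x = 0) (hsupp : ∀ v, ∃ x : M, B.e v • x ≠ 0) :
    ∃ N : ModuleCat.{u} R, IsSyzygy M N ∧ Module.Finite R N ∧ (∀ α (x : N), B.a α • x = 0) ∧
      ∀ v, ∃ x : N, B.e v • x ≠ 0 := by
  obtain ⟨P, f, hP, hP', hf, hker⟩ := B.exists_cover M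
  refine ⟨ModuleCat.of R (LinearMap.ker f), ⟨P, f, hP, hf, ?_, ⟨LinearEquiv.refl R _⟩⟩,
    inferInstanceAs (Module.Finite R (LinearMap.ker f)), ?_, ?_⟩
  · intro L hL
    refine B.eq_top_of_sup_rad ?_
    rw [eq_top_iff, ← hL]
    exact sup_le_sup_left hker L
  · intro α x
    exact Subtype.ext (B.a_smul_of_mem_rad (hker x.2) α)
  · intro v
    obtain ⟨α, rfl⟩ := ht v
    obtain ⟨x, hx⟩ := hsupp (s α)
    obtain ⟨p, rfl⟩ := hf x
    -- The element `a α • p` is the witness of weight `t α`. If it were zero, projectivity would put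
    -- `e (s α) • p` into the radical, and its image in the semisimple `M` would vanish.
    have h1 : B.a α • p ∈ LinearMap.ker f := by
      rw [LinearMap.mem_ker, map_smul, hM]
    refine ⟨⟨B.a α • p, h1⟩, fun h => hx ?_⟩
    have h2 : B.a α • p = 0 := by
      rw [← e_smul_a_smul_self]
      exact congrArg Subtype.val h
    obtain ⟨y, hy⟩ := B.map_mem_rad f (B.e_smul_mem_rad_of_projective h2)
    rw [← map_smul, hy]
    exact Finset.sum_eq_zero fun β _ => hM β _

theorem exists_isNthSyzygy [IsNoetherianRing R] (ht : Function.Surjective t) (M : ModuleCat.{u} R)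
    [Module.Finite R M] (hM : ∀ α (x : M), B.a α • x = 0) (hsupp : ∀ v, ∃ x : M, B.e v • x ≠ 0)
    (n : ℕ) : ∃ N : ModuleCat.{u} R, IsNthSyzygy n M N ∧ Module.Finite R N ∧
      (∀ α (x : N), B.a α • x = 0) ∧ ∀ v, ∃ x : N, B.e v • x ≠ 0 := by
  induction n with
  | zero => exact ⟨M, ⟨LinearEquiv.refl R M⟩, inferInstance, hM, hsupp⟩
  | succ n ih =>
    obtain ⟨L, hL, _, hL2, hL3⟩ := ih
    obtain ⟨N, hN, hN'⟩ := B.exists_isSyzygy ht L hL2 hL3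
    exact ⟨N, ⟨L, hL, hN⟩, hN'⟩

theorem exists_isNthCosyzygy (hs : Function.Surjective s) (M : ModuleCat.{u} R)
    (hM : ∀ α (x : M), B.a α • x = 0) (hsupp : ∀ v, ∃ x : M, B.e v • x ≠ 0)
    (n : ℕ) : ∃ N : ModuleCat.{u} R, IsNthCosyzygy n M N ∧
      (∀ α (x : N), B.a α • x = 0) ∧ ∀ v, ∃ x : N, B.e v • x ≠ 0 := by
  induction n with
  | zero => exact ⟨M, ⟨LinearEquiv.refl R M⟩, hM, hsupp⟩
  | succ n ih =>
    obtain ⟨L, hL, hL2, hL3⟩ := ih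
    obtain ⟨N, hN, hN'⟩ := B.exists_isCosyzygy hs L hL2 hL3
    exact ⟨N, ⟨L, hL, hN⟩, hN'⟩

/-- A superfluous submodule is contained in the radical. -/
theorem le_rad_of_superfluous {P : Type*} [AddCommGroup P] [Module R P] {S : Submodule R P}
    (hS : ∀ L : Submodule R P, L ⊔ S = ⊤ → L = ⊤) : S ≤ B.rad P := by
  by_contra h
  obtain ⟨y, hy, hy'⟩ := SetLike.not_le_iff_exists.1 h
  let _ : Module K P := Module.compHom P (algebraMap K R)
  have : IsScalarTower K R P := ⟨fun c r m => by rw [Algebra.smul_def, mul_smul]; rfl⟩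
  obtain ⟨w, hw⟩ : ∃ w, B.e w • y ∉ B.rad P := by
    by_contra! h1
    exact hy' (B.sum_e_smul y ▸ sum_mem fun v _ => h1 v)
  obtain ⟨l, hl⟩ : ∃ l : Module.Dual K (P ⧸ B.rad P), l ((B.rad P).mkQ (B.e w • y)) ≠ 0 := by
    by_contra! h
    exact hw ((Submodule.Quotient.mk_eq_zero _).1 ((Module.forall_dual_apply_eq_zero_iff K _).1 h))
  -- A maximal submodule that contains the radical and avoids `e w • y`. As `S` contains `e w • y`,
  -- the two span `P`, against superfluity.
  let L : Submodule R P :=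
    { carrier := {z | l (B.e w • (B.rad P).mkQ z) = 0}
      zero_mem' := by simp
      add_mem' := by
        intro x z hx hz
        change l (B.e w • (B.rad P).mkQ _) = 0 at *
        rw [map_add, smul_add, map_add, hx, hz, add_zero]
      smul_mem' := by
        intro r z hz
        change l (B.e w • (B.rad P).mkQ _) = 0 at *
        rw [LinearMap.map_smul (B.rad P).mkQ, B.smul_decomp r, Finset.sum_eq_zero (s := (Finset.univ : Finset E)) fun α _ =>
          by rw [a_smul_quotient_rad, smul_zero], add_zero, Finset.smul_sum,
          Finset.sum_eq_single w]
        · rw [smul_comm, e_smul_e_smul_self, map_smul, hz, smul_zero]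
        · intro v _ hv
          rw [smul_comm, B.e_smul_e_smul_of_ne hv.symm, smul_zero]
        · simp }
  have hL : ∀ z, z ∈ L ↔ l (B.e w • (B.rad P).mkQ z) = 0 := fun z => Iff.rfl
  have h1 : L = ⊤ := by
    refine hS L ?_
    rw [eq_top_iff]
    intro z _
    set c := l (B.e w • (B.rad P).mkQ z) * (l ((B.rad P).mkQ (B.e w • y)))⁻¹ with hc
    rw [← sub_add_cancel z (c • B.e w • y)]
    refine Submodule.add_mem_sup ?_ (Submodule.smul_of_tower_mem _ _ (S.smul_mem _ hy))
    rw [hL, map_sub, smul_sub, map_sub, LinearMap.map_smul_of_tower (B.rad P).mkQ, smul_comm, map_smul l c,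
      ← LinearMap.map_smul (B.rad P).mkQ (B.e w) (B.e w • y), e_smul_e_smul_self, hc, smul_eq_mul, mul_assoc,
      inv_mul_cancel₀ hl, mul_one, sub_self]
  have h2 : B.e w • y ∈ L := h1 ▸ Submodule.mem_top
  rw [hL, ← LinearMap.map_smul (B.rad P).mkQ, e_smul_e_smul_self] at h2
  exact hl h2

/-- A minimal syzygy lies in the radical, and all weights of a radical are ends of arrows. -/
theorem exists_arrow_of_isSyzygy {M N : ModuleCat.{u} R} (h : IsSyzygy M N) {v : V} {x : N}
    (hx : B.e v • x ≠ 0) : ∃ α, t α = v := by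
  obtain ⟨P, f, -, -, hP, ⟨e⟩⟩ := h
  obtain ⟨y, hy⟩ := B.le_rad_of_superfluous hP (e x).2
  by_contra! hα
  apply hx
  apply e.injective
  rw [map_zero, map_smul]
  apply Subtype.ext
  rw [Submodule.coe_smul, hy, Finset.smul_sum]
  exact Finset.sum_eq_zero fun α _ => B.e_smul_a_smul_of_ne (hα α) _

/-- At a sink `v` an element of weight `v` spans a submodule of dimension at most one. If it lies
outside the image of `M`, this submodule meets the image trivially, against essentiality. -/
theorem exists_arrow_of_isCosyzygy {M N : ModuleCat.{u} R} (h : IsCosyzygy M N) {v : V} {x : N}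
    (hx : B.e v • x ≠ 0) : ∃ α, s α = v := by
  obtain ⟨I, i, -, -, hI, ⟨e⟩⟩ := h
  by_contra! hα
  obtain ⟨y, hy⟩ := Submodule.Quotient.mk_surjective _ (e x)
  have h1 : B.e v • y ∉ LinearMap.range i := by
    intro h
    apply hx
    apply e.injective
    rw [map_zero, map_smul, ← hy, ← Submodule.Quotient.mk_smul, Submodule.Quotient.mk_eq_zero]
    exact h
  let _ : Module K I := Module.compHom I (algebraMap K R)
  have : IsScalarTower K R I := ⟨fun c r m => by rw [Algebra.smul_def, mul_smul]; rfl⟩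
  have h2 : Submodule.span R {B.e v • y} = ⊥ := by
    refine hI _ ?_
    rw [eq_bot_iff]
    rintro z ⟨hz, hz'⟩
    obtain ⟨r, rfl⟩ := Submodule.mem_span_singleton.1 hz
    rw [SetLike.mem_coe, B.smul_of_weight (B.e_smul_e_smul_self v y) fun α =>
      B.a_smul_e_smul_of_ne (hα α) y] at hz'
    rw [B.smul_of_weight (B.e_smul_e_smul_self v y) fun α =>
      B.a_smul_e_smul_of_ne (hα α) y]
    by_cases hc : B.ce v r = 0
    · rw [hc, zero_smul]
      exact zero_mem _
    · refine absurd ?_ h1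
      rw [← one_smul K (B.e v • y), ← inv_mul_cancel₀ hc, mul_smul]
      exact Submodule.smul_of_tower_mem _ _ hz'
  rw [Submodule.span_singleton_eq_bot] at h2
  exact h1 (h2 ▸ zero_mem _)

end RadSqZeroBasis

end

/-! ### The basis of the radical square zero algebra of a path algebra, and the member -/

noncomputable section

namespace PathAlgebra

variable {K : Type*} {V : Type*} [Field K] [Quiver V]

variable (K) in
/-- The coefficient of a path. -/
def coeff (q : QuiverPath V) : PathAlgebra K V →ₗ[K] K :=
  (Finsupp.lapply q : (QuiverPath V →₀ K) →ₗ[K] K)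

open Classical in
theorem coeff_ofPath (p q : QuiverPath V) : coeff K q (ofPath K p) = if p = q then 1 else 0 := by
  change (Finsupp.single p (1 : K)) q = _
  rw [Finsupp.single_apply]

theorem coeff_ofPath_self (q : QuiverPath V) : coeff K q (ofPath K q) = 1 := by
  rw [coeff_ofPath, if_pos rfl]

theorem coeff_ofPath_of_ne {p q : QuiverPath V} (h : p ≠ q) : coeff K q (ofPath K p) = 0 := by
  rw [coeff_ofPath, if_neg h]

/-- The length of a path. -/
def _root_.QuiverPath.length (p : QuiverPath V) : ℕ := p.path.length

/-- The path of length zero at a vertex. -/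
def _root_.QuiverPath.nil (v : V) : QuiverPath V := ⟨v, v, Quiver.Path.nil⟩

/-- The path of an arrow. -/
def _root_.QuiverPath.ofArrow {v w : V} (α : v ⟶ w) : QuiverPath V := ⟨v, w, α.toPath⟩

theorem _root_.QuiverPath.ne_of_length {p q : QuiverPath V} (h : p.length ≠ q.length) : p ≠ q :=
  fun h' => h (congrArg _ h')

theorem _root_.QuiverPath.cons_ne_nil {a b c : V} (p : Quiver.Path a b) (α : b ⟶ c) (v : V) :
    (⟨a, c, p.cons α⟩ : QuiverPath V) ≠ .nil v :=
  QuiverPath.ne_of_length (Nat.succ_ne_zero p.length)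

theorem bilinear_induction {P : PathAlgebra K V → PathAlgebra K V → Prop}
    (h0 : ∀ g, P 0 g) (h0' : ∀ f, P f 0) (hadd : ∀ f f' g, P f g → P f' g → P (f + f') g)
    (hadd' : ∀ f g g', P f g → P f g' → P f (g + g'))
    (hp : ∀ (c d : K) p q, P (c • ofPath K p) (d • ofPath K q)) (f g : PathAlgebra K V) :
    P f g := by
  induction f using induction_on with
  | h0 => exact h0 g
  | hadd f f' h h' => exact hadd _ _ _ h h'
  | hp c p =>
    induction g using induction_on with
    | h0 => exact h0' _
    | hadd g g' h h' => exact hadd' _ _ _ h h'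
    | hp d q => exact hp c d p q

theorem coeff_nil_mul (v : V) (f g : PathAlgebra K V) :
    coeff K (.nil v) (f * g) = coeff K (.nil v) f * coeff K (.nil v) g := by
  induction f, g using bilinear_induction with
  | h0 g => rw [zero_mul', map_zero, zero_mul]
  | h0' f => rw [mul_zero', map_zero, mul_zero]
  | hadd f f' g h h' => rw [add_mul', map_add, map_add, h, h', add_mul]
  | hadd' f g g' h h' => rw [mul_add', map_add, map_add, h, h', mul_add]
  | hp c d p q =>
    rw [smul_mul', mul_smul', map_smul, map_smul, map_smul, map_smul, smul_mul_smul_comm, smul_smul]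
    congr 1
    obtain ⟨a, b, p⟩ := p
    obtain ⟨b', z, q⟩ := q
    by_cases hb : b = b'
    · subst hb
      rw [ofPath_mul_ofPath]
      cases q with
      | nil =>
        rw [Quiver.Path.comp_nil]
        by_cases h : (⟨a, b, p⟩ : QuiverPath V) = .nil v
        · have h2 : b = v := congrArg QuiverPath.tgt h
          subst h2
          exact (mul_one _).symm.trans
            (congrArg _ (coeff_ofPath_self (K := K) (QuiverPath.nil b)).symm)
        · rw [coeff_ofPath_of_ne h, zero_mul]
      | cons q α =>
        rw [Quiver.Path.comp_cons, coeff_ofPath_of_ne (QuiverPath.cons_ne_nil _ _ v),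
          coeff_ofPath_of_ne (QuiverPath.cons_ne_nil _ _ v), mul_zero]
    · rw [ofPath_mul_ofPath_of_ne _ _ hb, map_zero]
      by_cases h : (⟨a, b, p⟩ : QuiverPath V) = .nil v
      · rw [coeff_ofPath_of_ne (p := ⟨b', z, q⟩), mul_zero]
        intro h'
        exact hb ((congrArg QuiverPath.tgt h).trans (congrArg QuiverPath.src h').symm)
      · rw [coeff_ofPath_of_ne h, zero_mul]

/-- An arrow factors only as itself times the trivial path at either end, which gives a Leibniz
rule. -/
theorem coeff_ofArrow_mul {v w : V} (α : v ⟶ w) (f g : PathAlgebra K V) :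
    coeff K (.ofArrow α) (f * g) = coeff K (.nil v) f * coeff K (.ofArrow α) g +
      coeff K (.ofArrow α) f * coeff K (.nil w) g := by
  induction f, g using bilinear_induction with
  | h0 g => simp only [zero_mul', map_zero, zero_mul, add_zero]
  | h0' f => simp only [mul_zero', map_zero, mul_zero, add_zero]
  | hadd f f' g h h' => rw [add_mul', map_add, map_add, map_add, h, h']; ring
  | hadd' f g g' h h' => rw [mul_add', map_add, map_add, map_add, h, h']; ring
  | hp c d p q =>
    rw [smul_mul', mul_smul', map_smul, map_smul, map_smul, map_smul, map_smul, map_smul,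
      smul_mul_smul_comm, smul_mul_smul_comm, smul_smul, ← smul_add]
    congr 1
    obtain ⟨a, b, p⟩ := p
    obtain ⟨b', z, q⟩ := q
    by_cases hb : b = b'
    · subst hb
      rw [ofPath_mul_ofPath]
      cases q with
      | nil =>
        rw [Quiver.Path.comp_nil, coeff_ofPath_of_ne (p := ⟨b, b, Quiver.Path.nil⟩)
          (q := .ofArrow α) (QuiverPath.ne_of_length (zero_ne_one)), mul_zero, zero_add]
        by_cases h : (⟨a, b, p⟩ : QuiverPath V) = .ofArrow α
        · have h2 : b = w := congrArg QuiverPath.tgt h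
          subst h2
          exact (mul_one _).symm.trans
            (congrArg _ (coeff_ofPath_self (K := K) (QuiverPath.nil b)).symm)
        · rw [coeff_ofPath_of_ne h, zero_mul]
      | cons q β =>
        rw [coeff_ofPath_of_ne (QuiverPath.cons_ne_nil _ _ w),
          mul_zero, add_zero]
        cases p with
        | nil =>
          rw [Quiver.Path.nil_comp]
          by_cases h : (⟨a, z, q.cons β⟩ : QuiverPath V) = .ofArrow α
          · have h2 : a = v := congrArg QuiverPath.src h
            subst h2
            exact (one_mul _).symm.trans
              (congrArg (· * _) (coeff_ofPath_self (K := K) (QuiverPath.nil a)).symm)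
          · rw [coeff_ofPath_of_ne h, mul_zero]
        | cons p γ =>
          rw [coeff_ofPath_of_ne (QuiverPath.cons_ne_nil _ _ v),
            zero_mul, coeff_ofPath_of_ne]
          apply QuiverPath.ne_of_length
          change (Quiver.Path.comp (p.cons γ) (q.cons β)).length ≠ 1
          rw [Quiver.Path.length_comp, Quiver.Path.length_cons, Quiver.Path.length_cons]
          omega
    · rw [ofPath_mul_ofPath_of_ne _ _ hb, map_zero]
      have h1 : coeff K (.nil v) (ofPath K ⟨a, b, p⟩) *
          coeff K (.ofArrow α) (ofPath K ⟨b', z, q⟩) = 0 := by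
        by_cases h : (⟨a, b, p⟩ : QuiverPath V) = .nil v
        · rw [coeff_ofPath_of_ne (p := ⟨b', z, q⟩), mul_zero]
          intro h'
          exact hb ((congrArg QuiverPath.tgt h).trans (congrArg QuiverPath.src h').symm)
        · rw [coeff_ofPath_of_ne h, zero_mul]
      have h2 : coeff K (.ofArrow α) (ofPath K ⟨a, b, p⟩) *
          coeff K (.nil w) (ofPath K ⟨b', z, q⟩) = 0 := by
        by_cases h : (⟨a, b, p⟩ : QuiverPath V) = .ofArrow α
        · rw [coeff_ofPath_of_ne (p := ⟨b', z, q⟩), mul_zero]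
          intro h'
          exact hb ((congrArg QuiverPath.tgt h).trans (congrArg QuiverPath.src h').symm)
        · rw [coeff_ofPath_of_ne h, zero_mul]
      rw [h1, h2, add_zero]

variable [Finite V]

theorem coeff_nil_of_mem_arrowIdeal {f : PathAlgebra K V} (hf : f ∈ arrowIdeal K V) (v : V) :
    coeff K (.nil v) f = 0 := by
  -- By multiplicativity of the coefficient this kernel is a two-sided ideal; it contains the arrows
  -- and hence the ideal they generate.
  let I : TwoSidedIdeal (PathAlgebra K V) := TwoSidedIdeal.mk' {f | coeff K (.nil v) f = 0}
    (map_zero _)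
    (by
      intro x y hx hy
      change coeff K (.nil v) _ = 0 at *
      rw [map_add, hx, hy, add_zero])
    (by
      intro x hx
      change coeff K (.nil v) _ = 0 at *
      rw [map_neg, hx, neg_zero])
    (by
      intro x y hy
      change coeff K (.nil v) _ = 0 at *
      rw [coeff_nil_mul, hy, mul_zero])
    (by
      intro x y hx
      change coeff K (.nil v) _ = 0 at *
      rw [coeff_nil_mul, hx, zero_mul])
  have hI : ∀ x, x ∈ I ↔ coeff K (.nil v) x = 0 := fun x => by
    rw [TwoSidedIdeal.mem_mk']
    rfl
  rw [arrowIdeal, TwoSidedIdeal.mem_asIdeal] at hf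
  refine (hI f).1 (TwoSidedIdeal.span_le.2 ?_ hf)
  rintro _ ⟨a, b, α, rfl⟩
  exact (hI _).2 (coeff_ofPath_of_ne (QuiverPath.ne_of_length (one_ne_zero)))

/-- Coefficients at paths of length at most one descend to `K Q / J²`, so vertices and arrows stay
linearly independent there. -/
theorem coeff_of_mem_arrowIdeal_sq {f : PathAlgebra K V} (hf : f ∈ arrowIdeal K V ^ 2) :
    (∀ v, coeff K (.nil v) f = 0) ∧ ∀ (v w : V) (α : v ⟶ w), coeff K (.ofArrow α) f = 0 := by
  rw [Submodule.pow_succ, Submodule.pow_one] at hf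
  induction hf using Submodule.mul_induction_on' with
  | mem_mul_mem x hx y hy =>
    refine ⟨fun v => ?_, fun v w α => ?_⟩
    · rw [coeff_nil_mul, coeff_nil_of_mem_arrowIdeal hx, zero_mul]
    · rw [coeff_ofArrow_mul, coeff_nil_of_mem_arrowIdeal hx, coeff_nil_of_mem_arrowIdeal hy,
        zero_mul, mul_zero, add_zero]
  | add x _ y _ hx hy =>
    refine ⟨fun v => ?_, fun v w α => ?_⟩
    · rw [map_add, hx.1, hy.1, add_zero]
    · rw [map_add, hx.2, hy.2, add_zero]

end PathAlgebra

namespace RadSqZero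

variable {K : Type*} {V : Type*} [Field K] [Quiver V] [Finite V]

variable (V) in
/-- The arrows of a quiver. -/
abbrev Arrow := Σ v w : V, v ⟶ w

variable (K V) in
/-- The vertices and arrows in the path algebra. -/
def generator : V ⊕ Arrow V → PathAlgebra K V :=
  Sum.elim (PathAlgebra.vertex K) fun α => PathAlgebra.arrow K α.2.2

/-- The path of a vertex or an arrow. -/
def generatorPath : V ⊕ Arrow V → QuiverPath V :=
  Sum.elim .nil fun α => .ofArrow α.2.2

omit [Finite V] in
theorem generatorPath_injective : Function.Injective (generatorPath (V := V)) := by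
  rintro (v | ⟨v, w, α⟩) (v' | ⟨v', w', α'⟩) h
  · rw [show v = v' from congrArg QuiverPath.src h]
  · exact absurd h (QuiverPath.ne_of_length (zero_ne_one))
  · exact absurd h (QuiverPath.ne_of_length (one_ne_zero))
  · obtain rfl : v = v' := congrArg QuiverPath.src h
    obtain rfl : w = w' := congrArg QuiverPath.tgt h
    have h1 : (α.toPath : Quiver.Path v w) = α'.toPath := by
      have := (QuiverPath.mk.injEq _ _ _ _ _ _).mp h
      exact eq_of_heq this.2.2
    have h2 : α = α' := eq_of_heq (Quiver.Path.hom_heq_of_cons_eq_cons h1)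
    rw [h2]

omit [Finite V] in
theorem generator_eq (i : V ⊕ Arrow V) :
    generator K V i = PathAlgebra.ofPath K (generatorPath i) := by
  rcases i with v | α <;> rfl

theorem coeff_of_mk_eq_zero {f : PathAlgebra K V}
    (hf : Ideal.Quotient.mk (PathAlgebra.arrowIdeal K V ^ 2) f = 0) (i : V ⊕ Arrow V) :
    PathAlgebra.coeff K (generatorPath i) f = 0 := by
  have := PathAlgebra.coeff_of_mem_arrowIdeal_sq (Ideal.Quotient.eq_zero_iff_mem.1 hf)
  rcases i with v | α
  · exact this.1 v
  · exact this.2 _ _ α.2.2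

theorem span_generator : Submodule.span K (Set.range fun i : V ⊕ Arrow V =>
    Ideal.Quotient.mk (PathAlgebra.arrowIdeal K V ^ 2) (generator K V i)) = ⊤ := by
  rw [eq_top_iff]
  intro x _
  obtain ⟨f, rfl⟩ := Ideal.Quotient.mk_surjective x
  induction f using PathAlgebra.induction_on with
  | h0 => rw [map_zero]; exact Submodule.zero_mem _
  | hadd f g hf hg => rw [map_add]; exact Submodule.add_mem _ (hf trivial) (hg trivial)
  | hp c p =>
    have hsm : Ideal.Quotient.mk (PathAlgebra.arrowIdeal K V ^ 2) (c • PathAlgebra.ofPath K p) =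
        c • Ideal.Quotient.mk (PathAlgebra.arrowIdeal K V ^ 2) (PathAlgebra.ofPath K p) := rfl
    rw [hsm]
    refine Submodule.smul_mem _ _ ?_
    obtain ⟨a, b, p⟩ := p
    cases p with
    | nil => exact Submodule.subset_span ⟨Sum.inl a, rfl⟩
    | cons p α =>
      cases p with
      | nil => exact Submodule.subset_span ⟨Sum.inr ⟨_, _, α⟩, rfl⟩
      | cons p β =>
        have h0 : Ideal.Quotient.mk (PathAlgebra.arrowIdeal K V ^ 2)
            (PathAlgebra.ofPath K ⟨a, b, (p.cons β).cons α⟩) = 0 := by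
          rw [Ideal.Quotient.eq_zero_iff_mem]
          have h : PathAlgebra.ofPath K ⟨a, b, (p.cons β).cons α⟩ =
              PathAlgebra.ofPath K ⟨a, _, p.cons β⟩ * PathAlgebra.arrow K α := by
            rw [PathAlgebra.arrow, PathAlgebra.ofPath_mul_ofPath]; rfl
          rw [h, Submodule.pow_succ, Submodule.pow_one]
          exact Ideal.mul_mem_mul (cons_mem _ _) (arrow_mem _)
        rw [h0]
        exact Submodule.zero_mem _

variable (K V) in
/-- The basis of the radical square zero algebra consisting of the vertices and the arrows. -/
def generatorBasis [Fintype V] [Fintype (Arrow V)] :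
    Module.Basis (V ⊕ Arrow V) K (RadSqZero K V) :=
  Module.Basis.mk (v := fun i => Ideal.Quotient.mk _ (generator K V i)) (by
    rw [Fintype.linearIndependent_iff]
    intro c hc i
    have h1 : Ideal.Quotient.mk (PathAlgebra.arrowIdeal K V ^ 2) (∑ i, c i • generator K V i) = 0 := by
      rw [← hc, map_sum]
      rfl
    have h2 := coeff_of_mk_eq_zero h1 i
    rw [map_sum, Finset.sum_eq_single i, map_smul, generator_eq, PathAlgebra.coeff_ofPath_self,
      smul_eq_mul, mul_one] at h2
    · exact h2
    · intro j _ hj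
      rw [map_smul, generator_eq,
        PathAlgebra.coeff_ofPath_of_ne (generatorPath_injective.ne hj), smul_zero]
    · simp) span_generator.ge

open MulOpposite in
variable (K V) in
/-- The radical square zero algebra as an instance of the abstract description. -/
def radSqZeroBasis [Fintype V] [Fintype (Arrow V)] :
    RadSqZeroBasis K (RadSqZero K V)ᵐᵒᵖ (fun α : Arrow V => α.1) fun α : Arrow V => α.2.1 := by
  have hbasis : ∀ i, (generatorBasis K V).map (opLinearEquiv K) i =
      op (Ideal.Quotient.mk _ (generator K V i)) := fun i => by
    rw [Module.Basis.map_apply, generatorBasis, Module.Basis.mk_apply]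
    rfl
  refine
    { basis := (generatorBasis K V).map (opLinearEquiv K)
      one_eq := ?_
      e_mul_e := ?_
      a_mul_e := ?_
      e_mul_a := ?_
      a_mul_a := ?_ }
  · simp only [hbasis]
    rw [← Finset.op_sum, ← map_sum]
    exact congrArg (fun x => op (Ideal.Quotient.mk (PathAlgebra.arrowIdeal K V ^ 2) x))
      PathAlgebra.one_def
  · intro v w
    rw [hbasis, hbasis, ← op_mul, ← map_mul]
    split_ifs with h
    · subst h
      congr 2
      exact PathAlgebra.ofPath_mul_ofPath _ _
    · rw [show generator K V (Sum.inl w) * generator K V (Sum.inl v) = 0 from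
        PathAlgebra.ofPath_mul_ofPath_of_ne _ _ (Ne.symm h), map_zero, op_zero]
  · rintro ⟨a, b, α⟩ v
    rw [hbasis, hbasis, ← op_mul, ← map_mul]
    split_ifs with h
    · change a = v at h
      subst h
      congr 2
      refine (PathAlgebra.ofPath_mul_ofPath _ _).trans ?_
      rw [Quiver.Path.nil_comp]
      rfl
    · rw [show generator K V (Sum.inl v) * generator K V (Sum.inr ⟨a, b, α⟩) = 0 from
        PathAlgebra.ofPath_mul_ofPath_of_ne _ _ (Ne.symm h), map_zero, op_zero]
  · rintro v ⟨a, b, α⟩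
    rw [hbasis, hbasis, ← op_mul, ← map_mul]
    split_ifs with h
    · change b = v at h
      subst h
      congr 2
      exact PathAlgebra.ofPath_mul_ofPath _ _
    · rw [show generator K V (Sum.inr ⟨a, b, α⟩) * generator K V (Sum.inl v) = 0 from
        PathAlgebra.ofPath_mul_ofPath_of_ne _ _ h, map_zero, op_zero]
  · intro α β
    rw [hbasis, hbasis, ← op_mul, ← map_mul, ← op_zero]
    congr 1
    rw [Ideal.Quotient.eq_zero_iff_mem, Submodule.pow_succ, Submodule.pow_one]
    exact Ideal.mul_mem_mul (arrow_mem _) (arrow_mem _)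

theorem radSqZeroBasis_e [Fintype V] [Fintype (Arrow V)] (v : V) :
    (radSqZeroBasis K V).e v = MulOpposite.op (vertex K v) :=
  ((generatorBasis K V).map_apply (MulOpposite.opLinearEquiv K) _).trans
    (congrArg MulOpposite.op (Module.Basis.mk_apply _ _ _))

theorem radSqZeroBasis_a [Fintype V] [Fintype (Arrow V)] (α : Arrow V) :
    (radSqZeroBasis K V).a α = MulOpposite.op (arrow K α.2.2) :=
  ((generatorBasis K V).map_apply (MulOpposite.opLinearEquiv K) _).trans
    (congrArg MulOpposite.op (Module.Basis.mk_apply _ _ _))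

variable (K V) in
/-- The projection onto `K Q / J`. -/
def toTop : PathAlgebra K V →+ SemisimpleTop K V :=
  (Ideal.Quotient.mk (PathAlgebra.arrowIdeal K V)).toAddMonoidHom

theorem toTop_surjective : Function.Surjective (toTop K V) := Ideal.Quotient.mk_surjective

theorem toTop_eq_zero_iff {f : PathAlgebra K V} :
    toTop K V f = 0 ↔ f ∈ PathAlgebra.arrowIdeal K V := Ideal.Quotient.eq_zero_iff_mem

theorem op_smul_toTop (r f : PathAlgebra K V) :
    MulOpposite.op (Ideal.Quotient.mk (PathAlgebra.arrowIdeal K V ^ 2) r) • toTop K V f =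
      toTop K V (f * r) := rfl

instance : Module.Finite (RadSqZero K V)ᵐᵒᵖ (SemisimpleTop K V) := by
  refine Module.Finite.of_surjective (LinearMap.toSpanSingleton (RadSqZero K V)ᵐᵒᵖ
    (SemisimpleTop K V) (toTop K V 1)) fun x => ?_
  obtain ⟨f, rfl⟩ := toTop_surjective x
  refine ⟨MulOpposite.op (Ideal.Quotient.mk (PathAlgebra.arrowIdeal K V ^ 2) f), ?_⟩
  rw [LinearMap.toSpanSingleton_apply, op_smul_toTop, one_mul]

theorem arrow_smul_semisimpleTop (α : Arrow V) (x : SemisimpleTop K V) :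
    MulOpposite.op (arrow K α.2.2) • x = 0 := by
  obtain ⟨f, rfl⟩ := toTop_surjective x
  rw [arrow, op_smul_toTop]
  exact toTop_eq_zero_iff.2 (Ideal.mul_mem_left _ _ (arrow_mem _))

theorem exists_vertex_smul_ne_zero (v : V) :
    ∃ x : SemisimpleTop K V, MulOpposite.op (vertex K v) • x ≠ 0 := by
  refine ⟨toTop K V 1, fun h => ?_⟩
  rw [vertex, op_smul_toTop, one_mul] at h
  have := PathAlgebra.coeff_nil_of_mem_arrowIdeal (toTop_eq_zero_iff.1 h) v
  exact one_ne_zero ((PathAlgebra.coeff_ofPath_self (K := K) (QuiverPath.nil v)).symm.trans this)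

/-- The member is empty if and only if there are no sources and no sinks. -/
theorem member_eq_empty_iff [∀ v w : V, Finite (v ⟶ w)] [Nonempty V] :
    member K V = ∅ ↔ Function.Surjective (fun α : Arrow V => α.1) ∧
      Function.Surjective fun α : Arrow V => α.2.1 := by
  let _ := Fintype.ofFinite V
  let _ := Fintype.ofFinite (Arrow V)
  rw [member, Set.compl_empty_iff, Set.eq_univ_iff_forall]
  let B := radSqZeroBasis K V
  constructor
  · intro h
    -- The number of vertices is positive, so at least one syzygy and one cosyzygy step is taken,
    -- and the last step yields the arrow.
    obtain ⟨n, hn⟩ := Nat.exists_eq_succ_of_ne_zero (Nat.card_pos (α := V)).ne'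
    constructor
    · intro v
      obtain ⟨-, N, hN, x, hx⟩ := h v
      rw [hn] at hN
      obtain ⟨L, -, hL⟩ := hN
      rw [← radSqZeroBasis_e] at hx
      exact B.exists_arrow_of_isCosyzygy hL hx
    · intro v
      obtain ⟨⟨N, hN, x, hx⟩, -⟩ := h v
      rw [hn] at hN
      obtain ⟨L, -, hL⟩ := hN
      rw [← radSqZeroBasis_e] at hx
      exact B.exists_arrow_of_isSyzygy hL hx
  · rintro ⟨hs, ht⟩ v
    let M := ModuleCat.of (RadSqZero K V)ᵐᵒᵖ (SemisimpleTop K V)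
    have : Module.Finite (RadSqZero K V)ᵐᵒᵖ M :=
      inferInstanceAs (Module.Finite (RadSqZero K V)ᵐᵒᵖ (SemisimpleTop K V))
    have h1 : ∀ α (x : M), B.a α • x = 0 := fun α x => by
      rw [radSqZeroBasis_a]
      exact arrow_smul_semisimpleTop α x
    have h2 : ∀ v, ∃ x : M, B.e v • x ≠ 0 := fun v => by
      rw [radSqZeroBasis_e]
      exact exists_vertex_smul_ne_zero v
    constructor
    · obtain ⟨N, hN, -, -, hN'⟩ := B.exists_isNthSyzygy ht M h1 h2 (Nat.card V)
      refine ⟨N, hN, ?_⟩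
      obtain ⟨x, hx⟩ := hN' v
      exact ⟨x, by rwa [← radSqZeroBasis_e]⟩
    · obtain ⟨N, hN, -, hN'⟩ := B.exists_isNthCosyzygy hs M h1 h2 (Nat.card V)
      refine ⟨N, hN, ?_⟩
      obtain ⟨x, hx⟩ := hN' v
      exact ⟨x, by rwa [← radSqZeroBasis_e]⟩

end RadSqZero

end

/-! ### Quotient quivers and the proof of the theorem -/

noncomputable section

namespace RadSqZero

variable {K V : Type*} [Field K] [Quiver V] [Finite V] [∀ v w : V, Finite (v ⟶ w)]

variable (V) in
/-- The matrix with the numbers of arrows between the vertices as entries. -/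
def adjMatrix : Matrix V V ℤ := Matrix.of fun v w => (Nat.card (v ⟶ w) : ℤ)

omit [Finite V] [∀ v w : V, Finite (v ⟶ w)] in
theorem arrowMatrix_eq [Fintype (Arrow V)] :
    arrowMatrix (fun α : Arrow V => α.1) (fun α : Arrow V => α.2.1) = adjMatrix V := by
  classical
  ext v w
  rw [arrowMatrix, adjMatrix, Matrix.of_apply, Matrix.of_apply, ← Fintype.card_subtype,
    ← Nat.card_eq_fintype_card]
  congr 1
  refine (Nat.card_congr (Equiv.ofBijective (fun α => ⟨⟨v, w, α⟩, rfl, rfl⟩) ⟨?_, ?_⟩)).symm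
  · intro α β h
    simpa using h
  · rintro ⟨⟨a, b, α⟩, h1, h2⟩
    dsimp only at h1 h2
    subst h1 h2
    exact ⟨α, rfl⟩

/-- Each vertex is the start of an arrow and the end of an arrow. -/
def NoSourcesSinks (V : Type*) [Quiver V] : Prop :=
  (∀ v : V, ∃ w : V, Nonempty (v ⟶ w)) ∧ ∀ w : V, ∃ v : V, Nonempty (v ⟶ w)

theorem member_eq_empty_iff_noSourcesSinks [Nonempty V] :
    member K V = ∅ ↔ NoSourcesSinks V := by
  rw [member_eq_empty_iff]
  refine and_congr (forall_congr' fun v => ?_) (forall_congr' fun v => ?_)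
  · constructor
    · rintro ⟨⟨a, b, α⟩, rfl⟩
      exact ⟨b, ⟨α⟩⟩
    · rintro ⟨w, ⟨α⟩⟩
      exact ⟨⟨v, w, α⟩, rfl⟩
  · constructor
    · rintro ⟨⟨a, b, α⟩, rfl⟩
      exact ⟨a, ⟨α⟩⟩
    · rintro ⟨w, ⟨α⟩⟩
      exact ⟨⟨w, v, α⟩, rfl⟩

open Classical in
theorem phiDim_eq [Fintype V] [Nonempty V] (h : NoSourcesSinks V) :
    phiDim (RadSqZero K V)ᵐᵒᵖ = ((if ∀ v : V, ∑ w, adjMatrix V v w = 1 then 0 else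
      (adjMatrix V).zeroIndex + 1 : ℕ) : ℕ∞) := by
  let _ := Fintype.ofFinite (Arrow V)
  obtain ⟨hs, ht⟩ := member_eq_empty_iff.1 (member_eq_empty_iff_noSourcesSinks (K := K).2 h)
  rw [(radSqZeroBasis K V).phiDim_eq hs ht, arrowMatrix_eq]

omit [Finite V] in
theorem zeroIndex_adjMatrix_lt [Fintype V] [DecidableEq V] [Nonempty V] (h : NoSourcesSinks V) :
    (adjMatrix V).zeroIndex < Nat.card V := by
  rw [Nat.card_eq_fintype_card]
  refine Matrix.zeroIndex_lt_card _ (fun v w => Int.natCast_nonneg _) fun v => ?_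
  obtain ⟨w, hw⟩ := h.1 v
  exact ⟨w, Int.natCast_ne_zero.2 Nat.card_pos.ne'⟩

theorem hasMaximalPhiDim_iff [Nonempty V] (h : NoSourcesSinks V) :
    HasMaximalPhiDim K V ↔ phiDim (RadSqZero K V)ᵐᵒᵖ = Nat.card V := by
  have := member_eq_empty_iff_noSourcesSinks (K := K).2 h
  exact ⟨fun h' => h'.1 this, fun h' => ⟨fun _ => h', fun h'' => absurd this h''⟩⟩

variable {π : Setoid V} (hπ : IsEquitable π)

/-- The class of a vertex, as a vertex of the quotient quiver. -/
def toQuotient (v : V) : QuotientQuiver π hπ := Quotient.mk π v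

omit [Finite V] [∀ v w : V, Finite (v ⟶ w)] in
theorem toQuotient_surjective : Function.Surjective (toQuotient hπ) := Quotient.mk_surjective

omit [Finite V] [∀ v w : V, Finite (v ⟶ w)] in
theorem card_hom_toQuotient (v : V) (C : QuotientQuiver π hπ) :
    Nat.card (toQuotient hπ v ⟶ C) = arrowsToClass π v C := Nat.card_fin _

theorem noSourcesSinks_quotient (h : NoSourcesSinks V) : NoSourcesSinks (QuotientQuiver π hπ) := by
  have key : ∀ v w : V, Nonempty (v ⟶ w) → Nonempty (toQuotient hπ v ⟶ toQuotient hπ w) := by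
    rintro v w ⟨α⟩
    have h1 : Nat.card (toQuotient hπ v ⟶ toQuotient hπ w) ≠ 0 := by
      rw [card_hom_toQuotient]
      have : Nonempty {α : (Σ w : V, v ⟶ w) // Quotient.mk π α.1 = toQuotient hπ w} :=
        ⟨⟨⟨w, α⟩, rfl⟩⟩
      exact Nat.card_pos.ne'
    exact (Nat.card_ne_zero.1 h1).1
  constructor
  · intro C
    obtain ⟨v, rfl⟩ := toQuotient_surjective hπ C
    obtain ⟨w, hw⟩ := h.1 v
    exact ⟨_, key v w hw⟩
  · intro C
    obtain ⟨w, rfl⟩ := toQuotient_surjective hπ C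
    obtain ⟨v, hv⟩ := h.2 w
    exact ⟨_, key v w hv⟩

omit [Finite V] in
open Classical in
theorem sum_adjMatrix_quotient [Fintype V] (v : V) (C : QuotientQuiver π hπ) :
    ∑ w with toQuotient hπ w = C, adjMatrix V v w =
      adjMatrix (QuotientQuiver π hπ) (toQuotient hπ v) C := by
  rw [adjMatrix, adjMatrix, Matrix.of_apply, card_hom_toQuotient]
  unfold arrowsToClass
  simp only [Matrix.of_apply]
  rw [← Nat.cast_sum]
  congr 1
  let e : {α : (Σ w : V, v ⟶ w) // Quotient.mk π α.1 = C} ≃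
      Σ w : {w : V // toQuotient hπ w = C}, v ⟶ w.1 :=
    { toFun := fun α => ⟨⟨α.1.1, α.2⟩, α.1.2⟩
      invFun := fun α => ⟨⟨α.1.1, α.2⟩, α.1.2⟩
      left_inv := fun _ => rfl
      right_inv := fun _ => rfl }
  rw [Nat.card_congr e, Nat.card_sigma]
  exact Finset.sum_subtype _ (by simp) fun w => Nat.card (v ⟶ w)

end RadSqZero

end

theorem theorem4p34 {K V : Type*} [Field K] [Quiver V] [Finite V] [∀ v w : V, Finite (v ⟶ w)]
    (hconn : IsConnectedQuiver V) (hmember : member K V = ∅) :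
    (∀ (π : Setoid V) (hπ : IsEquitable π), ∃ p q : ℕ,
      phiDim (RadSqZero K V)ᵐᵒᵖ = p ∧
      phiDim (RadSqZero K (QuotientQuiver π hπ))ᵐᵒᵖ = q ∧
      (Nat.card (QuotientQuiver π hπ) : ℤ) - q ≤ (Nat.card V : ℤ) - p) ∧
    (HasMaximalPhiDim K V ↔
      ∀ (π : Setoid V) (hπ : IsEquitable π), HasMaximalPhiDim K (QuotientQuiver π hπ)) := by
  classical
  have := Fintype.ofFinite V
  have : Nonempty V := hconn.1
  have hV := RadSqZero.member_eq_empty_iff_noSourcesSinks.1 hmember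
  have hlt := RadSqZero.zeroIndex_adjMatrix_lt hV
  have key : ∀ (π : Setoid V) (hπ : IsEquitable π), ∃ (q ν : ℕ),
      RadSqZero.NoSourcesSinks (QuotientQuiver π hπ) ∧ Nonempty (QuotientQuiver π hπ) ∧
      phiDim (RadSqZero K (QuotientQuiver π hπ))ᵐᵒᵖ = q ∧
      q = (if ∀ v : V, ∑ w, RadSqZero.adjMatrix V v w = 1 then 0 else ν + 1) ∧
      ν < Nat.card (QuotientQuiver π hπ) ∧ ν ≤ (RadSqZero.adjMatrix V).zeroIndex ∧
      (RadSqZero.adjMatrix V).zeroIndex + Nat.card (QuotientQuiver π hπ) ≤ ν + Nat.card V ∧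
      Nat.card (QuotientQuiver π hπ) ≤ Nat.card V := by
    intro π hπ
    have := Fintype.ofFinite (QuotientQuiver π hπ)
    have hne : Nonempty (QuotientQuiver π hπ) := ‹Nonempty V›.map (RadSqZero.toQuotient hπ)
    have hW := RadSqZero.noSourcesSinks_quotient hπ hV
    -- The number of arrows that start at `v` equals the number that start at its class, so the
    -- exceptional case holds for both quivers or for neither.
    have hsum : (∀ C : QuotientQuiver π hπ, ∑ D, RadSqZero.adjMatrix (QuotientQuiver π hπ) C D = 1) ↔
        ∀ v : V, ∑ w, RadSqZero.adjMatrix V v w = 1 := by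
      rw [(RadSqZero.toQuotient_surjective hπ).forall]
      refine forall_congr' fun v => ?_
      rw [← Finset.sum_fiberwise _ (RadSqZero.toQuotient hπ)]
      simp only [RadSqZero.sum_adjMatrix_quotient]
    obtain ⟨h1, h2⟩ := Matrix.zeroIndex_of_quotient (RadSqZero.adjMatrix V)
      (RadSqZero.adjMatrix (QuotientQuiver π hπ)) (RadSqZero.toQuotient hπ) (RadSqZero.toQuotient_surjective hπ)
      (RadSqZero.sum_adjMatrix_quotient hπ)
    refine ⟨_, (RadSqZero.adjMatrix (QuotientQuiver π hπ)).zeroIndex, hW, hne, RadSqZero.phiDim_eq hW, ?_,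
      RadSqZero.zeroIndex_adjMatrix_lt hW, h1, ?_, Nat.card_le_card_of_surjective _ (RadSqZero.toQuotient_surjective hπ)⟩
    · simp only [hsum]
    · rwa [Nat.card_eq_fintype_card, Nat.card_eq_fintype_card]
  constructor
  · intro π hπ
    obtain ⟨q, ν, -, -, hq, hq', h1, h2, h3, h4⟩ := key π hπ
    refine ⟨_, q, RadSqZero.phiDim_eq hV, hq, ?_⟩
    rw [hq']
    -- In the exceptional case both φ-dimensions are 0 and the claim is m ≤ n; otherwise it is the
    -- comparison of the indices.
    split_ifs
    · simp only [Nat.cast_zero, sub_zero]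
      exact_mod_cast h4
    · push_cast
      omega
  · rw [RadSqZero.hasMaximalPhiDim_iff hV, RadSqZero.phiDim_eq hV, Nat.cast_inj]
    have hpos : 0 < Nat.card V := Nat.card_pos
    constructor
    · intro h π hπ
      obtain ⟨q, ν, hW, _, hq, hq', h1, h2, h3, h4⟩ := key π hπ
      rw [RadSqZero.hasMaximalPhiDim_iff hW, hq, Nat.cast_inj, hq']
      -- The exceptional case would give n = 0. Otherwise ν(T) = n - 1, so the comparison gives ν(S)
      -- ≥ m - 1, and ν(S) < m is known.
      split_ifs at h ⊢
      · omega
      · omega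
    · intro h
      -- The partition into single vertices has m = n, and ν(S) ≤ ν(T) < n then transfers maximality
      -- from the quotient to `Q`.
      have hbot : IsEquitable (⊥ : Setoid V) := by
        intro v v' hv C
        rw [show v = v' from hv]
      obtain ⟨q, ν, hW, _, hq, hq', h1, h2, h3, h4⟩ := key ⊥ hbot
      have hmax := h ⊥ hbot
      rw [RadSqZero.hasMaximalPhiDim_iff hW, hq, Nat.cast_inj, hq'] at hmax
      have hcard : Nat.card V ≤ Nat.card (QuotientQuiver ⊥ hbot) :=
        Nat.card_le_card_of_injective (RadSqZero.toQuotient hbot) fun v w hvw => Quotient.exact hvw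
      split_ifs at hmax ⊢
      · omega
      · omega
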